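/- Let $k$ be an algebraically closed field of characteristic $p>0$, and let $X$, $Y$ be normal projective varieties over $k$. Let $f:X\to Y$ be a separable fibration over $k$, that is, a (projective) morphism with $f_*\mathcal{O}_X=\mathcal{O}_Y$ such that the field extension $K(X)/K(Y)$ is separable. Denote by $\eta$ the generic point of $Y$, by $X_\eta$ the generic fibre (a projective variety over $k(\eta)$), and by $F_Y^e:Y\to Y$ the $e$-th iterate of the absolute Frobenius. A $\mathbb{Q}$-Cartier divisor is an element of $\mathrm{CDiv}\otimes\mathbb{Q}$. For a $\mathbb{Q}$-Cartier divisor $B$ on a normal projective variety $V$ over a field, $\kappa(V,B)$ is the maximum of $\dim\Phi_{|mB|}(V)$ over the integers $m>0$ such that $mB$ is Cartier and $|mB|\neq\emptyset$, and $\kappa(V,B)=-\infty$ if there is no such $m$; $B$ is big if $\kappa(V,B)=\dim V$. A coherent sheaf $\mathcal{G}$ on $Y$ is generically globally generated if $H^0(Y,\mathcal{G})\to\mathcal{G}\otimes k(y)$ is surjective for all closed points $y$ of some non-empty open subset of $Y$. A torsion free coherent sheaf $\mathcal{F}$ on $Y$ is Frobenius weakly positive (FWP) if, for an ample $\mathbb{Q}$-Cartier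 divisor $A$ on $Y$, there are positive integers $n_e$ ($e=1,2,\dots$) such that $n_eA$ is Cartier, $F_Y^{e*}\mathcal{F}\otimes\mathcal{O}_Y(n_eA)$ is generically globally generated, and $n_e/p^e\to 0$ as $e\to\infty$. Let $D$ be a Cartier divisor on $X$, and assume that for some positive integer $e$ the sheaf $F_Y^{e*}f_*\mathcal{O}_X(D)$ contains a non-zero FWP subsheaf. Then for every big $\mathbb{Q}$-Cartier divisor $H$ on $Y$, $$\kappa(X,D+f^*H)\ \geq\ \kappa(X_\eta,D|_{X_\eta})+\dim Y .$$ -/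

import Mathlib

open CategoryTheory AlgebraicGeometry TopologicalSpace Opposite TensorProduct

universe u

namespace FWPKod
noncomputable section

section Cartier
variable (X : Scheme.{u}) [IsIntegral X]

/-- The image of the units of `𝒪_{X,x}` in `K(X)ˣ`. -/
def stalkUnits (x : X) : Subgroup (X.functionField)ˣ :=
  (Units.map (algebraMap (X.presheaf.stalk x) X.functionField).toMonoidHom).range

/-- The group of Cartier divisors of an integral scheme, i.e. of global sections of the sheaf
`𝒦ˣ/𝒪ˣ`, written multiplicatively through local equations: the families of classes in the stalks
`K(X)ˣ/𝒪_{X,x}ˣ` that are locally given by one rational function. -/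
def cartierSubgroup : Subgroup (∀ x : X, (X.functionField)ˣ ⧸ stalkUnits X x) where
  carrier := {D | ∀ x : X, ∃ U : X.Opens, x ∈ U ∧ ∃ g : (X.functionField)ˣ,
    ∀ y ∈ U, D y = QuotientGroup.mk g}
  one_mem' x := ⟨⊤, trivial, 1, fun _ _ => rfl⟩
  mul_mem' {D E} hD hE x := by
    obtain ⟨U, hU, g, hg⟩ := hD x
    obtain ⟨V, hV, h, hh⟩ := hE x
    exact ⟨U ⊓ V, ⟨hU, hV⟩, g * h, fun y hy => by
      rw [Pi.mul_apply, hg y hy.1, hh y hy.2]; rfl⟩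
  inv_mem' {D} hD x := by
    obtain ⟨U, hU, g, hg⟩ := hD x
    exact ⟨U, hU, g⁻¹, fun y hy => by rw [Pi.inv_apply, hg y hy]; rfl⟩

instance : CommGroup (cartierSubgroup X) where
  mul_comm D E := Subtype.ext (funext fun x => by
    obtain ⟨g, hg⟩ := QuotientGroup.mk_surjective (D.1 x)
    obtain ⟨h, hh⟩ := QuotientGroup.mk_surjective (E.1 x)
    change D.1 x * E.1 x = E.1 x * D.1 x
    rw [← hg, ← hh, ← QuotientGroup.mk_mul, ← QuotientGroup.mk_mul, mul_comm])

/-- The additive group `CDiv(X)` of Cartier divisors. -/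
abbrev CDiv : Type u := Additive (cartierSubgroup X)

/-- The `ℚ`-vector space `CDiv(X) ⊗ ℚ` of `ℚ`-Cartier divisors. -/
abbrev QCDiv : Type u := ℚ ⊗[ℤ] CDiv X

variable {X}

/-- The class of the local equations of `D` at `x`. -/
def CDiv.germ (D : CDiv X) (x : X) : (X.functionField)ˣ ⧸ stalkUnits X x := (D.toMul).1 x

lemma mem_of_mk_eq {x : X} {g h : (X.functionField)ˣ}
    (e : (QuotientGroup.mk g : (X.functionField)ˣ ⧸ stalkUnits X x) = QuotientGroup.mk h)
    {φ : X.functionField}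
    (hφ : φ * g ∈ (algebraMap (X.presheaf.stalk x) X.functionField).range) :
    φ * h ∈ (algebraMap (X.presheaf.stalk x) X.functionField).range := by
  obtain ⟨u, hu⟩ := QuotientGroup.eq.mp e
  have : (h : X.functionField) = g * algebraMap (X.presheaf.stalk x) X.functionField u := by
    have h2 : h = g * Units.map (algebraMap (X.presheaf.stalk x) X.functionField).toMonoidHom u := by
      rw [hu]; simp
    rw [h2]; rfl
  rw [this, ← mul_assoc]
  exact mul_mem hφ ⟨_, rfl⟩

/-- The stalk `𝒪_X(D)_x ⊆ K(X)`: the rational functions `φ` with `φ g ∈ 𝒪_{X,x}` for a local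
equation `g` of `D` at `x`. -/
def CDiv.stalk (D : CDiv X) (x : X) : Submodule (X.presheaf.stalk x) X.functionField where
  carrier := {φ | ∃ g : (X.functionField)ˣ, D.germ x = QuotientGroup.mk g ∧
    φ * g ∈ (algebraMap (X.presheaf.stalk x) X.functionField).range}
  zero_mem' := by
    obtain ⟨g, hg⟩ := QuotientGroup.mk_surjective (D.germ x)
    exact ⟨g, hg.symm, by rw [zero_mul]; exact zero_mem _⟩
  add_mem' {φ ψ} := by
    rintro ⟨g, hg, h1⟩ ⟨h, hh, h2⟩
    have := mem_of_mk_eq (hh.symm.trans hg) h2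
    exact ⟨g, hg, by rw [add_mul]; exact add_mem h1 this⟩
  smul_mem' r φ := by
    rintro ⟨g, hg, h1⟩
    refine ⟨g, hg, ?_⟩
    rw [Algebra.smul_def, mul_assoc]
    exact mul_mem ⟨_, rfl⟩ h1

/-- `φ` generates `𝒪_X(D)` at `x`: `φ g ∈ 𝒪_{X,x}ˣ` for a local equation `g` of `D`. -/
def CDiv.Generates (D : CDiv X) (φ : X.functionField) (x : X) : Prop :=
  ∃ v : (X.functionField)ˣ, (v : X.functionField) = φ ∧ D.germ x = QuotientGroup.mk v⁻¹

end Cartier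

section Sheaf
variable {X : Scheme.{u}} [IsIntegral X]

/-- The value in `K(X)` at `x ∈ U` of a regular function on `U`. -/
def toFunctionField (U : X.Opens) : Γ(X, U) →+* (U → X.functionField) :=
  RingHom.pi fun x => (algebraMap (X.presheaf.stalk x.1) X.functionField).comp
    (X.presheaf.germ U x.1 x.2).hom

/-- Being a section of `𝒪_X(D)`: locally constant with values in the stalks of `𝒪_X(D)`. -/
def CDiv.localPredicate (D : CDiv X) :
    TopCat.LocalPredicate (X := (X : TopCat.{u})) (fun _ => (X.functionField : Type u)) where
  pred {U} s := ∀ x : U, s x ∈ D.stalk x.1 ∧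
    ∃ V : Opens X, x.1 ∈ V ∧ ∀ y : U, y.1 ∈ V → s y = s x
  res {U V} i s hs x := by
    obtain ⟨h1, W, hW, h2⟩ := hs (i x)
    exact ⟨h1, W, hW, fun y hy => h2 (i y) hy⟩
  locality {U} s hs x := by
    obtain ⟨V, hV, i, h⟩ := hs x
    obtain ⟨h1, W, hW, h2⟩ := h ⟨x.1, hV⟩
    exact ⟨h1, V ⊓ W, ⟨hV, hW⟩, fun y hy => h2 ⟨y.1, hy.1⟩ hy.2⟩

/-- The sections over `U` of `𝒪_X(D)`. -/
def CDiv.sections (D : CDiv X) (U : X.Opens) : AddSubgroup (U → X.functionField) where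
  carrier := {s | D.localPredicate.pred s}
  zero_mem' x := ⟨zero_mem _, ⊤, trivial, fun _ _ => rfl⟩
  add_mem' {s t} hs ht x := by
    obtain ⟨h1, V, hV, h2⟩ := hs x
    obtain ⟨k1, W, hW, k2⟩ := ht x
    exact ⟨add_mem h1 k1, V ⊓ W, ⟨hV, hW⟩, fun y hy => by
      rw [Pi.add_apply, Pi.add_apply, h2 y hy.1, k2 y hy.2]⟩
  neg_mem' {s} hs x := by
    obtain ⟨h1, V, hV, h2⟩ := hs x
    exact ⟨neg_mem h1, V, hV, fun y hy => by rw [Pi.neg_apply, Pi.neg_apply, h2 y hy]⟩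

lemma toFunctionField_const (U : X.Opens) (r : Γ(X, U)) (x y : U) :
    toFunctionField U r x = toFunctionField U r y := by
  have : Nonempty U := ⟨x⟩
  have key : ∀ z : U, toFunctionField U r z = X.germToFunctionField U r := fun z =>
    Scheme.algebraMap_germ_eq_germToFunctionField X z.2 r
  rw [key, key]

instance (D : CDiv X) (U : X.Opens) : Module Γ(X, U) (D.sections U) where
  smul r s := ⟨toFunctionField U r * s.1, fun x => by
    obtain ⟨h1, V, hV, h2⟩ := s.2 x
    refine ⟨?_, V, hV, fun y hy => ?_⟩
    · have := (D.stalk x.1).smul_mem (X.presheaf.germ U x.1 x.2 r) h1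
      rwa [Algebra.smul_def] at this
    · rw [Pi.mul_apply, Pi.mul_apply, h2 y hy, toFunctionField_const U r y x]⟩
  one_smul s := Subtype.ext (by change toFunctionField U 1 * s.1 = s.1; simp)
  mul_smul r t s := Subtype.ext (by
    change toFunctionField U (r * t) * s.1 = toFunctionField U r * (toFunctionField U t * s.1)
    rw [map_mul, mul_assoc])
  smul_zero r := Subtype.ext (mul_zero _)
  smul_add r s t := Subtype.ext (mul_add _ _ _)
  add_smul r t s := Subtype.ext (by
    change toFunctionField U (r + t) * s.1 = toFunctionField U r * s.1 + toFunctionField U t * s.1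
    rw [map_add, add_mul])
  zero_smul s := Subtype.ext (by change toFunctionField U 0 * s.1 = 0; simp)

/-- The underlying presheaf of abelian groups of `𝒪_X(D)`. -/
def CDiv.presheaf (D : CDiv X) : TopCat.Presheaf Ab.{u} X where
  obj U := AddCommGrpCat.of (D.sections U.unop)
  map {U V} i := AddCommGrpCat.ofHom
    { toFun := fun s => ⟨fun x => s.1 (i.unop x), D.localPredicate.res i.unop s.1 s.2⟩
      map_zero' := rfl
      map_add' := fun _ _ => rfl }

lemma CDiv.presheaf_isSheaf (D : CDiv X) : D.presheaf.IsSheaf := by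
  rw [TopCat.Presheaf.isSheaf_iff_isSheaf_comp (forget Ab.{u})]
  exact TopCat.subpresheafToTypes.isSheaf D.localPredicate

instance (D : CDiv X) (U : (Opens X)ᵒᵖ) :
    Module (X.ringCatSheaf.obj.obj U) (D.presheaf.obj U) :=
  inferInstanceAs (Module Γ(X, U.unop) (D.sections U.unop))

/-- The invertible sheaf `𝒪_X(D)`. -/
def CDiv.sheaf (D : CDiv X) : X.Modules where
  val := PresheafOfModules.ofPresheaf D.presheaf (fun U V i r s => by
    apply Subtype.ext
    funext x
    change toFunctionField U.unop r (i.unop x) * s.1 (i.unop x) =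
      toFunctionField V.unop (X.presheaf.map i r) x * s.1 (i.unop x)
    congr 1
    exact congrArg (algebraMap (X.presheaf.stalk x.1) X.functionField)
      (X.presheaf.germ_res_apply i.unop x.1 x.2 r).symm)
  isSheaf := D.presheaf_isSheaf

end Sheaf

section Pullback
variable {X Y : Scheme.{u}} [IsIntegral X] [IsIntegral Y] (f : X ⟶ Y) [IsDominant f]

lemma map_genericPoint : f (genericPoint X) = genericPoint Y := by
  have h := (genericPoint_spec X).image f.continuous
  rw [Set.image_univ, f.denseRange.closure_range] at h
  exact h.eq (genericPoint_spec Y)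

/-- The inclusion of function fields `K(Y) → K(X)` of a dominant morphism `f : X ⟶ Y`. -/
def functionFieldMap : Y.functionField →+* X.functionField :=
  (Y.presheaf.stalkSpecializes (specializes_of_eq (map_genericPoint f)) ≫
    f.stalkMap (genericPoint X)).hom

lemma functionFieldMap_algebraMap (x : X) (r : Y.presheaf.stalk (f x)) :
    functionFieldMap f (algebraMap (Y.presheaf.stalk (f x)) Y.functionField r) =
      algebraMap (X.presheaf.stalk x) X.functionField (f.stalkMap x r) := by
  have h : genericPoint X ⤳ x := genericPoint_specializes x
  have h1 := Scheme.Hom.stalkSpecializes_stalkMap f (genericPoint X) x h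
  have h2 : Y.presheaf.stalkSpecializes (genericPoint_specializes (f x)) ≫
      Y.presheaf.stalkSpecializes (specializes_of_eq (map_genericPoint f)) =
      Y.presheaf.stalkSpecializes (h.map f.continuous) := by
    rw [TopCat.Presheaf.stalkSpecializes_comp]
  have h3 := h1
  rw [← h2, Category.assoc] at h3
  exact congr($h3 r)

/-- The pull-back map on local equations, `K(Y)ˣ/𝒪_{Y,f(x)}ˣ → K(X)ˣ/𝒪_{X,x}ˣ`. -/
def pullbackGerm (x : X) : ((Y.functionField)ˣ ⧸ stalkUnits Y (f x)) →*
    ((X.functionField)ˣ ⧸ stalkUnits X x) :=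
  QuotientGroup.map _ _ (Units.map (functionFieldMap f).toMonoidHom) (by
    rintro _ ⟨u, rfl⟩
    refine ⟨Units.map (f.stalkMap x).hom.toMonoidHom u, Units.ext ?_⟩
    exact (functionFieldMap_algebraMap f x u).symm)

/-- The pull-back `f^* : CDiv(Y) → CDiv(X)` along a dominant morphism of integral schemes. -/
def CDiv.pullback : CDiv Y →+ CDiv X :=
  MonoidHom.toAdditive
    { toFun := fun D => ⟨fun x => pullbackGerm f x (D.1 (f x)), fun x => by
        obtain ⟨U, hU, g, hg⟩ := D.2 (f x)
        exact ⟨f ⁻¹ᵁ U, hU, Units.map (functionFieldMap f).toMonoidHom g, fun y hy => by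
          exact congrArg (pullbackGerm f y) (hg (f y) hy)⟩⟩
      map_one' := Subtype.ext (funext fun x => map_one (pullbackGerm f x))
      map_mul' := fun D E => Subtype.ext (funext fun x =>
        map_mul (pullbackGerm f x) (D.1 (f x)) (E.1 (f x))) }

/-- The pull-back `f^* : CDiv(Y) ⊗ ℚ → CDiv(X) ⊗ ℚ`. -/
def QCDiv.pullback : QCDiv Y →ₗ[ℤ] QCDiv X :=
  (CDiv.pullback f).toIntLinearMap.lTensor ℚ

/-- The dominant morphism `f` is separable: the extension `K(X)/K(Y)` is separable (not
necessarily algebraic), i.e. `K(X) ⊗ L` is reduced for an algebraic closure `L` of `K(Y)`. -/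
def IsSeparableMorphism : Prop :=
  letI : Algebra Y.functionField X.functionField := (functionFieldMap f).toAlgebra
  Algebra.IsGeometricallyReduced Y.functionField X.functionField

end Pullback

section Fiber
variable {X Y : Scheme.{u}} [IsIntegral X] [IsIntegral Y] (f : X ⟶ Y) [IsDominant f]

lemma flat_fromSpecResidueField_genericPoint (Y : Scheme.{u}) [IsIntegral Y] :
    Flat (Y.fromSpecResidueField (genericPoint Y)) := by
  refine Flat.of_stalkMap _ fun z => ?_
  have hz : Y.fromSpecResidueField (genericPoint Y) z = genericPoint Y := by
    have : Y.fromSpecResidueField (genericPoint Y) z ∈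
        Set.range (Y.fromSpecResidueField (genericPoint Y)) := ⟨z, rfl⟩
    rwa [Scheme.range_fromSpecResidueField] at this
  have hF : IsField (Y.presheaf.stalk (Y.fromSpecResidueField (genericPoint Y) z)) := by
    rw [hz]
    exact Field.toIsField Y.functionField
  let _ := hF.toField
  let _ := ((Y.fromSpecResidueField (genericPoint Y)).stalkMap z).hom.toAlgebra
  exact (inferInstance : Module.Flat
    (Y.presheaf.stalk (Y.fromSpecResidueField (genericPoint Y) z))
    ((Spec (Y.residueField (genericPoint Y))).presheaf.stalk z))

lemma bijective_stalkMap_fiberι {X Y : Scheme.{u}} [IsIntegral Y] (f : X ⟶ Y)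
    (z : f.fiber (genericPoint Y)) :
    Function.Bijective ((f.fiberι (genericPoint Y)).stalkMap z) := by
  have := flat_fromSpecResidueField_genericPoint Y
  have : Flat (f.fiberι (genericPoint Y)) :=
    inferInstanceAs (Flat (Limits.pullback.fst f (Y.fromSpecResidueField (genericPoint Y))))
  refine ⟨?_, (f.fiberι (genericPoint Y)).stalkMap_surjective z⟩
  let _ := ((f.fiberι (genericPoint Y)).stalkMap z).hom.toAlgebra
  have : Module.FaithfullyFlat (X.presheaf.stalk (f.fiberι (genericPoint Y) z))
      ((f.fiber (genericPoint Y)).presheaf.stalk z) :=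
    @Module.FaithfullyFlat.of_flat_of_isLocalHom _ _ _ _ _ _ _
      (Flat.stalkMap (f.fiberι (genericPoint Y)) z) ((f.fiberι (genericPoint Y)).toLRSHom.prop z)
  exact FaithfulSMul.algebraMap_injective (X.presheaf.stalk (f.fiberι (genericPoint Y) z))
      ((f.fiber (genericPoint Y)).presheaf.stalk z)

lemma genericPoint_mem_range_fiberι :
    genericPoint X ∈ Set.range (f.fiberι (genericPoint Y)) := by
  rw [Scheme.Hom.range_fiberι]
  exact map_genericPoint f

instance isDominant_fiberι : IsDominant (f.fiberι (genericPoint Y)) := by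
  refine ⟨dense_iff_closure_eq.mpr (Set.univ_subset_iff.mp ?_)⟩
  rw [← (genericPoint_spec X)]
  exact closure_mono (Set.singleton_subset_iff.mpr (genericPoint_mem_range_fiberι f))

/-- The generic fibre of a dominant morphism of integral schemes is integral. -/
instance isIntegral_fiber : IsIntegral (f.fiber (genericPoint Y)) := by
  obtain ⟨ξ, hξ⟩ := genericPoint_mem_range_fiberι f
  have hgen : IsGenericPoint ξ (Set.univ : Set (f.fiber (genericPoint Y))) := by
    rw [isGenericPoint_iff_specializes]
    intro y
    refine ⟨fun _ => trivial, fun _ => ?_⟩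
    rw [← (f.fiberι (genericPoint Y)).isEmbedding.isInducing.specializes_iff, hξ]
    exact genericPoint_specializes _
  have : IrreducibleSpace (f.fiber (genericPoint Y)) :=
    (irreducibleSpace_def _).mpr hgen.isIrreducible
  have : ∀ z : f.fiber (genericPoint Y),
      _root_.IsReduced ((f.fiber (genericPoint Y)).presheaf.stalk z) := fun z =>
    isReduced_of_injective
      (RingEquiv.ofBijective ((f.fiberι (genericPoint Y)).stalkMap z).hom
        (bijective_stalkMap_fiberι f z)).symm.toRingHom (RingEquiv.injective _)
  have := isReduced_of_isReduced_stalk (f.fiber (genericPoint Y))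
  exact isIntegral_of_irreducibleSpace_of_isReduced _

end Fiber

section Kodaira
attribute [local instance] MvPolynomial.gradedAlgebra

variable {X : Scheme.{u}} [IsIntegral X] {F : Type u} [Field F] (π : X ⟶ Spec (.of F))

/-- The inclusion of the base field into the function field of an `F`-scheme. -/
def baseFieldMap : F →+* X.functionField :=
  ((Scheme.ΓSpecIso (.of F)).inv ≫ π.appTop ≫
    X.presheaf.germ ⊤ (genericPoint X) trivial).hom

lemma baseFieldMap_eq (x : X) (c : F) : baseFieldMap π c =
    algebraMap (X.presheaf.stalk x) X.functionField
      (X.presheaf.germ ⊤ x trivial (π.appTop ((Scheme.ΓSpecIso (.of F)).inv c))) :=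
  have : Nonempty (⊤ : X.Opens) := ⟨⟨x, trivial⟩⟩
  (Scheme.algebraMap_germ_eq_germToFunctionField X (U := ⊤) (x := x) trivial _).symm

/-- The `F`-algebra structure of the function field. -/
abbrev functionFieldAlgebra : Algebra F X.functionField := (baseFieldMap π).toAlgebra

/-- `H⁰(X, 𝒪_X(D))`, as an `F`-subspace of `K(X)`. -/
def H0 (D : CDiv X) : letI := functionFieldAlgebra π; Submodule F X.functionField :=
  letI := functionFieldAlgebra π
  { carrier := {φ | ∀ x : X, φ ∈ D.stalk x}
    zero_mem' := fun _ => zero_mem _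
    add_mem' := fun h h' x => add_mem (h x) (h' x)
    smul_mem' := fun c φ h x => by
      rw [Algebra.smul_def]
      change baseFieldMap π c * φ ∈ _
      rw [baseFieldMap_eq π x, ← Algebra.smul_def]
      exact (D.stalk x).smul_mem _ (h x) }

/-- The index set of a basis of `H⁰(X, 𝒪_X(D))`. -/
abbrev H0Index (D : CDiv X) : Type u :=
  letI := functionFieldAlgebra π
  Module.Basis.ofVectorSpaceIndex F (H0 π D)

/-- A basis `(s_i)` of `H⁰(X, 𝒪_X(D))`, as a family of rational functions. -/
def H0Basis (D : CDiv X) (i : H0Index π D) : X.functionField :=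
  letI := functionFieldAlgebra π
  (Module.Basis.ofVectorSpace F (H0 π D) i : H0 π D)

/-- `T_i ↦ s_i`. -/
def linearSystemRingHom (D : CDiv X) :
    MvPolynomial (H0Index π D) F →+* Γ(Spec X.functionField, ⊤) :=
  (Scheme.ΓSpecIso X.functionField).inv.hom.comp
    (MvPolynomial.eval₂Hom (baseFieldMap π) (H0Basis π D))

lemma map_irrelevant_linearSystemRingHom (D : CDiv X) (h : H0 π D ≠ ⊥) :
    (HomogeneousIdeal.irrelevant
      (MvPolynomial.homogeneousSubmodule (H0Index π D) F)).toIdeal.map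
      (linearSystemRingHom π D) = ⊤ := by
  let _ := functionFieldAlgebra π
  have : Nontrivial (H0 π D) := (Submodule.nontrivial_iff_ne_bot).mpr h
  obtain ⟨i⟩ := (Module.Basis.ofVectorSpace F (H0 π D)).index_nonempty
  have hi : H0Basis π D i ≠ 0 := fun h0 =>
    (Module.Basis.ofVectorSpace F (H0 π D)).ne_zero i (Subtype.ext h0)
  have hX : (MvPolynomial.X i : MvPolynomial (H0Index π D) F) ∈
      (HomogeneousIdeal.irrelevant
        (MvPolynomial.homogeneousSubmodule (H0Index π D) F)).toIdeal := by
    change _ ∈ HomogeneousIdeal.irrelevant _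
    rw [HomogeneousIdeal.mem_irrelevant_iff]
    exact DirectSum.decompose_of_mem_ne (MvPolynomial.homogeneousSubmodule (H0Index π D) F)
      (show MvPolynomial.X i ∈ MvPolynomial.homogeneousSubmodule (H0Index π D) F 1 from
        MvPolynomial.isHomogeneous_X F i) one_ne_zero
  refine Ideal.eq_top_of_isUnit_mem _ (Ideal.mem_map_of_mem _ hX) ?_
  have : linearSystemRingHom π D (MvPolynomial.X i) =
      (Scheme.ΓSpecIso X.functionField).inv (H0Basis π D i) := by
    simp [linearSystemRingHom]
  rw [this]
  exact (IsUnit.mk0 _ hi).map (Scheme.ΓSpecIso X.functionField).inv.hom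

/-- The rational map `Φ_{|D|} = (s_0 : s_1 : …) : X ⇢ ℙ(H⁰(X, 𝒪_X(D)))` of the complete linear
system `|D|`, at the generic point `Spec K(X)` of `X`. -/
def linearSystemMap (D : CDiv X) (h : H0 π D ≠ ⊥) :
    Spec X.functionField ⟶ Proj (MvPolynomial.homogeneousSubmodule (H0Index π D) F) :=
  Proj.fromOfGlobalSections _ (linearSystemRingHom π D) (map_irrelevant_linearSystemRingHom π D h)

/-- `dim Φ_{|D|}(X)`: the dimension of the closure of the image of `Φ_{|D|}`, which is the closure
of the image of the generic point of `X`. -/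
def dimLinearSystemImage (D : CDiv X) (h : H0 π D ≠ ⊥) : WithBot ℕ∞ :=
  topologicalKrullDim (closure (Set.range (linearSystemMap π D h)))

/-- The `D`-dimension `κ(X, D)` of a `ℚ`-Cartier divisor: the maximum of `dim Φ_{|mD|}(X)` over the
integers `m > 0` with `mD = E` Cartier and `|E| ≠ ∅`; it is `⊥` (that is, `-∞`) if there are none. -/
def kappa (D : QCDiv X) : WithBot ℕ∞ :=
  ⨆ (m : ℕ) (E : CDiv X) (_ : 0 < m ∧ m • D = (1 : ℚ) ⊗ₜ[ℤ] E) (h : H0 π E ≠ ⊥),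
    dimLinearSystemImage π E h

/-- `D` is big: `κ(X, D) = dim X`. -/
def IsBig (D : QCDiv X) : Prop := kappa π D = topologicalKrullDim X

/-- `D` is ample: every point has an affine neighbourhood of the form `X_s`, for a global section
`s` of `𝒪_X(nD)` with `n > 0`. -/
def CDiv.IsAmple (D : CDiv X) : Prop :=
  CompactSpace X ∧ ∀ x : X, ∃ n : ℕ, 0 < n ∧ ∃ s : X.functionField, (∀ y, s ∈ (n • D).stalk y) ∧
    ∃ U : X.Opens, x ∈ U ∧ IsAffineOpen U ∧ ∀ y, y ∈ U ↔ (n • D).Generates s y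

/-- A `ℚ`-Cartier divisor is ample if a positive multiple is an ample Cartier divisor. -/
def QCDiv.IsAmple (D : QCDiv X) : Prop :=
  ∃ m : ℕ, 0 < m ∧ ∃ E : CDiv X, m • D = (1 : ℚ) ⊗ₜ[ℤ] E ∧ E.IsAmple

end Kodaira

section Frobenius

lemma add_pow_of_natCast_eq_zero {R : Type*} [CommRing R] {p : ℕ} (hp : p.Prime)
    (h : (p : R) = 0) (e : ℕ) (a b : R) : (a + b) ^ p ^ e = a ^ p ^ e + b ^ p ^ e := by
  rcases subsingleton_or_nontrivial R with _ | _
  · exact Subsingleton.elim _ _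
  · have : Fact p.Prime := ⟨hp⟩
    have : CharP R p := by
      have h1 : ringChar R ∣ p := ringChar.dvd h
      rcases (Nat.dvd_prime hp).mp h1 with h2 | h2
      · exact absurd h2 (CharP.ringChar_ne_one)
      · exact ringChar.of_eq h2
    exact add_pow_char_pow a b p e

/-- `a ↦ a ^ (p ^ e)` on a ring in which the prime `p` vanishes. -/
def powRingHom {R : Type*} [CommRing R] {p : ℕ} (hp : p.Prime)
    (h : (p : R) = 0) (e : ℕ) : R →+* R where
  toFun a := a ^ p ^ e
  map_one' := one_pow _
  map_mul' a b := mul_pow a b _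
  map_zero' := zero_pow (pow_ne_zero _ hp.ne_zero)
  map_add' a b := add_pow_of_natCast_eq_zero hp h e a b

lemma natCast_section_eq_zero {Y : Scheme.{u}} {p : ℕ} (h : (p : Γ(Y, ⊤)) = 0) (U : Y.Opens) :
    (p : Γ(Y, U)) = 0 := by
  have := congrArg (Y.presheaf.map (homOfLE le_top : U ⟶ ⊤).op) h
  rwa [map_natCast, map_zero] at this

/-- The morphism of structure sheaves of the Frobenius. -/
def absFrobeniusComorphism {Y : Scheme.{u}} {p : ℕ} (hp : p.Prime) (h : (p : Γ(Y, ⊤)) = 0) (e : ℕ) :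
    Y.presheaf ⟶ (TopCat.Presheaf.pushforward CommRingCat (𝟙 _)).obj Y.presheaf where
  app U := CommRingCat.ofHom (powRingHom hp (natCast_section_eq_zero h U.unop) e)
  naturality U V i := by
    ext a
    exact (map_pow (Y.presheaf.map i).hom a (p ^ e)).symm

/-- The `e`-th iterate `F_Y^e : Y ⟶ Y` of the absolute Frobenius of a scheme of characteristic `p`:
the identity on points and `a ↦ a ^ (p ^ e)` on functions. -/
def absFrobenius {Y : Scheme.{u}} {p : ℕ} (hp : p.Prime) (h : (p : Γ(Y, ⊤)) = 0) (e : ℕ) : Y ⟶ Y where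
  base := 𝟙 _
  c := absFrobeniusComorphism hp h e
  prop x := by
    constructor
    intro a ha
    obtain ⟨U, hx, s, rfl⟩ := Y.presheaf.exists_germ_eq a
    have h1 := PresheafedSpace.stalkMap_germ
      (X := Y.toPresheafedSpace) (Y := Y.toPresheafedSpace)
      ⟨𝟙 _, absFrobeniusComorphism hp h e⟩ U x hx
    have h2 : Y.presheaf.germ U x hx (s ^ p ^ e) = _ := congr($h1.symm s)
    rw [map_pow] at h2
    refine (isUnit_pow_iff (pow_ne_zero e hp.ne_zero)).mp ?_
    exact h2.symm ▸ ha

/-- A scheme over a field of characteristic `p` has characteristic `p`. -/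
lemma natCast_eq_zero_of_charP {Y : Scheme.{u}} {k : Type u} [Field k] (p : ℕ) [CharP k p]
    (π : Y ⟶ Spec (.of k)) : (p : Γ(Y, ⊤)) = 0 := by
  have := congrArg ((Scheme.ΓSpecIso (.of k)).inv ≫ π.appTop).hom (CharP.cast_eq_zero k p)
  rwa [map_natCast, map_zero] at this

end Frobenius

section Positivity
variable {Y : Scheme.{u}}

/-- The tensor product of two sheaves of `𝒪_Y`-modules. -/
def tensor (M N : Y.Modules) : Y.Modules :=
  (PresheafOfModules.sheafification (𝟙 Y.ringCatSheaf.obj)).obj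
    (MonoidalCategory.tensorObj (C := PresheafOfModules.{u} (Y.presheaf ⋙ forget₂ _ RingCat))
      M.val N.val)

/-- `M` is generically globally generated: for all closed points `y` of a non-empty open subset the
natural map `H⁰(Y, M) → M ⊗ k(y)` is surjective, where `M ⊗ k(y)` is the pull-back of `M` to
`Spec k(y)`. -/
def IsGenericallyGloballyGenerated (M : Y.Modules) : Prop :=
  ∃ U : Y.Opens, (U : Set Y).Nonempty ∧ ∀ y ∈ U, IsClosed {y} →
    Function.Surjective
      (((Scheme.Modules.pullbackPushforwardAdjunction
        (Y.fromSpecResidueField y)).unit.app M).app ⊤)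

/-- Torsion free sheaves on an integral scheme. -/
def IsTorsionFree (M : Y.Modules) : Prop :=
  ∀ (U : Y.Opens) (r : Γ(Y, U)) (s : Γ(M, U)), r • s = 0 → r = 0 ∨ s = 0

/-- Coherent sheaves on a locally noetherian scheme: locally the cokernel of a morphism between
finite free sheaves. -/
def IsCoherent (M : Y.Modules) : Prop :=
  SheafOfModules.IsFinitePresentation (R := Y.ringCatSheaf) M

variable [IsIntegral Y]

/-- Frobenius weakly positive (FWP) sheaves: `M` is coherent and torsion free and, for an ample
`ℚ`-Cartier divisor `H`, there are positive integers `n_e` (`e = 1, 2, …`) such that `n_e H` is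
Cartier, `F_Y^{e*} M ⊗ 𝒪_Y(n_e H)` is generically globally generated and `n_e / p^e → 0`. -/
def IsFWP {p : ℕ} (hp : p.Prime) (h : (p : Γ(Y, ⊤)) = 0) (M : Y.Modules) : Prop :=
  IsCoherent M ∧ IsTorsionFree M ∧
  ∃ H : QCDiv Y, H.IsAmple ∧ ∃ n : ℕ → ℕ,
    (∀ e, 0 < e → 0 < n e ∧ ∃ E : CDiv Y, n e • H = (1 : ℚ) ⊗ₜ[ℤ] E ∧
      IsGenericallyGloballyGenerated
        (tensor ((Scheme.Modules.pullback (absFrobenius hp h e)).obj M) E.sheaf)) ∧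
    Filter.Tendsto (fun e => (n e : ℝ) / (p : ℝ) ^ e) Filter.atTop (nhds 0)

end Positivity

section Varieties
attribute [local instance] MvPolynomial.gradedAlgebra
variable {k : Type u} [Field k]

variable (k) in
/-- The projective space `ℙⁿ` over `k`. -/
def projectiveSpace (n : ℕ) : Scheme.{u} :=
  Proj (MvPolynomial.homogeneousSubmodule (Fin (n + 1)) k)

variable (k) in
/-- The structure morphism `ℙⁿ ⟶ Spec k`. -/
def projectiveSpaceStructure (n : ℕ) : projectiveSpace k n ⟶ Spec (.of k) :=
  Proj.toSpecZero (MvPolynomial.homogeneousSubmodule (Fin (n + 1)) k) ≫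
    Spec.map (CommRingCat.ofHom
      (algebraMap k (MvPolynomial.homogeneousSubmodule (Fin (n + 1)) k 0)))

/-- `X` is projective over `k`: it is a closed subscheme of some `ℙⁿ`. -/
def IsProjectiveOver {X : Scheme.{u}} (π : X ⟶ Spec (.of k)) : Prop :=
  ∃ (n : ℕ) (i : X ⟶ projectiveSpace k n), IsClosedImmersion i ∧
    i ≫ projectiveSpaceStructure k n = π

/-- `X` is normal: its local rings are integrally closed domains. -/
def IsNormalScheme (X : Scheme.{u}) : Prop :=
  ∀ x : X, IsDomain (X.presheaf.stalk x) ∧ IsIntegrallyClosed (X.presheaf.stalk x)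

/-- The condition `f_* 𝒪_X = 𝒪_Y` on a fibration: the natural map `𝒪_Y → f_* 𝒪_X` is an isomorphism.
(A morphism between projective `k`-schemes is automatically projective.) -/
class IsFibration {X Y : Scheme.{u}} (f : X ⟶ Y) : Prop where
  bijective_app (U : Y.Opens) : Function.Bijective (f.app U)

instance {X Y : Scheme.{u}} [IsIntegral Y] (f : X ⟶ Y) [hf : IsFibration f] :
    IsDominant f := by
  constructor
  rw [DenseRange, dense_iff_inter_open]
  intro U hU hne
  by_contra hc
  have hpre : f ⁻¹ᵁ ⟨U, hU⟩ = ⊥ := by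
    ext x
    refine ⟨fun hx => hc ⟨f x, hx, x, rfl⟩, fun hx => hx.elim⟩
  have : Nonempty (⟨U, hU⟩ : Y.Opens) := ⟨⟨hne.some, hne.some_mem⟩⟩
  have hs : Subsingleton Γ(X, f ⁻¹ᵁ ⟨U, hU⟩) := by
    rw [hpre]; infer_instance
  have := (hf.bijective_app ⟨U, hU⟩).1.subsingleton
  exact not_subsingleton Γ(Y, ⟨U, hU⟩) this

end Varieties
end

end FWPKod

open FWPKod

/-!
Everything takes place in function fields. The sheaf `f_* 𝒪_X(D)` is a sheaf of rational functions
on `X`. A non-zero torsion free subsheaf `M` of its Frobenius pull-back still consists of rational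
functions, sections of `𝒪_X(p ^ e D)` along the fibres: take `p ^ e`-th powers, which is injective
on the Frobenius pull-back because `K(X) / K(Y)` is separable, so that elements of `K(X)` which are
linearly independent over `K(Y)` have linearly independent `p ^ e`-th powers. Hence the generic
global generation of `F^{e'*} M ⊗ 𝒪_Y(n_{e'} A)` yields a non-zero section of
`p ^ (e + e') D + n_{e'} f^*A`, and as `n_{e'} / p ^ e' → 0`, some multiple of `D + δ f^*A` has a
non-zero section for arbitrarily small `δ > 0`.

The number `κ` is the largest number of algebraically independent ratios of sections of a multiple.
Sections of multiples of `D` on the generic fibre extend to sections of multiples of `D + c f^*A`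
for some `c > 0`, and `H - ε A` has multiples with non-zero sections for some `ε > 0` by Kodaira's
lemma. As `δ` may be chosen much smaller than `ε`, a convex combination turns the ratios on the
generic fibre, which are algebraically independent over `K(Y)`, and a transcendence basis of `K(Y)`
over `k` given by `H` into ratios of sections of a multiple of `D + f^*H`.
-/

namespace FWPKod
noncomputable section

section LinearPredicate
variable {Y : Scheme.{u}} (B : Y → Type u) [∀ y, AddCommGroup (B y)]
  [∀ y, Module (Y.presheaf.stalk y) (B y)]

/-- A local predicate on families of elements of modules `B y` over the local rings of `Y` which is
compatible with the module operations, so that its sections form a sheaf of `𝒪_Y`-modules. Morphisms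
into such sheaves can be written down pointwise. -/
structure LinearPredicate extends TopCat.LocalPredicate (X := (Y : TopCat.{u})) B where
  zero {U : Opens Y} : pred (fun _ : U => 0)
  add {U : Opens Y} (s t : ∀ x : U, B x) : pred s → pred t → pred (fun x => s x + t x)
  neg {U : Opens Y} (s : ∀ x : U, B x) : pred s → pred (fun x => -s x)
  smul {U : Opens Y} (r : Γ(Y, U)) (s : ∀ x : U, B x) :
    pred s → pred (fun x => Y.presheaf.germ U x.1 x.2 r • s x)

variable {B}
namespace LinearPredicate
variable (P : LinearPredicate B)

/-- The sections over `U` satisfying the predicate. -/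
def sections (U : Y.Opens) : AddSubgroup (∀ x : U, B x) where
  carrier := {s | P.pred s}
  zero_mem' := P.zero
  add_mem' {s t} hs ht := P.add s t hs ht
  neg_mem' {s} hs := P.neg s hs

instance (U : Y.Opens) : Module Γ(Y, U) (P.sections U) where
  smul r s := ⟨fun x => Y.presheaf.germ U x.1 x.2 r • s.1 x, P.smul r s.1 s.2⟩
  one_smul s := Subtype.ext (funext fun x => by
    change Y.presheaf.germ U x.1 x.2 1 • s.1 x = s.1 x; rw [map_one, one_smul])
  mul_smul r t s := Subtype.ext (funext fun x => by
    change Y.presheaf.germ U x.1 x.2 (r * t) • s.1 x =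
      Y.presheaf.germ U x.1 x.2 r • Y.presheaf.germ U x.1 x.2 t • s.1 x
    rw [map_mul, mul_smul])
  smul_zero r := Subtype.ext (funext fun x => smul_zero _)
  smul_add r s t := Subtype.ext (funext fun x => smul_add _ _ _)
  add_smul r t s := Subtype.ext (funext fun x => by
    change Y.presheaf.germ U x.1 x.2 (r + t) • s.1 x =
      Y.presheaf.germ U x.1 x.2 r • s.1 x + Y.presheaf.germ U x.1 x.2 t • s.1 x
    rw [map_add, add_smul])
  zero_smul s := Subtype.ext (funext fun x => by
    change Y.presheaf.germ U x.1 x.2 0 • s.1 x = 0; rw [map_zero, zero_smul])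

/-- The presheaf of abelian groups of the sections satisfying the predicate. -/
def presheaf : TopCat.Presheaf Ab.{u} Y where
  obj U := AddCommGrpCat.of (P.sections U.unop)
  map {U V} i := AddCommGrpCat.ofHom
    { toFun := fun s => ⟨fun x => s.1 (i.unop x), P.res i.unop s.1 s.2⟩
      map_zero' := rfl
      map_add' := fun _ _ => rfl }

lemma presheaf_isSheaf : P.presheaf.IsSheaf := by
  rw [TopCat.Presheaf.isSheaf_iff_isSheaf_comp (forget Ab.{u})]
  exact TopCat.subpresheafToTypes.isSheaf P.toLocalPredicate

instance (U : (Opens Y)ᵒᵖ) : Module (Y.ringCatSheaf.obj.obj U) (P.presheaf.obj U) :=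
  inferInstanceAs (Module Γ(Y, U.unop) (P.sections U.unop))

/-- The sheaf of modules of the sections satisfying the predicate. -/
def sheaf : Y.Modules where
  val := PresheafOfModules.ofPresheaf P.presheaf (fun U V i r s => by
    apply Subtype.ext
    funext x
    change Y.presheaf.germ U.unop (i.unop x) _ r • s.1 (i.unop x) =
      Y.presheaf.germ V.unop x _ (Y.presheaf.map i r) • s.1 (i.unop x)
    congr 1
    exact (Y.presheaf.germ_res_apply i.unop x.1 x.2 r).symm)
  isSheaf := P.presheaf_isSheaf

/-- The value at a point of a section. -/
def value {U : Y.Opens} (s : Γ(P.sheaf, U)) (x : U) : B x :=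
  Subtype.val (p := fun s => s ∈ P.sections U) s x

lemma value_ext {U : Y.Opens} {s t : Γ(P.sheaf, U)} (h : ∀ x, P.value s x = P.value t x) : s = t :=
  Subtype.ext (funext h)

lemma value_smul {U : Y.Opens} (r : Γ(Y, U)) (s : Γ(P.sheaf, U)) (x : U) :
    P.value (r • s) x = Y.presheaf.germ U x.1 x.2 r • P.value s x := rfl

lemma value_pred {U : Y.Opens} (s : Γ(P.sheaf, U)) : P.pred (P.value s) := s.2

/-- The morphism into the push-forward along `g` of the sheaf of sections satisfying a predicate
which is given by additive maps `Γ(M, U) → B x` for `x ∈ g⁻¹ U`. -/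
def homPushforward {Z : Scheme.{u}} (g : Y ⟶ Z) (M : Z.Modules)
    (φ : ∀ (U : Z.Opens) (x : (g ⁻¹ᵁ U : Y.Opens)), Γ(M, U) →+ B x)
    (hmap : ∀ (U V : Z.Opens) (i : U ⟶ V) (m : Γ(M, V)) (x : (g ⁻¹ᵁ U : Y.Opens)),
      φ U x (M.presheaf.map i.op m) = φ V ⟨x.1, i.le x.2⟩ m)
    (hsmul : ∀ (U : Z.Opens) (r : Γ(Z, U)) (m : Γ(M, U)) (x : (g ⁻¹ᵁ U : Y.Opens)),
      φ U x (r • m) = Y.presheaf.germ (g ⁻¹ᵁ U) x.1 x.2 (g.app U r) • φ U x m)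
    (hpred : ∀ (U : Z.Opens) (m : Γ(M, U)), P.pred (fun x => φ U x m)) :
    M ⟶ (Scheme.Modules.pushforward g).obj P.sheaf where
  val := PresheafOfModules.homMk
    { app := fun U => AddCommGrpCat.ofHom
        { toFun := fun m => (⟨fun x => φ U.unop x m, hpred U.unop m⟩ : P.sections (g ⁻¹ᵁ U.unop))
          map_zero' := Subtype.ext (funext fun x => map_zero (φ U.unop x))
          map_add' := fun m n => Subtype.ext (funext fun x => map_add (φ U.unop x) m n) }
      naturality := fun U V i => by
        ext m
        exact Subtype.ext (funext fun x => hmap V.unop U.unop i.unop m x) }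
    (fun U r m => Subtype.ext (funext fun x => hsmul U.unop r m x))

/-- The morphism into the sheaf of sections satisfying a predicate which is given by additive maps
`Γ(M, U) → B x` for `x ∈ U`. -/
def hom (M : Y.Modules) (φ : ∀ (U : Y.Opens) (x : U), Γ(M, U) →+ B x)
    (hmap : ∀ (U V : Y.Opens) (i : U ⟶ V) (m : Γ(M, V)) (x : U),
      φ U x (M.presheaf.map i.op m) = φ V (i x) m)
    (hsmul : ∀ (U : Y.Opens) (r : Γ(Y, U)) (m : Γ(M, U)) (x : U),
      φ U x (r • m) = Y.presheaf.germ U x.1 x.2 r • φ U x m)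
    (hpred : ∀ (U : Y.Opens) (m : Γ(M, U)), P.pred (fun x => φ U x m)) :
    M ⟶ P.sheaf :=
  P.homPushforward (𝟙 Y) M φ hmap hsmul hpred ≫ (Scheme.Modules.pushforwardId Y).hom.app P.sheaf

/-- The sheaf of all families of elements of the modules `B y`. -/
def univ (B : Y → Type u) [∀ y, AddCommGroup (B y)] [∀ y, Module (Y.presheaf.stalk y) (B y)] :
    LinearPredicate B where
  pred _ := True
  res _ _ _ := trivial
  locality _ _ := trivial
  zero := trivial
  add _ _ _ _ := trivial
  neg _ _ := trivial
  smul _ _ _ := trivial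

end LinearPredicate
end LinearPredicate

section Tensor
variable {Y : Scheme.{u}} (M N K : Y.Modules)

/-- The presheaf tensor product of two sheaves of modules. -/
abbrev preTensor : PresheafOfModules.{u} (Y.presheaf ⋙ forget₂ CommRingCat RingCat) :=
  MonoidalCategory.tensorObj (C := PresheafOfModules.{u} (Y.presheaf ⋙ forget₂ _ RingCat))
    M.val N.val

/-- The presheaf of modules underlying a sheaf of modules. -/
abbrev preMod : PresheafOfModules.{u} (Y.presheaf ⋙ forget₂ CommRingCat RingCat) := M.val

/-- The pure tensor `m ⊗ n` as a section of the presheaf tensor product. -/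
def preTensorSection {U : Y.Opens} (m : Γ(M, U)) (n : Γ(N, U)) : (preTensor M N).obj (op U) :=
  TensorProduct.tmul (Y.presheaf.obj (op U)) (M := (preMod M).obj (op U))
    (N := (preMod N).obj (op U)) m n

/-- The section `m ⊗ n` of `M ⊗ N`. -/
def tensorSection {U : Y.Opens} (m : Γ(M, U)) (n : Γ(N, U)) : Γ(tensor M N, U) :=
  ((PresheafOfModules.sheafificationAdjunction (𝟙 Y.ringCatSheaf.obj)).unit.app
    (preTensor M N)).app (op U) (preTensorSection M N m n)

variable {M N K}

/-- The morphism of presheaves defined by a bilinear pairing. -/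
def preTensorLift (β : ∀ U : Y.Opens, Γ(M, U) → Γ(N, U) → Γ(K, U))
    (hadd₁ : ∀ U m m' n, β U (m + m') n = β U m n + β U m' n)
    (hadd₂ : ∀ U m n n', β U m (n + n') = β U m n + β U m n')
    (hsmul₁ : ∀ U (r : Γ(Y, U)) m n, β U (r • m) n = r • β U m n)
    (hsmul₂ : ∀ U (r : Γ(Y, U)) m n, β U m (r • n) = r • β U m n)
    (hmap : ∀ (U V : Y.Opens) (i : U ⟶ V) m n,
      β U (M.presheaf.map i.op m) (N.presheaf.map i.op n) = K.presheaf.map i.op (β V m n)) :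
    preTensor M N ⟶ preMod K where
  app U := ModuleCat.MonoidalCategory.tensorLift (R := Y.presheaf.obj U)
    (M₁ := (preMod M).obj U) (M₂ := (preMod N).obj U) (M₃ := (preMod K).obj U)
    (fun m n => β U.unop m n)
    (fun m m' n => hadd₁ U.unop m m' n) (fun r m n => hsmul₁ U.unop r m n)
    (fun m n n' => hadd₂ U.unop m n n') (fun r m n => hsmul₂ U.unop r m n)
  naturality {U V} i := ModuleCat.MonoidalCategory.tensor_ext (R := Y.presheaf.obj U)
    (M₁ := (preMod M).obj U) (M₂ := (preMod N).obj U) fun m n => hmap V.unop U.unop i.unop m n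

/-- The morphism from a tensor product defined by a bilinear pairing. -/
def tensorLift (β : ∀ U : Y.Opens, Γ(M, U) → Γ(N, U) → Γ(K, U))
    (hadd₁ : ∀ U m m' n, β U (m + m') n = β U m n + β U m' n)
    (hadd₂ : ∀ U m n n', β U m (n + n') = β U m n + β U m n')
    (hsmul₁ : ∀ U (r : Γ(Y, U)) m n, β U (r • m) n = r • β U m n)
    (hsmul₂ : ∀ U (r : Γ(Y, U)) m n, β U m (r • n) = r • β U m n)
    (hmap : ∀ (U V : Y.Opens) (i : U ⟶ V) m n,
      β U (M.presheaf.map i.op m) (N.presheaf.map i.op n) = K.presheaf.map i.op (β V m n)) :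
    tensor M N ⟶ K :=
  ((PresheafOfModules.sheafificationAdjunction (𝟙 Y.ringCatSheaf.obj)).homEquiv
    (preTensor M N) K).symm (preTensorLift β hadd₁ hadd₂ hsmul₁ hsmul₂ hmap)

lemma tensorLift_app_tensorSection (β : ∀ U : Y.Opens, Γ(M, U) → Γ(N, U) → Γ(K, U))
    (h₁ h₂ h₃ h₄ h₅) {U : Y.Opens} (m : Γ(M, U)) (n : Γ(N, U)) :
    (tensorLift β h₁ h₂ h₃ h₄ h₅).app U (tensorSection M N m n) = β U m n := by
  have h := (Adjunction.homEquiv_unit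
    (PresheafOfModules.sheafificationAdjunction (𝟙 Y.ringCatSheaf.obj)) (X := preTensor M N)
    (Y := K) (f := tensorLift β h₁ h₂ h₃ h₄ h₅)).symm.trans
    (Equiv.apply_symm_apply _ (preTensorLift β h₁ h₂ h₃ h₄ h₅))
  exact congr(PresheafOfModules.Hom.app $h (op U) (preTensorSection M N m n))

end Tensor

section PullbackSection
variable {Y Z : Scheme.{u}} (g : Y ⟶ Z) (N : Z.Modules)

/-- The pull-back of a section. -/
def pullbackSection (U : Z.Opens) : Γ(N, U) →+ Γ((Scheme.Modules.pullback g).obj N, g ⁻¹ᵁ U) :=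
  (((Scheme.Modules.pullbackPushforwardAdjunction g).unit.app N).app U).hom

lemma pullbackSection_smul (U : Z.Opens) (r : Γ(Z, U)) (n : Γ(N, U)) :
    pullbackSection g N U (r • n) = g.app U r • pullbackSection g N U n :=
  (((Scheme.Modules.pullbackPushforwardAdjunction g).unit.app N)).app_smul r n

lemma pullbackSection_map {U V : Z.Opens} (i : U ⟶ V) (n : Γ(N, V)) :
    pullbackSection g N U (N.presheaf.map i.op n) =
      ((Scheme.Modules.pullback g).obj N).presheaf.map ((Opens.map g.base).map i).op
        (pullbackSection g N V n) :=
  congr($(((Scheme.Modules.pullbackPushforwardAdjunction g).unit.app N).mapPresheaf.naturality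
    i.op) n)

variable {g N}
variable {K : Y.Modules}

/-- The morphism from a pull-back corresponding to a morphism to a push-forward. -/
def pullbackLift (φ : N ⟶ (Scheme.Modules.pushforward g).obj K) :
    (Scheme.Modules.pullback g).obj N ⟶ K :=
  ((Scheme.Modules.pullbackPushforwardAdjunction g).homEquiv N K).symm φ

lemma pullbackLift_app_pullbackSection (φ : N ⟶ (Scheme.Modules.pushforward g).obj K)
    (U : Z.Opens) (n : Γ(N, U)) :
    (pullbackLift φ).app (g ⁻¹ᵁ U) (pullbackSection g N U n) = φ.app U n := by
  have h := (Adjunction.homEquiv_unit (Scheme.Modules.pullbackPushforwardAdjunction g)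
    (X := N) (Y := K) (f := pullbackLift φ)).symm.trans (Equiv.apply_symm_apply _ φ)
  exact congr(Scheme.Modules.Hom.app $h U n)

lemma pullback_hom_ext {φ ψ : (Scheme.Modules.pullback g).obj N ⟶ K}
    (h : ∀ U n, φ.app (g ⁻¹ᵁ U) (pullbackSection g N U n) =
      ψ.app (g ⁻¹ᵁ U) (pullbackSection g N U n)) : φ = ψ := by
  apply ((Scheme.Modules.pullbackPushforwardAdjunction g).homEquiv N K).injective
  rw [Adjunction.homEquiv_unit, Adjunction.homEquiv_unit]
  refine Scheme.Modules.hom_ext _ _ fun U => ?_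
  ext n
  exact h U n

end PullbackSection

section Stalk
variable {Y : Scheme.{u}} (M : Y.Modules)

/-- The stalk of a sheaf of modules. -/
def modStalk (y : Y) : Type u := ↑(TopCat.Presheaf.stalk (preMod M).presheaf y)

instance (y : Y) : AddCommGroup (modStalk M y) :=
  inferInstanceAs (AddCommGroup ↑(TopCat.Presheaf.stalk (preMod M).presheaf y))

instance (y : Y) : Module (Y.presheaf.stalk y) (modStalk M y) :=
  inferInstanceAs (Module (Y.presheaf.stalk y) ↑(TopCat.Presheaf.stalk (preMod M).presheaf y))

/-- The germ of a section. -/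
def modGerm {U : Y.Opens} (y : U) : Γ(M, U) →+ modStalk M y :=
  (TopCat.Presheaf.germ (preMod M).presheaf U y.1 y.2).hom

lemma modGerm_smul {U : Y.Opens} (y : U) (r : Γ(Y, U)) (m : Γ(M, U)) :
    modGerm M y (r • m) = Y.presheaf.germ U y.1 y.2 r • modGerm M y m :=
  PresheafOfModules.germ_smul (preMod M) y.1 U y.2 r m

lemma modGerm_map {U V : Y.Opens} (i : U ⟶ V) (m : Γ(M, V)) (y : U) :
    modGerm M y (M.presheaf.map i.op m) = modGerm M (i y) m :=
  TopCat.Presheaf.germ_res_apply (preMod M).presheaf i y.1 y.2 m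

lemma exists_map_eq_of_modGerm_eq {U V : Y.Opens} {y : Y} (hU : y ∈ U) (hV : y ∈ V)
    (m : Γ(M, U)) (n : Γ(M, V)) (h : modGerm M ⟨y, hU⟩ m = modGerm M ⟨y, hV⟩ n) :
    ∃ (W : Y.Opens) (_ : y ∈ W) (i : W ⟶ U) (j : W ⟶ V),
      M.presheaf.map i.op m = M.presheaf.map j.op n :=
  TopCat.Presheaf.germ_eq (preMod M).presheaf y hU hV m n h

variable {M} (S : ∀ y, Submodule (Y.presheaf.stalk y) (modStalk M y))

/-- The morphism from `M` to the product of the skyscraper sheaves `M_y / S_y`. Its vanishing says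
that all germs of sections of `M` lie in the submodules `S_y`. -/
def stalkQuotientHom : M ⟶ (LinearPredicate.univ fun y => modStalk M y ⧸ S y).sheaf :=
  LinearPredicate.hom _ M (fun _ y => (S y.1).mkQ.toAddMonoidHom.comp (modGerm M y))
    (fun _ _ i m y => congrArg (S y.1).mkQ (modGerm_map M i m y))
    (fun U r m y => by
      change (S y.1).mkQ (modGerm M y (r • m)) =
        Y.presheaf.germ U y.1 y.2 r • (S y.1).mkQ (modGerm M y m)
      rw [modGerm_smul, map_smul])
    (fun _ _ => trivial)

lemma value_stalkQuotientHom_eq_zero_iff {U : Y.Opens} (m : Γ(M, U)) (y : U) :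
    LinearPredicate.value _ ((stalkQuotientHom S).app U m) y = 0 ↔ modGerm M y m ∈ S y.1 :=
  Submodule.Quotient.mk_eq_zero (S y.1)

end Stalk

section LocalSpan
variable {Y Z : Scheme.{u}} (g : Y ⟶ Z) (N : Z.Modules)

lemma modGerm_mem_span_pullbackSection {V : Y.Opens}
    (s : Γ((Scheme.Modules.pullback g).obj N, V)) (y : V) :
    modGerm _ y s ∈ Submodule.span (Y.presheaf.stalk y.1)
      {t : modStalk ((Scheme.Modules.pullback g).obj N) y.1 | ∃ (U : Z.Opens) (hy : y.1 ∈ g ⁻¹ᵁ U)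
        (n : Γ(N, U)), modGerm _ ⟨y.1, hy⟩ (pullbackSection g N U n) = t} := by
  let S (y : Y) : Submodule (Y.presheaf.stalk y) (modStalk ((Scheme.Modules.pullback g).obj N) y) :=
    Submodule.span (Y.presheaf.stalk y) {t | ∃ (U : Z.Opens) (hy : y ∈ g ⁻¹ᵁ U) (n : Γ(N, U)),
      modGerm _ ⟨y, hy⟩ (pullbackSection g N U n) = t}
  have hS : stalkQuotientHom S = 0 := pullback_hom_ext fun U n =>
    LinearPredicate.value_ext _ fun x =>
      (value_stalkQuotientHom_eq_zero_iff S _ x).mpr (Submodule.subset_span ⟨U, x.2, n, rfl⟩)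
  refine (value_stalkQuotientHom_eq_zero_iff S s y).mp ?_
  rw [hS]
  rfl

end LocalSpan

lemma generatingSections_hom_ext {C : Type*} [Category C] {J : GrothendieckTopology C}
    {R : Sheaf J RingCat.{u}} [HasWeakSheafify J AddCommGrpCat.{u}]
    [J.WEqualsLocallyBijective AddCommGrpCat.{u}] {M N : SheafOfModules.{u} R}
    (τ : M.GeneratingSections) {φ ψ : M ⟶ N}
    (h : ∀ j, SheafOfModules.sectionsMap φ (τ.s j) = SheafOfModules.sectionsMap ψ (τ.s j)) :
    φ = ψ := by
  rw [← cancel_epi τ.π, SheafOfModules.freeHomEquiv_symm_comp,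
    SheafOfModules.freeHomEquiv_symm_comp]
  exact congrArg _ (funext h)

section FiniteType
variable {Y : Scheme.{u}} {M : Y.Modules}

lemma modGerm_mem_span_of_generatingSections {W : Y.Opens}
    (τ : (SheafOfModules.over (R := Y.ringCatSheaf) M W).GeneratingSections)
    {V : Y.Opens} (i : V ⟶ W) (s : Γ(M, V)) (y : V) :
    modGerm M y s ∈ Submodule.span (Y.presheaf.stalk y.1)
      (Set.range fun j => modGerm M (i y) ((τ.s j).1 (op (Over.mk (𝟙 W))))) := by
  classical
  let m : τ.I → Γ(M, W) := fun j => (τ.s j).1 (op (Over.mk (𝟙 W)))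
  let S (y : Y) : Submodule (Y.presheaf.stalk y) (modStalk M y) :=
    if hy : y ∈ W then
      Submodule.span (Y.presheaf.stalk y) (Set.range fun j => modGerm M ⟨y, hy⟩ (m j))
    else ⊤
  have hgerm (j : τ.I) (V : Over W) (x : V.left) :
      modGerm M x ((τ.s j).1 (op V)) ∈ S x.1 := by
    have hres : (τ.s j).1 (op V) = M.presheaf.map V.hom.op (m j) :=
      ((τ.s j).2 (Over.homMk V.hom : V ⟶ Over.mk (𝟙 W)).op).symm
    rw [hres, modGerm_map]
    simp only [S]
    rw [dif_pos (V.hom.le x.2)]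
    exact Submodule.subset_span ⟨j, rfl⟩
  have hzero : SheafOfModules.Hom.over (R := Y.ringCatSheaf) (stalkQuotientHom S) W = 0 := by
    refine generatingSections_hom_ext τ fun j => PresheafOfModules.sections_ext _ _ fun V => ?_
    exact (LinearPredicate.univ fun y => modStalk M y ⧸ S y).value_ext (U := V.unop.left) fun x =>
      (value_stalkQuotientHom_eq_zero_iff S (U := V.unop.left) ((τ.s j).1 V) x).mpr
        (hgerm j V.unop x)
  have hs : LinearPredicate.value _ ((stalkQuotientHom S).app V s) y = 0 :=
    congrArg (fun t => (LinearPredicate.univ fun y => modStalk M y ⧸ S y).value (U := V) t y)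
      congr(($hzero).val.app (op (Over.mk i)) s)
  have hSy : S y.1 = Submodule.span (Y.presheaf.stalk y.1)
      (Set.range fun j => modGerm M (i y) (m j)) := dif_pos (i.le y.2)
  rw [← hSy]
  exact (value_stalkQuotientHom_eq_zero_iff S s y).mp hs

lemma IsCoherent.exists_generators [Nonempty Y] (hM : IsCoherent M) :
    ∃ W : Y.Opens, (W : Set Y).Nonempty ∧ ∃ (ι : Type u) (_ : Finite ι) (m : ι → Γ(M, W)),
      ∀ (V : Y.Opens) (i : V ⟶ W) (s : Γ(M, V)) (y : V), modGerm M y s ∈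
        Submodule.span (Y.presheaf.stalk y.1) (Set.range fun j => modGerm M (i y) (m j)) := by
  have hM' : SheafOfModules.IsFinitePresentation (R := Y.ringCatSheaf) M := hM
  obtain ⟨σ, hσ⟩ := hM'.exists_quasicoherentData
  obtain ⟨y⟩ := ‹Nonempty Y›
  obtain ⟨_, _, hcover, hy⟩ := σ.coversTop ⊤ y trivial
  obtain ⟨l, ⟨hl⟩⟩ := (Sieve.mem_ofObjects_iff ..).mp hcover
  have : (σ.presentation l).generators.IsFiniteType :=
    (hσ.isFinite_presentation l).isFiniteType_generators
  exact ⟨σ.X l, ⟨y, hl.le hy⟩, _, this.finite, _, fun V i s y =>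
    modGerm_mem_span_of_generatingSections (σ.presentation l).generators i s y⟩

end FiniteType

section CartierBasics
variable {X Y : Scheme.{u}} [IsIntegral X] [IsIntegral Y]

/-- The local ring `𝒪_{X,x}` as a subring of the function field. -/
def localRing (x : X) : Subring X.functionField :=
  (algebraMap (X.presheaf.stalk x) X.functionField).range

lemma CDiv.mem_stalk_iff {D : CDiv X} {x : X} {g : (X.functionField)ˣ}
    (hg : D.germ x = QuotientGroup.mk g) {φ : X.functionField} :
    φ ∈ D.stalk x ↔ φ * g ∈ localRing x :=
  ⟨fun ⟨_, hh, h⟩ => mem_of_mk_eq (hh.symm.trans hg) h, fun h => ⟨g, hg, h⟩⟩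

lemma CDiv.exists_germ_eq (D : CDiv X) (x : X) :
    ∃ g : (X.functionField)ˣ, D.germ x = QuotientGroup.mk g := by
  obtain ⟨g, hg⟩ := QuotientGroup.mk_surjective (D.germ x)
  exact ⟨g, hg.symm⟩

lemma CDiv.exists_equation (D : CDiv X) (x : X) :
    ∃ U : X.Opens, x ∈ U ∧ ∃ g : (X.functionField)ˣ, ∀ y ∈ U, D.germ y = QuotientGroup.mk g :=
  D.toMul.2 x

lemma CDiv.germ_add (D E : CDiv X) (x : X) : (D + E).germ x = D.germ x * E.germ x := rfl

lemma CDiv.germ_zero (x : X) : (0 : CDiv X).germ x = QuotientGroup.mk 1 := rfl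

lemma CDiv.germ_neg (D : CDiv X) (x : X) : (-D).germ x = (D.germ x)⁻¹ := rfl

lemma CDiv.germ_nsmul (D : CDiv X) (n : ℕ) (x : X) : (n • D).germ x = D.germ x ^ n := by
  induction n with
  | zero => rw [zero_smul, pow_zero]; rfl
  | succ n ih => rw [succ_nsmul, germ_add, ih, pow_succ]

lemma CDiv.mem_zero_stalk_iff {x : X} {φ : X.functionField} :
    φ ∈ (0 : CDiv X).stalk x ↔ φ ∈ localRing x := by
  rw [mem_stalk_iff (germ_zero x), Units.val_one, mul_one]

lemma CDiv.mul_mem_stalk {D E : CDiv X} {x : X} {φ ψ : X.functionField}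
    (hφ : φ ∈ D.stalk x) (hψ : ψ ∈ E.stalk x) : φ * ψ ∈ (D + E).stalk x := by
  obtain ⟨g, hg⟩ := D.exists_germ_eq x
  obtain ⟨h, hh⟩ := E.exists_germ_eq x
  have hgh : (D + E).germ x = QuotientGroup.mk (g * h) := by
    rw [germ_add, hg, hh]; rfl
  rw [mem_stalk_iff hg] at hφ
  rw [mem_stalk_iff hh] at hψ
  rw [mem_stalk_iff hgh, Units.val_mul, mul_mul_mul_comm]
  exact mul_mem hφ hψ

lemma CDiv.pow_mem_stalk {D : CDiv X} {x : X} {φ : X.functionField}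
    (hφ : φ ∈ D.stalk x) (n : ℕ) : φ ^ n ∈ (n • D).stalk x := by
  induction n with
  | zero =>
    rw [pow_zero, zero_smul, mem_zero_stalk_iff]
    exact one_mem _
  | succ n ih => rw [pow_succ, succ_nsmul]; exact mul_mem_stalk ih hφ

lemma CDiv.localRing_mul_mem_stalk {D : CDiv X} {x : X} {r φ : X.functionField}
    (hr : r ∈ localRing x) (hφ : φ ∈ D.stalk x) : r * φ ∈ D.stalk x := by
  simpa only [zero_add] using mul_mem_stalk (mem_zero_stalk_iff.mpr hr) hφ

lemma CDiv.prod_mem_stalk {ι : Type*} (s : Finset ι) {D : ι → CDiv X} {x : X}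
    {φ : ι → X.functionField} (h : ∀ i ∈ s, φ i ∈ (D i).stalk x) :
    ∏ i ∈ s, φ i ∈ (∑ i ∈ s, D i).stalk x := by
  classical
  induction s using Finset.induction_on with
  | empty => rw [Finset.prod_empty, Finset.sum_empty, mem_zero_stalk_iff]; exact one_mem _
  | insert a s ha ih =>
    rw [Finset.prod_insert ha, Finset.sum_insert ha]
    exact mul_mem_stalk (h a (Finset.mem_insert_self a s))
      (ih fun i hi => h i (Finset.mem_insert_of_mem hi))

lemma CDiv.Generates.mem_stalk_iff {D : CDiv X} {x : X} {φ ψ : X.functionField}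
    (h : D.Generates φ x) : ψ ∈ D.stalk x ↔ ψ * φ⁻¹ ∈ localRing x := by
  obtain ⟨v, rfl, hv⟩ := h
  rw [CDiv.mem_stalk_iff hv, Units.val_inv_eq_inv_val]

lemma CDiv.Generates.ne_zero {D : CDiv X} {x : X} {φ : X.functionField}
    (h : D.Generates φ x) : φ ≠ 0 := by
  obtain ⟨v, rfl, -⟩ := h
  exact v.ne_zero

lemma CDiv.Generates.inv_mem_stalk {D : CDiv X} {x : X} {φ : X.functionField}
    (h : D.Generates φ x) : φ⁻¹ ∈ (-D).stalk x := by
  obtain ⟨v, rfl, hv⟩ := h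
  have : (-D).germ x = QuotientGroup.mk v := by rw [germ_neg, hv, ← QuotientGroup.mk_inv, inv_inv]
  rw [CDiv.mem_stalk_iff this, inv_mul_cancel₀ v.ne_zero]
  exact one_mem _

lemma CDiv.Generates.pow {D : CDiv X} {x : X} {φ : X.functionField}
    (h : D.Generates φ x) (n : ℕ) : (n • D).Generates (φ ^ n) x := by
  obtain ⟨v, rfl, hv⟩ := h
  exact ⟨v ^ n, by simp, by rw [germ_nsmul, hv, ← QuotientGroup.mk_pow, inv_pow]⟩

lemma CDiv.generates_iff {D : CDiv X} {x : X} {g : (X.functionField)ˣ}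
    (hg : D.germ x = QuotientGroup.mk g) {φ : X.functionField} :
    D.Generates φ x ↔ ∃ u : (X.presheaf.stalk x)ˣ,
      algebraMap (X.presheaf.stalk x) X.functionField u = φ * g := by
  constructor
  · rintro ⟨v, rfl, hv⟩
    rw [hg] at hv
    obtain ⟨u, hu⟩ := QuotientGroup.eq.mp hv.symm
    refine ⟨u, ?_⟩
    simpa using congrArg Units.val hu
  · rintro ⟨u, hu⟩
    have hφ : φ ≠ 0 := by
      rintro rfl
      rw [zero_mul, map_eq_zero_iff _ (FaithfulSMul.algebraMap_injective _ _)] at hu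
      exact u.ne_zero hu
    refine ⟨Units.mk0 φ hφ, rfl, ?_⟩
    rw [hg, QuotientGroup.eq]
    refine ⟨u⁻¹, ?_⟩
    rw [map_inv, inv_eq_iff_eq_inv]
    ext
    simp only [Units.coe_map]
    change algebraMap (X.presheaf.stalk x) X.functionField u = _
    rw [hu]
    simp [mul_comm]

variable (f : X ⟶ Y) [IsDominant f]

lemma functionFieldMap_mem_localRing {x : X} {r : Y.functionField}
    (hr : r ∈ localRing (f x)) : functionFieldMap f r ∈ localRing x := by
  obtain ⟨a, rfl⟩ := hr
  exact ⟨_, (functionFieldMap_algebraMap f x a).symm⟩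

lemma CDiv.germ_pullback {D : CDiv Y} {x : X} {g : (Y.functionField)ˣ}
    (hg : D.germ (f x) = QuotientGroup.mk g) :
    (CDiv.pullback f D).germ x =
      QuotientGroup.mk (Units.map (functionFieldMap f).toMonoidHom g) :=
  congrArg (pullbackGerm f x) hg

lemma CDiv.functionFieldMap_mem_stalk {D : CDiv Y} {x : X} {φ : Y.functionField}
    (hφ : φ ∈ D.stalk (f x)) : functionFieldMap f φ ∈ (CDiv.pullback f D).stalk x := by
  obtain ⟨g, hg⟩ := D.exists_germ_eq (f x)
  rw [mem_stalk_iff hg] at hφ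
  rw [mem_stalk_iff (germ_pullback f hg)]
  have := functionFieldMap_mem_localRing f hφ
  rwa [map_mul] at this

end CartierBasics

section LinearDisjointness
universe v
variable {K L : Type*} [Field K] [Field L] [Algebra K L] {ι : Type v} {p : ℕ} [Fact p.Prime]
  [CharP K p]

variable (p) in
lemma linearIndependent_pow_char_pow_of_isReduced (Ω : Type*) [Field Ω] [Algebra K Ω]
    [IsAlgClosed Ω] [IsReduced (Ω ⊗[K] L)] (e : ℕ) {φ : ι → L} (hφ : LinearIndependent K φ) :
    LinearIndependent K fun i => φ i ^ p ^ e := by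
  have : CharP (Ω ⊗[K] L) p :=
    charP_of_injective_algebraMap (algebraMap K (Ω ⊗[K] L)).injective p
  have hq : 0 < p ^ e := pow_pos (Fact.out : p.Prime).pos e
  rw [linearIndependent_iff']
  intro s a ha i hi
  choose b hb using fun l => IsAlgClosed.exists_pow_nat_eq (algebraMap K Ω (a l)) hq
  have hterm (l : ι) : (b l ⊗ₜ[K] φ l) ^ p ^ e = (1 : Ω) ⊗ₜ[K] (a l • φ l ^ p ^ e) := by
    rw [Algebra.TensorProduct.tmul_pow, hb, Algebra.algebraMap_eq_smul_one,
      TensorProduct.smul_tmul]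
  have hpow : (∑ l ∈ s, b l ⊗ₜ[K] φ l) ^ p ^ e = 0 := by
    rw [sum_pow_char_pow, Finset.sum_congr rfl fun l _ => hterm l, ← TensorProduct.tmul_sum, ha,
      TensorProduct.tmul_zero]
  have hsum : ∑ l ∈ s, b l • (1 : Ω) ⊗ₜ[K] φ l = 0 := by
    simpa only [TensorProduct.smul_tmul', smul_eq_mul, mul_one] using eq_zero_of_pow_eq_zero hpow
  have hli : LinearIndependent Ω fun l => (1 : Ω) ⊗ₜ[K] φ l :=
    Module.Flat.linearIndependent_one_tmul hφ
  have hbi : b i = 0 := linearIndependent_iff'.mp hli s b hsum i hi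
  rw [← map_eq_zero (algebraMap K Ω), ← hb, hbi, zero_pow hq.ne']

lemma exists_linearRelations_of_sum_smul_pow_eq_zero [Algebra.IsGeometricallyReduced K L]
    [Fintype ι] (e : ℕ) (a : ι → K) (φ : ι → L) (h : ∑ l, a l • φ l ^ p ^ e = 0) :
    ∃ (κ : Type v) (_ : Fintype κ) (j : κ → ι) (c : ι → κ → K),
      (∀ l, φ l = ∑ i, c l i • φ (j i)) ∧ ∀ i, ∑ l, a l * c l i ^ p ^ e = 0 := by
  obtain ⟨κ, j, hj, hspan, hli⟩ := exists_linearIndependent' K φ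
  have : Fintype κ := @Fintype.ofFinite κ (Finite.of_injective j hj)
  have hmem (l : ι) : φ l ∈ Submodule.span K (Set.range (φ ∘ j)) :=
    hspan ▸ Submodule.subset_span ⟨l, rfl⟩
  choose c hc using fun l => (Submodule.mem_span_range_iff_exists_fun K).mp (hmem l)
  have hpow (l : ι) : φ l ^ p ^ e = ∑ i, c l i ^ p ^ e • φ (j i) ^ p ^ e := by
    have : CharP L p := charP_of_injective_algebraMap (algebraMap K L).injective p
    simp only [← hc l, sum_pow_char_pow, smul_pow, Function.comp_apply]
  have hli' : LinearIndependent K fun i => (φ ∘ j) i ^ p ^ e :=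
    linearIndependent_pow_char_pow_of_isReduced p (AlgebraicClosure K) e hli
  refine ⟨κ, this, j, c, fun l => (hc l).symm, Fintype.linearIndependent_iff.mp hli' _ ?_⟩
  calc
    _ = ∑ l, a l • ∑ i, c l i ^ p ^ e • φ (j i) ^ p ^ e := by
      simp only [Finset.sum_smul, Finset.smul_sum, mul_smul, Function.comp_apply]
      exact Finset.sum_comm
    _ = ∑ l, a l • φ l ^ p ^ e := Finset.sum_congr rfl fun l _ => by rw [← hpow]
    _ = 0 := h

end LinearDisjointness

section SectionValue
variable {X : Scheme.{u}} [IsIntegral X] {D : CDiv X} {V : X.Opens}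

lemma genericPoint_mem_of_mem {x : X} (hx : x ∈ V) : genericPoint X ∈ V :=
  (genericPoint_specializes x).mem_open V.2 hx

/-- The rational function underlying a section of `𝒪_X(D)`. -/
def sectionValue (hV : genericPoint X ∈ V) : Γ(D.sheaf, V) →+ X.functionField where
  toFun s := Subtype.val (p := fun s => s ∈ D.sections V) s ⟨genericPoint X, hV⟩
  map_zero' := rfl
  map_add' _ _ := rfl

lemma apply_eq_sectionValue (hV : genericPoint X ∈ V) (s : Γ(D.sheaf, V)) (x : V) :
    Subtype.val (p := fun s => s ∈ D.sections V) s x = sectionValue hV s := by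
  obtain ⟨-, W, hW, h⟩ := s.2 x
  exact (h ⟨genericPoint X, hV⟩ (genericPoint_mem_of_mem hW)).symm

lemma sectionValue_mem_stalk (hV : genericPoint X ∈ V) (s : Γ(D.sheaf, V)) {x : X} (hx : x ∈ V) :
    sectionValue hV s ∈ D.stalk x := by
  rw [← apply_eq_sectionValue hV s ⟨x, hx⟩]
  exact (s.2 ⟨x, hx⟩).1

lemma sectionValue_smul (hV : genericPoint X ∈ V) (r : Γ(X, V)) (s : Γ(D.sheaf, V)) :
    sectionValue hV (r • s) =
      X.presheaf.germ V (genericPoint X) hV r * sectionValue hV s := by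
  change algebraMap (X.presheaf.stalk (genericPoint X)) X.functionField _ * _ = _
  congr 1
  have : Nonempty V := ⟨⟨_, hV⟩⟩
  exact Scheme.algebraMap_germ_eq_germToFunctionField X hV r

lemma sectionValue_injective (hV : genericPoint X ∈ V) :
    Function.Injective (sectionValue (D := D) hV) := fun s t h =>
  Subtype.ext (funext fun x =>
    (apply_eq_sectionValue hV s x).trans (h.trans (apply_eq_sectionValue hV t x).symm))

lemma exists_sectionValue_eq (hV : genericPoint X ∈ V) {c : X.functionField}
    (hc : ∀ x ∈ V, c ∈ D.stalk x) : ∃ s : Γ(D.sheaf, V), sectionValue hV s = c :=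
  ⟨(⟨fun _ => c, fun x => ⟨hc x x.2, ⊤, trivial, fun _ _ => rfl⟩⟩ : D.sections V), rfl⟩

end SectionValue

section RationalFunctions

/-- The function field of `X`, as a module over the local rings of `Y`. -/
def RationalFunctions {X Y : Scheme.{u}} [IsIntegral X] (_ : X ⟶ Y) : Type u := X.functionField

variable {X Y : Scheme.{u}} [IsIntegral X] [IsIntegral Y] (f : X ⟶ Y) [IsDominant f]

instance : Field (RationalFunctions f) := inferInstanceAs (Field X.functionField)

instance : Algebra Y.functionField (RationalFunctions f) := (functionFieldMap f).toAlgebra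

instance (y : Y) : Algebra (Y.presheaf.stalk y) (RationalFunctions f) :=
  ((functionFieldMap f).comp (algebraMap (Y.presheaf.stalk y) Y.functionField)).toAlgebra

instance (y : Y) : IsScalarTower (Y.presheaf.stalk y) Y.functionField (RationalFunctions f) :=
  .of_algebraMap_eq fun _ => rfl

variable {f}

lemma algebraMap_germ_eq (U : Y.Opens) {y : Y} (hy : y ∈ U) (hU : genericPoint Y ∈ U)
    (r : Γ(Y, U)) :
    algebraMap (Y.presheaf.stalk y) Y.functionField (Y.presheaf.germ U y hy r) =
      Y.presheaf.germ U (genericPoint Y) hU r := by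
  have : Nonempty U := ⟨⟨_, hU⟩⟩
  exact Scheme.algebraMap_germ_eq_germToFunctionField Y hy r

lemma functionFieldMap_germ (U : Y.Opens) (hU : genericPoint Y ∈ U)
    (hV : genericPoint X ∈ f ⁻¹ᵁ U) (r : Γ(Y, U)) :
    functionFieldMap f (Y.presheaf.germ U (genericPoint Y) hU r) =
      X.presheaf.germ (f ⁻¹ᵁ U) (genericPoint X) hV (f.app U r) := by
  have hV' : f (genericPoint X) ∈ U := hV
  have hmap := functionFieldMap_algebraMap f (genericPoint X)
    (Y.presheaf.germ U (f (genericPoint X)) hV' r)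
  rw [algebraMap_germ_eq U hV' hU] at hmap
  refine hmap.trans ?_
  rw [← algebraMap_germ_eq _ hV hV]
  congr 1
  exact Scheme.Hom.germ_stalkMap_apply f U (genericPoint X) hV r

lemma genericPoint_mem_preimage {U : Y.Opens} {y : Y} (hy : y ∈ U) :
    genericPoint X ∈ f ⁻¹ᵁ U := by
  change f (genericPoint X) ∈ U
  rw [map_genericPoint]
  exact genericPoint_mem_of_mem hy

variable (f) in
/-- Locally constant families of rational functions on `X` with prescribed local conditions
over `Y`. -/
def constPredicate (Q : ∀ y : Y, Submodule (Y.presheaf.stalk y) (RationalFunctions f)) :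
    LinearPredicate (Y := Y) (fun _ => RationalFunctions f) where
  pred {U} s := ∀ x : U, s x ∈ Q x.1 ∧ ∃ V : Opens Y, x.1 ∈ V ∧ ∀ y : U, y.1 ∈ V → s y = s x
  res {U V} i s hs x := by
    obtain ⟨hsx, W, hW, hconst⟩ := hs (i x)
    exact ⟨hsx, W, hW, fun y hy => hconst (i y) hy⟩
  locality {U} s hs x := by
    obtain ⟨V, hV, i, h⟩ := hs x
    obtain ⟨hsx, W, hW, hconst⟩ := h ⟨x.1, hV⟩
    exact ⟨hsx, V ⊓ W, ⟨hV, hW⟩, fun y hy => hconst ⟨y.1, hy.1⟩ hy.2⟩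
  zero x := ⟨zero_mem _, ⊤, trivial, fun _ _ => rfl⟩
  add s t hs ht x := by
    obtain ⟨hsx, V, hV, hconst⟩ := hs x
    obtain ⟨htx, W, hW, htconst⟩ := ht x
    exact ⟨add_mem hsx htx, V ⊓ W, ⟨hV, hW⟩, fun y hy => by
      change s y + t y = s x + t x; rw [hconst y hy.1, htconst y hy.2]⟩
  neg s hs x := by
    obtain ⟨hsx, V, hV, hconst⟩ := hs x
    exact ⟨neg_mem hsx, V, hV, fun y hy => by change -s y = -s x; rw [hconst y hy]⟩
  smul {U} r s hs x := by
    obtain ⟨hsx, V, hV, hconst⟩ := hs x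
    refine ⟨Submodule.smul_mem _ _ hsx, V, hV, fun y hy => ?_⟩
    change _ • s y = _ • s x
    rw [hconst y hy, Algebra.smul_def, Algebra.smul_def]
    congr 1
    change functionFieldMap f (algebraMap _ _ _) = functionFieldMap f (algebraMap _ _ _)
    rw [algebraMap_germ_eq U y.2 (genericPoint_mem_of_mem x.2),
      algebraMap_germ_eq U x.2 (genericPoint_mem_of_mem x.2)]

lemma constPredicate_value_eq (Q : ∀ y : Y, Submodule (Y.presheaf.stalk y) (RationalFunctions f))
    {U : Y.Opens} (s : Γ((constPredicate f Q).sheaf, U)) (x y : U) :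
    (constPredicate f Q).value s x = (constPredicate f Q).value s y := by
  have hη := genericPoint_mem_of_mem x.2
  have hgen : ∀ z : U, (constPredicate f Q).value s z =
      (constPredicate f Q).value s ⟨genericPoint Y, hη⟩ := fun z => by
    obtain ⟨-, V, hV, h⟩ := (constPredicate f Q).value_pred s z
    exact (h ⟨genericPoint Y, hη⟩ (genericPoint_mem_of_mem hV)).symm
  rw [hgen x, hgen y]

lemma constPredicate_pred_const (Q : ∀ y : Y, Submodule (Y.presheaf.stalk y) (RationalFunctions f))
    {U : Y.Opens} (s : U → RationalFunctions f) (hs : ∀ x y, s x = s y) (h : ∀ x : U, s x ∈ Q x.1) :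
    (constPredicate f Q).pred (U := U) s :=
  fun x => ⟨h x, ⊤, trivial, fun y _ => hs y x⟩

end RationalFunctions

section Opens
variable {Y : Scheme.{u}}

lemma exists_opens_le_of_finite {ι : Type*} [Finite ι] {y : Y} {U : ι → Y.Opens}
    (hU : ∀ i, y ∈ U i) : ∃ W : Y.Opens, y ∈ W ∧ ∀ i, W ≤ U i := by
  have := Fintype.ofFinite ι
  refine ⟨Finset.univ.inf U, ?_, fun i => Finset.inf_le (Finset.mem_univ i)⟩
  rw [← SetLike.mem_coe, Opens.coe_finset_inf, Finset.inf_eq_iInf]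
  simpa using hU

lemma exists_germ_eq_of_finite {ι : Type*} [Finite ι] {y : Y} (t : ι → Y.presheaf.stalk y)
    {V : Y.Opens} (hV : y ∈ V) :
    ∃ (W : Y.Opens) (_ : W ⟶ V) (hW : y ∈ W) (T : ι → Γ(Y, W)),
      ∀ i, Y.presheaf.germ W y hW (T i) = t i := by
  choose U hU s hs using fun i => Y.presheaf.exists_germ_eq (t i)
  obtain ⟨W, hW, hWU⟩ := exists_opens_le_of_finite hU
  refine ⟨V ⊓ W, homOfLE inf_le_left, ⟨hV, hW⟩,
    fun i => Y.presheaf.map (homOfLE (inf_le_right.trans (hWU i))).op (s i), fun i => ?_⟩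
  exact (Y.presheaf.germ_res_apply (homOfLE (inf_le_right.trans (hWU i))) y _ (s i)).trans (hs i)

lemma germ_genericPoint_injective [IsIntegral Y] (U : Y.Opens) (hU : genericPoint Y ∈ U) :
    Function.Injective (Y.presheaf.germ U (genericPoint Y) hU) := by
  have : Nonempty U := ⟨⟨_, hU⟩⟩
  exact Scheme.germToFunctionField_injective Y U

end Opens

section FrobeniusSection
variable {Y : Scheme.{u}} {p : ℕ} (hp : p.Prime) (h : (p : Γ(Y, ⊤)) = 0) (e : ℕ) (N : Y.Modules)

/-- The Frobenius pull-back of a section. -/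
def frobSection {U : Y.Opens} :
    Γ(N, U) →+ Γ((Scheme.Modules.pullback (absFrobenius hp h e)).obj N, U) :=
  pullbackSection (absFrobenius hp h e) N U

lemma frobSection_smul {U : Y.Opens} (r : Γ(Y, U)) (n : Γ(N, U)) :
    frobSection hp h e N (r • n) = r ^ p ^ e • frobSection hp h e N n :=
  pullbackSection_smul (absFrobenius hp h e) N U r n

lemma frobSection_map {U V : Y.Opens} (i : U ⟶ V) (n : Γ(N, V)) :
    frobSection hp h e N (N.presheaf.map i.op n) =
      ((Scheme.Modules.pullback (absFrobenius hp h e)).obj N).presheaf.map i.op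
        (frobSection hp h e N n) :=
  pullbackSection_map (absFrobenius hp h e) N i n

lemma exists_eq_sum_frobSection {V : Y.Opens}
    (s : Γ((Scheme.Modules.pullback (absFrobenius hp h e)).obj N, V)) (y : V) :
    ∃ (W : Y.Opens) (i : W ⟶ V) (_ : y.1 ∈ W) (d : ℕ) (a : Fin d → Γ(Y, W))
      (n : Fin d → Γ(N, W)),
      ((Scheme.Modules.pullback (absFrobenius hp h e)).obj N).presheaf.map i.op s =
        ∑ l, a l • frobSection hp h e N (n l) := by
  obtain ⟨d, r, t, hrt⟩ := Submodule.mem_span_set'.mp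
    (modGerm_mem_span_pullbackSection (absFrobenius hp h e) N s y)
  choose U hU n hn using fun l => (t l).2
  obtain ⟨W, hW, hWU⟩ := exists_opens_le_of_finite hU
  obtain ⟨W', i, hW', a, ha⟩ := exists_germ_eq_of_finite r hW
  let n' (l : Fin d) : Γ(N, W') := N.presheaf.map (i ≫ homOfLE (hWU l)).op (n l)
  have hgerm : modGerm _ y s =
      modGerm _ ⟨y.1, hW'⟩ (∑ l, a l • frobSection hp h e N (n' l)) := by
    rw [← hrt, map_sum]
    refine Finset.sum_congr rfl fun l _ => ?_
    rw [modGerm_smul, ha, ← hn l]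
    congr 1
    exact ((congrArg (modGerm _ ⟨y.1, hW'⟩) (frobSection_map hp h e N _ (n l))).trans
      (modGerm_map _ _ _ _)).symm
  obtain ⟨W'', hW'', j, k, hjk⟩ := exists_map_eq_of_modGerm_eq _ y.2 hW' s _ hgerm
  refine ⟨W'', j, hW'', d, fun l => Y.presheaf.map k.op (a l), fun l => N.presheaf.map k.op (n' l),
    ?_⟩
  rw [hjk, map_sum]
  simp only [Scheme.Modules.map_smul, frobSection_map]

variable {N} in
lemma pow_smul_sum_smul_frobSection_eq_zero {U : Y.Opens} {ι κ : Type*} [Fintype ι] [Fintype κ]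
    {a : ι → Γ(Y, U)} {n : ι → Γ(N, U)} {r : Γ(Y, U)} {d : ι → κ → Γ(Y, U)} {m : κ → Γ(N, U)}
    (hn : ∀ l, r • n l = ∑ k, d l k • m k) (hd : ∀ k, ∑ l, a l * d l k ^ p ^ e = 0) :
    r ^ p ^ e • ∑ l, a l • frobSection hp h e N (n l) = 0 := by
  have hterm (l : ι) : r ^ p ^ e • a l • frobSection hp h e N (n l) =
      ∑ k, (a l * d l k ^ p ^ e) • frobSection hp h e N (m k) := by
    rw [smul_comm, ← frobSection_smul, hn, map_sum, Finset.smul_sum]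
    simp only [frobSection_smul, mul_smul]
  rw [Finset.smul_sum, Finset.sum_congr rfl fun l _ => hterm l, Finset.sum_comm]
  refine Finset.sum_eq_zero fun k _ => ?_
  rw [← Finset.sum_smul, hd, zero_smul]

end FrobeniusSection

lemma app_injective_of_mono {Y : Scheme.{u}} {M N : Y.Modules} (i : M ⟶ N) [Mono i] (U : Y.Opens) :
    Function.Injective (i.app U) := by
  have hi : Mono ((Scheme.Modules.toPresheaf Y).map i) := inferInstance
  exact (AddCommGrpCat.mono_iff_injective _).mp ((NatTrans.mono_iff_mono_app _).mp hi (op U))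

lemma eq_zero_of_locally_eq_zero {Y : Scheme.{u}} {M : Y.Modules} {U : Y.Opens} (m : Γ(M, U))
    (h : ∀ y ∈ U, ∃ (W : Y.Opens) (i : W ⟶ U), y ∈ W ∧ M.presheaf.map i.op m = 0) : m = 0 := by
  choose! W i hW hm using h
  refine TopCat.Sheaf.eq_of_locally_eq' (X := (Y : TopCat.{u})) ⟨M.presheaf, M.isSheaf⟩ (ι := U)
    (fun y => W y.1) U
    (fun y => homOfLE (leOfHom (i y.1 y.2))) (fun y hy => ?_) m 0 fun y => ?_
  · exact Opens.mem_iSup.mpr ⟨⟨y, hy⟩, hW y hy⟩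
  · rw [map_zero]
    exact hm y.1 y.2

lemma exists_section_ne_zero {Y : Scheme.{u}} {M : Y.Modules} (h : ¬ Limits.IsZero M) :
    ∃ (U : Y.Opens) (m : Γ(M, U)), m ≠ 0 := by
  by_contra! hc
  apply h
  rw [Limits.IsZero.iff_id_eq_zero]
  refine Scheme.Modules.hom_ext _ _ fun U => ?_
  ext m
  exact (hc U _).trans (hc U _).symm

lemma charP_of_prime_of_natCast_eq_zero {R : Type*} [NonAssocSemiring R] [Nontrivial R] {p : ℕ}
    (hp : p.Prime) (h : (p : R) = 0) : CharP R p :=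
  ringChar.of_eq ((hp.dvd_iff_eq CharP.ringChar_ne_one).mp (ringChar.dvd h)).symm

lemma natCast_functionField_eq_zero {Y : Scheme.{u}} [IsIntegral Y] {p : ℕ}
    (h : (p : Γ(Y, ⊤)) = 0) : (p : Y.functionField) = 0 := by
  have := congrArg (Y.presheaf.germ ⊤ (genericPoint Y) trivial) h
  rwa [map_natCast, map_zero] at this

lemma natCast_rationalFunctions_eq_zero {X Y : Scheme.{u}} [IsIntegral X] [IsIntegral Y]
    (f : X ⟶ Y) [IsDominant f] {p : ℕ} (h : (p : Γ(Y, ⊤)) = 0) :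
    (p : RationalFunctions f) = 0 := by
  have := congrArg (algebraMap Y.functionField (RationalFunctions f))
    (natCast_functionField_eq_zero h)
  rwa [map_natCast, map_zero] at this

lemma LinearPredicate.value_sum {Y : Scheme.{u}} {B : Y → Type u} [∀ y, AddCommGroup (B y)]
    [∀ y, Module (Y.presheaf.stalk y) (B y)] (P : LinearPredicate B) {U : Y.Opens}
    {ι : Type*} (t : Finset ι) (s : ι → Γ(P.sheaf, U)) (x : U) :
    P.value (∑ i ∈ t, s i) x = ∑ i ∈ t, P.value (s i) x := by
  let v : Γ(P.sheaf, U) →+ B x :=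
    { toFun := fun s => P.value s x, map_zero' := rfl, map_add' := fun _ _ => rfl }
  exact map_sum v s t
section FrobLift
variable {X Y : Scheme.{u}} [IsIntegral X] [IsIntegral Y] {f : X ⟶ Y} [IsDominant f]
  {p : ℕ} (hp : p.Prime) (h : (p : Γ(Y, ⊤)) = 0) (e : ℕ) {M N : Y.Modules}
  {Q₀ Q : ∀ y : Y, Submodule (Y.presheaf.stalk y) (RationalFunctions f)}

lemma value_app_map {P : LinearPredicate (fun _ : Y => RationalFunctions f)} (j : M ⟶ P.sheaf)
    {U V : Y.Opens} (i : U ⟶ V) (m : Γ(M, V)) (x : U) :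
    P.value (j.app U (M.presheaf.map i.op m)) x = P.value (j.app V m) (i x) := by
  have hnat : j.app U (M.presheaf.map i.op m) = P.sheaf.presheaf.map i.op (j.app V m) :=
    congr($(j.mapPresheaf.naturality i.op) m)
  rw [hnat]
  rfl

lemma germ_smul_rationalFunctions {U : Y.Opens} (y : U) (r : Γ(Y, U)) (c : RationalFunctions f) :
    Y.presheaf.germ U y.1 y.2 r • c =
      (Y.presheaf.germ U (genericPoint Y) (genericPoint_mem_of_mem y.2) r :
        Y.functionField) • c := by
  rw [← algebraMap_germ_eq U y.2, algebraMap_smul]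

/-- The `p ^ e`-th power of a morphism into a sheaf of rational functions. -/
def frobPower (j : M ⟶ (constPredicate f Q₀).sheaf)
    (hQ : ∀ (U : Y.Opens) (m : Γ(M, U)) (x : U),
      (constPredicate f Q₀).value (j.app U m) x ^ p ^ e ∈ Q x) :
    M ⟶ (Scheme.Modules.pushforward (absFrobenius hp h e)).obj (constPredicate f Q).sheaf :=
  (constPredicate f Q).homPushforward (absFrobenius hp h e) M
    (fun U x =>
      { toFun := fun m => (constPredicate f Q₀).value (j.app U m) (⟨x.1, x.2⟩ : U) ^ p ^ e
        map_zero' := by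
          rw [map_zero]
          exact zero_pow (pow_ne_zero _ hp.ne_zero)
        map_add' := fun m n => by
          rw [map_add]
          exact add_pow_of_natCast_eq_zero hp (natCast_rationalFunctions_eq_zero f h) e _ _ })
    (fun U V i m x => congrArg (· ^ p ^ e) (value_app_map j i m ⟨x.1, x.2⟩))
    (fun U r m x => by
      change (constPredicate f Q₀).value (j.app U _) (⟨x.1, x.2⟩ : U) ^ p ^ e =
        Y.presheaf.germ U x.1 x.2 (r ^ p ^ e) •
          (constPredicate f Q₀).value (j.app U m) (⟨x.1, x.2⟩ : U) ^ p ^ e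
      rw [Scheme.Modules.Hom.app_smul, LinearPredicate.value_smul, smul_pow, map_pow])
    (fun U m => constPredicate_pred_const _ _
      (fun x y => congrArg (· ^ p ^ e) (constPredicate_value_eq Q₀ _ _ _))
      (fun x => hQ U m ⟨x.1, x.2⟩))

/-- The morphism on the Frobenius pull-back given by `p ^ e`-th powers. -/
def frobLift (j : M ⟶ (constPredicate f Q₀).sheaf)
    (hQ : ∀ (U : Y.Opens) (m : Γ(M, U)) (x : U),
      (constPredicate f Q₀).value (j.app U m) x ^ p ^ e ∈ Q x) :
    (Scheme.Modules.pullback (absFrobenius hp h e)).obj M ⟶ (constPredicate f Q).sheaf :=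
  pullbackLift (frobPower hp h e j hQ)

lemma value_frobLift_app_frobSection (j : M ⟶ (constPredicate f Q₀).sheaf)
    (hQ : ∀ (U : Y.Opens) (m : Γ(M, U)) (x : U),
      (constPredicate f Q₀).value (j.app U m) x ^ p ^ e ∈ Q x) {U : Y.Opens} (m : Γ(M, U)) (x : U) :
    (constPredicate f Q).value ((frobLift hp h e j hQ).app U (frobSection hp h e M m)) x =
      (constPredicate f Q₀).value (j.app U m) x ^ p ^ e :=
  congrArg (fun t => (constPredicate f Q).value (U := U) t x)
    (pullbackLift_app_pullbackSection (frobPower hp h e j hQ) U m)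

lemma exists_sections_eq_mul_of_functionField {ι : Type*} [Finite ι] (c : ι → Y.functionField)
    {y : Y} {V : Y.Opens} (hV : y ∈ V) :
    ∃ (W : Y.Opens) (_ : W ⟶ V) (hW : y ∈ W) (r : Γ(Y, W)) (d : ι → Γ(Y, W)), r ≠ 0 ∧
      ∀ i, (Y.presheaf.germ W (genericPoint Y) (genericPoint_mem_of_mem hW) (d i) :
        Y.functionField) =
          Y.presheaf.germ W (genericPoint Y) (genericPoint_mem_of_mem hW) r * c i := by
  obtain ⟨r, hr⟩ := IsLocalization.exist_integer_multiples_of_finite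
    (nonZeroDivisors (Y.presheaf.stalk y)) c
  choose d hd using hr
  obtain ⟨W, k, hW, T, hT⟩ := exists_germ_eq_of_finite (fun o : Option ι => o.elim r.1 d) hV
  have hη := genericPoint_mem_of_mem hW
  refine ⟨W, k, hW, T none, fun i => T (some i), fun h0 => ?_, fun i => ?_⟩
  · have := hT none
    rw [h0, map_zero] at this
    exact nonZeroDivisors.coe_ne_zero r this.symm
  · rw [← algebraMap_germ_eq W hW hη, ← algebraMap_germ_eq W hW hη, hT, hT]
    exact (hd i).trans (Algebra.smul_def _ _)

lemma smul_eq_sum_of_value_eq {ι : Type*} [Fintype ι] (j : N ⟶ (constPredicate f Q₀).sheaf)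
    {U : Y.Opens} (hj : Function.Injective (j.app U)) (y : U) {r : Γ(Y, U)} {d : ι → Γ(Y, U)}
    {c : ι → Y.functionField} {n : Γ(N, U)} {m : ι → Γ(N, U)}
    (hd : ∀ i, (Y.presheaf.germ U (genericPoint Y) (genericPoint_mem_of_mem y.2) (d i) :
      Y.functionField) =
        Y.presheaf.germ U (genericPoint Y) (genericPoint_mem_of_mem y.2) r * c i)
    (hn : (constPredicate f Q₀).value (j.app U n) y =
      ∑ i, c i • (constPredicate f Q₀).value (j.app U (m i)) y) :
    r • n = ∑ i, d i • m i := by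
  refine hj ((constPredicate f Q₀).value_ext fun x => ?_)
  rw [constPredicate_value_eq Q₀ _ x y, constPredicate_value_eq Q₀ (j.app U (∑ i, _)) x y, map_sum,
    LinearPredicate.value_sum]
  simp only [Scheme.Modules.Hom.app_smul, LinearPredicate.value_smul, germ_smul_rationalFunctions,
    hd, mul_smul]
  rw [hn, Finset.smul_sum]

lemma sum_smul_value_pow_eq_zero (j : N ⟶ (constPredicate f Q₀).sheaf)
    (hQ : ∀ (U : Y.Opens) (m : Γ(N, U)) (x : U),
      (constPredicate f Q₀).value (j.app U m) x ^ p ^ e ∈ Q x)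
    {U : Y.Opens} (y : U) {ι : Type*} [Fintype ι] {a : ι → Γ(Y, U)} {n : ι → Γ(N, U)}
    (hs : (frobLift hp h e j hQ).app U (∑ l, a l • frobSection hp h e N (n l)) = 0) :
    ∑ l, (Y.presheaf.germ U (genericPoint Y) (genericPoint_mem_of_mem y.2) (a l) :
      Y.functionField) • (constPredicate f Q₀).value (j.app U (n l)) y ^ p ^ e = 0 := by
  have hval := congrArg (fun t => (constPredicate f Q).value t y) hs
  simp only [map_sum, LinearPredicate.value_sum, Scheme.Modules.Hom.app_smul,
    LinearPredicate.value_smul, value_frobLift_app_frobSection,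
    germ_smul_rationalFunctions] at hval
  exact hval

lemma exists_smul_map_eq_zero_of_frobLift_eq_zero (hsep : IsSeparableMorphism f)
    (j : N ⟶ (constPredicate f Q₀).sheaf)
    (hj : ∀ U : Y.Opens, Function.Injective (j.app U))
    (hQ : ∀ (U : Y.Opens) (m : Γ(N, U)) (x : U),
      (constPredicate f Q₀).value (j.app U m) x ^ p ^ e ∈ Q x)
    {V : Y.Opens} (s : Γ((Scheme.Modules.pullback (absFrobenius hp h e)).obj N, V)) (y : V)
    (hs : (frobLift hp h e j hQ).app V s = 0) :
    ∃ (W : Y.Opens) (i : W ⟶ V) (_ : y.1 ∈ W) (r : Γ(Y, W)), r ≠ 0 ∧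
      r • ((Scheme.Modules.pullback (absFrobenius hp h e)).obj N).presheaf.map i.op s = 0 := by
  have : Fact p.Prime := ⟨hp⟩
  have : CharP Y.functionField p :=
    charP_of_prime_of_natCast_eq_zero hp (natCast_functionField_eq_zero h)
  have : Algebra.IsGeometricallyReduced Y.functionField (RationalFunctions f) := hsep
  obtain ⟨W, i, hW, d, a, n, hsum⟩ := exists_eq_sum_frobSection hp h e N s y
  have hzero : (frobLift hp h e j hQ).app W (∑ l, a l • frobSection hp h e N (n l)) = 0 := by
    refine (constPredicate f Q).value_ext fun x => ?_
    rw [← hsum, value_app_map, hs]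
    rfl
  obtain ⟨κ, _, b, c, hc, hac⟩ := exists_linearRelations_of_sum_smul_pow_eq_zero e _ _
    (sum_smul_value_pow_eq_zero hp h e j hQ ⟨y.1, hW⟩ hzero)
  obtain ⟨W', i', hW', r, T, hr0, hT⟩ :=
    exists_sections_eq_mul_of_functionField (fun li : Fin d × κ => c li.1 li.2) hW
  have hlin (l : Fin d) : r • N.presheaf.map i'.op (n l) =
      ∑ k, T (l, k) • N.presheaf.map i'.op (n (b k)) := by
    refine smul_eq_sum_of_value_eq j (hj W') ⟨y.1, hW'⟩ (fun k => hT (l, k)) ?_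
    simp only [value_app_map]
    exact hc l
  have hcoef (k : κ) : ∑ l, Y.presheaf.map i'.op (a l) * T (l, k) ^ p ^ e = 0 := by
    apply germ_genericPoint_injective W' (genericPoint_mem_of_mem hW')
    rw [map_zero, map_sum,
      ← mul_zero (Y.presheaf.germ W' _ (genericPoint_mem_of_mem hW') r ^ p ^ e), ← hac k,
      Finset.mul_sum]
    refine Finset.sum_congr rfl fun l _ => ?_
    rw [map_mul, map_pow, hT, Y.presheaf.germ_res_apply]
    ring
  refine ⟨W', i' ≫ i, hW', r ^ p ^ e, pow_ne_zero _ hr0, ?_⟩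
  rw [op_comp, Functor.map_comp, ConcreteCategory.comp_apply, hsum, map_sum]
  simp only [Scheme.Modules.map_smul, ← frobSection_map]
  exact pow_smul_sum_smul_frobSection_eq_zero hp h e hlin hcoef

lemma comp_frobLift_app_injective (hsep : IsSeparableMorphism f)
    (j : N ⟶ (constPredicate f Q₀).sheaf)
    (hj : ∀ U : Y.Opens, Function.Injective (j.app U))
    (hQ : ∀ (U : Y.Opens) (m : Γ(N, U)) (x : U),
      (constPredicate f Q₀).value (j.app U m) x ^ p ^ e ∈ Q x)
    (i : M ⟶ (Scheme.Modules.pullback (absFrobenius hp h e)).obj N) [Mono i]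
    (hM : IsTorsionFree M) (U : Y.Opens) :
    Function.Injective ((i ≫ frobLift hp h e j hQ).app U) := by
  refine (injective_iff_map_eq_zero ((i ≫ frobLift hp h e j hQ).app U).hom).mpr fun m hm => ?_
  refine eq_zero_of_locally_eq_zero m fun y hy => ?_
  obtain ⟨W, k, hW, r, hr, hsmul⟩ :=
    exists_smul_map_eq_zero_of_frobLift_eq_zero hp h e hsep j hj hQ (i.app U m) ⟨y, hy⟩ hm
  refine ⟨W, k, hW, (hM W r _ ?_).resolve_left hr⟩
  apply app_injective_of_mono i W
  rw [map_zero, Scheme.Modules.Hom.app_smul, ← hsmul]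
  congr 1
  exact congr($(i.mapPresheaf.naturality k.op) m)

end FrobLift

section GlobalSection
variable {X Y : Scheme.{u}} [IsIntegral X] [IsIntegral Y] {f : X ⟶ Y} [IsDominant f]

/-- The inverse of `𝒪_{Y,y} → K(Y)` on the rational functions with regular image under a linear
functional. -/
def regularPart {v : Y} (ell : RationalFunctions f →ₗ[Y.functionField] Y.functionField)
    (Q : Submodule (Y.presheaf.stalk v) (RationalFunctions f))
    (hQ : ∀ c ∈ Q, ell c ∈ localRing v) : Q →ₗ[Y.presheaf.stalk v] Y.presheaf.stalk v :=
  (LinearEquiv.ofInjective (Algebra.linearMap (Y.presheaf.stalk v) Y.functionField)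
    (IsFractionRing.injective _ Y.functionField)).symm.toLinearMap.comp
    ((ell.restrictScalars (Y.presheaf.stalk v)).restrict (p := Q)
      (q := LinearMap.range (Algebra.linearMap (Y.presheaf.stalk v) Y.functionField)) hQ)

lemma algebraMap_regularPart {v : Y}
    (ell : RationalFunctions f →ₗ[Y.functionField] Y.functionField)
    (Q : Submodule (Y.presheaf.stalk v) (RationalFunctions f))
    (hQ : ∀ c ∈ Q, ell c ∈ localRing v) (c : Q) :
    algebraMap (Y.presheaf.stalk v) Y.functionField (regularPart ell Q hQ c) = ell c := by
  have := (LinearEquiv.ofInjective (Algebra.linearMap (Y.presheaf.stalk v) Y.functionField)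
    (IsFractionRing.injective _ Y.functionField)).apply_symm_apply
    (((ell.restrictScalars (Y.presheaf.stalk v)).restrict (p := Q)
      (q := LinearMap.range (Algebra.linearMap (Y.presheaf.stalk v) Y.functionField)) hQ) c)
  exact congrArg Subtype.val this

lemma fromSpecResidueField_apply {Y : Scheme.{u}} (y : Y) (z : Spec (Y.residueField y)) :
    Y.fromSpecResidueField y z = y := by
  have : Y.fromSpecResidueField y z ∈ Set.range (Y.fromSpecResidueField y) := ⟨z, rfl⟩
  rwa [Scheme.range_fromSpecResidueField] at this

section ResidueHom
variable {y : Y} {Q : ∀ y : Y, Submodule (Y.presheaf.stalk y) (RationalFunctions f)}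
  (ell : RationalFunctions f →ₗ[Y.functionField] Y.functionField)
  (hQ : ∀ c ∈ Q y, ell c ∈ localRing y)

/-- The additive map taking a section of a sheaf of rational functions to the image, in the local
ring at a point of `Spec κ(y)`, of its value under a linear functional. -/
def residueValue (U : Y.Opens)
    (z : (Y.fromSpecResidueField y ⁻¹ᵁ U : (Spec (Y.residueField y)).Opens)) :
    Γ((constPredicate f Q).sheaf, U) →+ (Spec (Y.residueField y)).presheaf.stalk z.1 :=
  let hz : ∀ c ∈ Q (Y.fromSpecResidueField y z.1),
      ell c ∈ localRing (Y.fromSpecResidueField y z.1) := by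
    rw [fromSpecResidueField_apply]
    exact hQ
  ((Y.fromSpecResidueField y).stalkMap z.1).hom.toAddMonoidHom.comp <|
    (regularPart ell _ hz).toAddMonoidHom.comp
      { toFun := fun m => ⟨(constPredicate f Q).value m ⟨_, z.2⟩,
          ((constPredicate f Q).value_pred m ⟨_, z.2⟩).1⟩
        map_zero' := rfl
        map_add' := fun _ _ => rfl }

/-- The morphism from a sheaf of rational functions to the skyscraper sheaf `κ(y)` given by a linear
functional. The skyscraper sheaf is the direct image along `Spec κ(y) → Y`. -/
def residueHom : (constPredicate f Q).sheaf ⟶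
    (Scheme.Modules.pushforward (Y.fromSpecResidueField y)).obj
      (LinearPredicate.univ fun z : Spec (Y.residueField y) =>
        ((Spec (Y.residueField y)).presheaf.stalk z : Type u)).sheaf :=
  LinearPredicate.homPushforward _ _ _ (residueValue ell hQ) (fun _ _ _ _ _ => rfl)
    (fun U r m z => by
      let c : Q (Y.fromSpecResidueField y z.1) := ⟨(constPredicate f Q).value m ⟨_, z.2⟩,
        ((constPredicate f Q).value_pred m ⟨_, z.2⟩).1⟩
      change (Y.fromSpecResidueField y).stalkMap z.1
        (regularPart ell _ _ (Y.presheaf.germ U _ z.2 r • c)) = _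
      rw [map_smul, smul_eq_mul, map_mul]
      exact congrArg (· * _)
        (Scheme.Hom.germ_stalkMap_apply (Y.fromSpecResidueField y) U z.1 z.2 r))
    (fun _ _ => trivial)

lemma residueHom_app_ne_zero {V : Y.Opens} (hy : y ∈ V) (m : Γ((constPredicate f Q).sheaf, V))
    (hm : ell ((constPredicate f Q).value m ⟨y, hy⟩) = 1) :
    (residueHom ell hQ).app V m ≠ 0 := by
  intro h0
  let z : Spec (Y.residueField y) := Classical.arbitrary _
  have hz : z ∈ Y.fromSpecResidueField y ⁻¹ᵁ V := by
    change Y.fromSpecResidueField y z ∈ V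
    rwa [fromSpecResidueField_apply]
  have hzero : residueValue ell hQ V ⟨z, hz⟩ m = 0 :=
    congrArg (fun s => (LinearPredicate.univ fun z : Spec (Y.residueField y) =>
      ((Spec (Y.residueField y)).presheaf.stalk z : Type u)).value
        (U := Y.fromSpecResidueField y ⁻¹ᵁ V) s ⟨z, hz⟩) h0
  have hone : residueValue ell hQ V ⟨z, hz⟩ m = 1 := by
    refine (congrArg (fun c => (Y.fromSpecResidueField y).stalkMap z c) ?_).trans (map_one _)
    apply IsFractionRing.injective _ Y.functionField
    refine (algebraMap_regularPart ell _ _ _).trans (Eq.trans ?_ (map_one _).symm)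
    exact (congrArg ell (constPredicate_value_eq Q _ _ _)).trans hm
  exact one_ne_zero (hone.symm.trans hzero)

end ResidueHom

lemma app_eq_zero_of_app_top_eq_zero {Y : Scheme.{u}} {G : Y.Modules} {y : Y}
    (hG : Function.Surjective (((Scheme.Modules.pullbackPushforwardAdjunction
        (Y.fromSpecResidueField y)).unit.app G).app ⊤))
    {N : (Spec (Y.residueField y)).Modules}
    (φ : G ⟶ (Scheme.Modules.pushforward (Y.fromSpecResidueField y)).obj N)
    (hφ : ∀ γ : Γ(G, ⊤), φ.app ⊤ γ = 0) {V : Y.Opens} (hy : y ∈ V) (t : Γ(G, V)) :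
    φ.app V t = 0 := by
  have hzero : ∀ W : (Spec (Y.residueField y)).Opens, W = Y.fromSpecResidueField y ⁻¹ᵁ ⊤ →
      ∀ s, (pullbackLift φ).app W s = 0 := by
    rintro _ rfl s
    obtain ⟨γ, rfl⟩ := hG s
    exact (pullbackLift_app_pullbackSection φ ⊤ γ).trans (hφ γ)
  have htop : Y.fromSpecResidueField y ⁻¹ᵁ V = Y.fromSpecResidueField y ⁻¹ᵁ ⊤ := by
    refine le_antisymm (fun _ _ => trivial) fun z _ => ?_
    change Y.fromSpecResidueField y z ∈ V
    rwa [fromSpecResidueField_apply]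
  exact (pullbackLift_app_pullbackSection φ V t).symm.trans (hzero _ htop _)

lemma exists_app_top_ne_zero {G : Y.Modules} {y : Y}
    (hG : Function.Surjective (((Scheme.Modules.pullbackPushforwardAdjunction
        (Y.fromSpecResidueField y)).unit.app G).app ⊤))
    {Q : ∀ y : Y, Submodule (Y.presheaf.stalk y) (RationalFunctions f)}
    (ψ : G ⟶ (constPredicate f Q).sheaf)
    (ell : RationalFunctions f →ₗ[Y.functionField] Y.functionField)
    (hQ : ∀ c ∈ Q y, ell c ∈ localRing y) {V : Y.Opens} (hy : y ∈ V) (t : Γ(G, V))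
    (ht : ell ((constPredicate f Q).value (ψ.app V t) ⟨y, hy⟩) = 1) :
    ∃ γ : Γ(G, ⊤), ψ.app ⊤ γ ≠ 0 := by
  by_contra! hψ
  refine residueHom_app_ne_zero ell hQ hy _ ht
    (app_eq_zero_of_app_top_eq_zero hG (ψ ≫ residueHom ell hQ) (fun γ => ?_) hy t)
  change (residueHom ell hQ).app ⊤ (ψ.app ⊤ γ) = 0
  rw [hψ, map_zero]

end GlobalSection

section StalkFamily
variable {X Y : Scheme.{u}} [IsIntegral X] [IsIntegral Y] (f : X ⟶ Y) [IsDominant f]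

/-- The rational functions on `X` which are sections of `𝒪_X(Z)` along the fibre over `y`. -/
def stalkFamily (Z : CDiv X) (y : Y) : Submodule (Y.presheaf.stalk y) (RationalFunctions f) where
  carrier := {c | ∀ x : X, f x = y → (show X.functionField from c) ∈ Z.stalk x}
  zero_mem' _ _ := zero_mem _
  add_mem' ha hb x hx := add_mem (ha x hx) (hb x hx)
  smul_mem' r c hc x hx := by
    subst hx
    exact CDiv.localRing_mul_mem_stalk (functionFieldMap_mem_localRing f ⟨r, rfl⟩) (hc x rfl)

/-- The embedding of `f_* 𝒪_X(D)` into a sheaf of rational functions. -/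
def pushforwardHom (D : CDiv X) : (Scheme.Modules.pushforward f).obj D.sheaf ⟶
    (constPredicate f (stalkFamily f D)).sheaf :=
  (constPredicate f (stalkFamily f D)).hom _
    (fun U y => sectionValue (D := D) (V := f ⁻¹ᵁ U) (genericPoint_mem_preimage y.2))
    (fun _ _ _ _ _ => rfl)
    (fun U r m y => by
      refine (sectionValue_smul (D := D) (V := f ⁻¹ᵁ U) (genericPoint_mem_preimage y.2)
        (f.app U r) m).trans ?_
      change _ = functionFieldMap f (algebraMap _ _ _) * _
      rw [algebraMap_germ_eq U y.2 (genericPoint_mem_of_mem y.2),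
        functionFieldMap_germ U _ (genericPoint_mem_preimage y.2)]
      rfl)
    (fun U m => constPredicate_pred_const _ _ (fun _ _ => rfl) fun y x hx =>
      sectionValue_mem_stalk (D := D) (V := f ⁻¹ᵁ U) (genericPoint_mem_preimage y.2) m
        (by change f x ∈ U; rw [hx]; exact y.2))

lemma pushforwardHom_app_injective (D : CDiv X) (U : Y.Opens) :
    Function.Injective ((pushforwardHom f D).app U) := by
  intro s t h
  by_cases hU : ∃ y, y ∈ U
  · obtain ⟨y, hy⟩ := hU
    exact sectionValue_injective (D := D) (V := f ⁻¹ᵁ U) (genericPoint_mem_preimage hy)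
      (congrArg (fun m => (constPredicate f (stalkFamily f D)).value (U := U) m ⟨y, hy⟩) h)
  · exact Subtype.ext (funext fun x => absurd ⟨f x.1, x.2⟩ hU)

variable {f}

lemma pow_value_mem_stalkFamily {D : CDiv X} {M : Y.Modules}
    (j : M ⟶ (constPredicate f (stalkFamily f D)).sheaf) (n : ℕ) {U : Y.Opens} (m : Γ(M, U))
    (x : U) : (constPredicate f (stalkFamily f D)).value (j.app U m) x ^ n ∈
      stalkFamily f (n • D) x := fun z hz =>
  CDiv.pow_mem_stalk (((constPredicate f (stalkFamily f D)).value_pred (j.app U m) x).1 z hz) _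

lemma mul_algebraMap_mem_stalkFamily {Z : CDiv X} {E : CDiv Y} {y : Y} {c : RationalFunctions f}
    {s : Y.functionField} (hc : c ∈ stalkFamily f Z y) (hs : s ∈ E.stalk y) :
    c * algebraMap Y.functionField (RationalFunctions f) s ∈
      stalkFamily f (Z + CDiv.pullback f E) y := by
  rintro x rfl
  exact CDiv.mul_mem_stalk (hc x rfl) (CDiv.functionFieldMap_mem_stalk f hs)

/-- The rational functions on `X` whose value under a linear functional is regular at `y`, where a
condition is imposed only for `y ∈ O`. -/
def regularFamily (O : Y.Opens) (ell : RationalFunctions f →ₗ[Y.functionField] Y.functionField)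
    (y : Y) : Submodule (Y.presheaf.stalk y) (RationalFunctions f) :=
  ⨅ _ : y ∈ O, Submodule.comap (ell.restrictScalars (Y.presheaf.stalk y))
    (LinearMap.range (Algebra.linearMap (Y.presheaf.stalk y) Y.functionField))

lemma mem_regularFamily {O : Y.Opens}
    {ell : RationalFunctions f →ₗ[Y.functionField] Y.functionField} {y : Y}
    {c : RationalFunctions f} :
    c ∈ regularFamily O ell y ↔ (y ∈ O → ell c ∈ localRing y) :=
  Submodule.mem_iInf _

lemma mul_algebraMap_mem_regularFamily {O : Y.Opens} {E : CDiv Y} {g : (Y.functionField)ˣ}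
    (hg : ∀ y ∈ O, E.germ y = QuotientGroup.mk g)
    {ell : RationalFunctions f →ₗ[Y.functionField] Y.functionField} {y : Y}
    {c : RationalFunctions f} {s : Y.functionField} (hc : c ∈ regularFamily O ell y)
    (hs : s ∈ E.stalk y) :
    c * algebraMap Y.functionField (RationalFunctions f) s ∈
      regularFamily O ((g : Y.functionField) • ell) y := by
  refine mem_regularFamily.mpr fun hy => ?_
  have hprod := mul_mem ((CDiv.mem_stalk_iff (hg y hy)).mp hs) (mem_regularFamily.mp hc hy)
  rwa [mul_comm c, ← Algebra.smul_def, map_smul, LinearMap.smul_apply, smul_eq_mul, smul_eq_mul,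
    ← mul_assoc]

end StalkFamily

section GenericValues
variable {X Y : Scheme.{u}} [IsIntegral X] [IsIntegral Y] {f : X ⟶ Y} [IsDominant f]

lemma value_mem_span_of_modGerm_mem_span {M : Y.Modules}
    {P : LinearPredicate (fun _ : Y => RationalFunctions f)} (j : M ⟶ P.sheaf) {W : Y.Opens}
    {ι : Type*} [Finite ι] (m : ι → Γ(M, W)) {V : Y.Opens} (s : Γ(M, V)) {y : Y} (hy : y ∈ V)
    (hW : y ∈ W)
    (h : modGerm M ⟨y, hy⟩ s ∈ Submodule.span (Y.presheaf.stalk y)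
      (Set.range fun l => (modGerm M ⟨y, hW⟩ (m l) : modStalk M y))) :
    P.value (j.app V s) ⟨y, hy⟩ ∈ Submodule.span (Y.presheaf.stalk y)
      (Set.range fun l => P.value (j.app W (m l)) ⟨y, hW⟩) := by
  have := Fintype.ofFinite ι
  obtain ⟨c, hc⟩ := (Submodule.mem_span_range_iff_exists_fun _).mp h
  obtain ⟨W', i, hW', T, hT⟩ := exists_germ_eq_of_finite c hW
  have hgerm : modGerm M ⟨y, hW'⟩ (∑ l, T l • M.presheaf.map i.op (m l)) =
      modGerm M ⟨y, hy⟩ s := by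
    rw [← hc, map_sum]
    refine Finset.sum_congr rfl fun l _ => ?_
    rw [modGerm_smul, modGerm_map, hT]
    rfl
  obtain ⟨W'', hW'', a, b, hab⟩ := exists_map_eq_of_modGerm_eq M hW' hy _ _ hgerm
  have hvalue : P.value (j.app V s) ⟨y, hy⟩ =
      P.value (j.app W' (∑ l, T l • M.presheaf.map i.op (m l))) ⟨y, hW'⟩ := by
    have ha := value_app_map j a (∑ l, T l • M.presheaf.map i.op (m l)) ⟨y, hW''⟩
    have hb := value_app_map j b s ⟨y, hW''⟩
    rw [← hab] at hb
    exact hb.symm.trans ha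
  rw [hvalue, map_sum, LinearPredicate.value_sum]
  refine Submodule.sum_mem _ fun l _ => ?_
  rw [Scheme.Modules.Hom.app_smul, LinearPredicate.value_smul, value_app_map]
  exact Submodule.smul_mem _ _ (Submodule.subset_span ⟨l, rfl⟩)

lemma exists_generating_values [Nonempty Y] {M : Y.Modules} (hM : IsCoherent M)
    {Q : ∀ y : Y, Submodule (Y.presheaf.stalk y) (RationalFunctions f)}
    (j : M ⟶ (constPredicate f Q).sheaf) :
    ∃ W : Y.Opens, genericPoint Y ∈ W ∧ ∃ (ι : Type u) (_ : Finite ι) (m : ι → Γ(M, W))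
      (v : ι → RationalFunctions f),
      (∀ l (y : W), (constPredicate f Q).value (j.app W (m l)) y = v l) ∧
      ∀ (U : Y.Opens) (s : Γ(M, U)) (y : U), y.1 ∈ W →
        (constPredicate f Q).value (j.app U s) y ∈
          Submodule.span (Y.presheaf.stalk y.1) (Set.range v) := by
  obtain ⟨W, ⟨w, hw⟩, ι, _, m, hm⟩ := hM.exists_generators
  have hηW : genericPoint Y ∈ W := genericPoint_mem_of_mem hw
  refine ⟨W, hηW, ι, ‹_›, m, fun l => (constPredicate f Q).value (j.app W (m l)) ⟨_, hηW⟩,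
    fun l y => constPredicate_value_eq _ _ _ _, fun U s y hyW => ?_⟩
  have hmem := value_mem_span_of_modGerm_mem_span j m _ (show y.1 ∈ U ⊓ W from ⟨y.2, hyW⟩) hyW
    (hm (U ⊓ W) (homOfLE inf_le_right)
      (M.presheaf.map (homOfLE inf_le_left : U ⊓ W ⟶ U).op s) ⟨y, y.2, hyW⟩)
  rw [value_app_map] at hmem
  convert hmem using 4
  · exact constPredicate_value_eq _ _ _ _
  · rfl

lemma exists_generating_value_ne_zero {M : Y.Modules} (hM : ¬ Limits.IsZero M)
    {Q : ∀ y : Y, Submodule (Y.presheaf.stalk y) (RationalFunctions f)}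
    (j : M ⟶ (constPredicate f Q).sheaf) (hj : ∀ U : Y.Opens, Function.Injective (j.app U))
    {W : Y.Opens} (hW : genericPoint Y ∈ W) {ι : Type*} {v : ι → RationalFunctions f}
    (hv : ∀ (U : Y.Opens) (s : Γ(M, U)) (y : U), y.1 ∈ W →
      (constPredicate f Q).value (j.app U s) y ∈
        Submodule.span (Y.presheaf.stalk y.1) (Set.range v)) :
    ∃ l, v l ≠ 0 := by
  by_contra! h0
  obtain ⟨U, s, hs⟩ := exists_section_ne_zero hM
  refine hs (hj U ?_)
  rw [map_zero]
  refine (constPredicate f Q).value_ext fun x => ?_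
  have hspan (y : Y) : Submodule.span (Y.presheaf.stalk y) (Set.range v) ≤ ⊥ := by
    rw [Submodule.span_le]
    rintro _ ⟨l, rfl⟩
    exact h0 l
  exact (constPredicate_value_eq _ _ _ ⟨_, genericPoint_mem_of_mem x.2⟩).trans
    (hspan _ (hv U s ⟨_, genericPoint_mem_of_mem x.2⟩ hW))

lemma exists_opens_forall_mem_localRing {ι : Type*} [Finite ι] (t : ι → Y.functionField)
    (V : Y.Opens) (hV : genericPoint Y ∈ V) :
    ∃ W : Y.Opens, W ≤ V ∧ genericPoint Y ∈ W ∧ ∀ y ∈ W, ∀ l, t l ∈ localRing y := by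
  obtain ⟨W, i, hW, T, hT⟩ := exists_germ_eq_of_finite t hV
  exact ⟨W, i.le, hW, fun y hy l => ⟨Y.presheaf.germ W y hy (T l),
    (algebraMap_germ_eq W hy hW (T l)).trans (hT l)⟩⟩

lemma exists_regular_dual {ι : Type*} [Finite ι] (w : ι → RationalFunctions f) {l₀ : ι}
    (hw : w l₀ ≠ 0) (V : Y.Opens) (hV : genericPoint Y ∈ V) :
    ∃ (ell : RationalFunctions f →ₗ[Y.functionField] Y.functionField) (O : Y.Opens),
      ell (w l₀) = 1 ∧ O ≤ V ∧ genericPoint Y ∈ O ∧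
        ∀ y, Submodule.span (Y.presheaf.stalk y) (Set.range w) ≤ regularFamily O ell y := by
  obtain ⟨ell, hell⟩ := Module.Projective.exists_dual_ne_zero Y.functionField hw
  obtain ⟨O, hOV, hO, hreg⟩ :=
    exists_opens_forall_mem_localRing (fun l => ((ell (w l₀))⁻¹ • ell) (w l)) V hV
  refine ⟨(ell (w l₀))⁻¹ • ell, O, inv_mul_cancel₀ hell, hOV, hO, fun y => ?_⟩
  rw [Submodule.span_le]
  rintro _ ⟨l, rfl⟩
  exact mem_regularFamily.mpr fun hy => hreg y hy l

end GenericValues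

section TwistHom
variable {X Y : Scheme.{u}} [IsIntegral X] [IsIntegral Y] {f : X ⟶ Y} [IsDominant f]
  {Q Q' : ∀ y : Y, Submodule (Y.presheaf.stalk y) (RationalFunctions f)} {N : Y.Modules}
  (ψ : N ⟶ (constPredicate f Q).sheaf) (E : CDiv Y)
  (hE : ∀ (y : Y), ∀ c ∈ Q y, ∀ s ∈ E.stalk y,
    c * algebraMap Y.functionField (RationalFunctions f) s ∈ Q' y)

/-- The product of the value of a section of `N` under a morphism to a sheaf of rational functions
and a section of `𝒪_Y(E)`. -/
def twistPairing (U : Y.Opens) (n : Γ(N, U)) (s : Γ(E.sheaf, U)) :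
    Γ((constPredicate f Q').sheaf, U) :=
  (⟨fun x => (constPredicate f Q).value (ψ.app U n) x *
      algebraMap Y.functionField (RationalFunctions f)
        (sectionValue (genericPoint_mem_of_mem x.2) s),
    constPredicate_pred_const _ _
      (fun x x' => by rw [constPredicate_value_eq Q (ψ.app U n) x x'])
      fun x => hE _ _ ((constPredicate f Q).value_pred (ψ.app U n) x).1 _
        (sectionValue_mem_stalk _ s x.2)⟩ : (constPredicate f Q').sections U)

/-- The twist by `𝒪_Y(E)` of a morphism to a sheaf of rational functions. -/
def twistHom : tensor N E.sheaf ⟶ (constPredicate f Q').sheaf :=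
  tensorLift (twistPairing ψ E hE)
    (fun U n n' s => (constPredicate f Q').value_ext fun x => by
      change (constPredicate f Q).value (ψ.app U (n + n')) x * _ =
        (constPredicate f Q).value (ψ.app U n) x * _ + (constPredicate f Q).value (ψ.app U n') x * _
      rw [map_add, ← add_mul]
      rfl)
    (fun U n s s' => (constPredicate f Q').value_ext fun x => by
      change _ * algebraMap _ (RationalFunctions f) (sectionValue _ (s + s')) =
        _ * algebraMap _ (RationalFunctions f) (sectionValue _ s) +
        _ * algebraMap _ (RationalFunctions f) (sectionValue _ s')
      rw [map_add, map_add, mul_add])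
    (fun U r n s => (constPredicate f Q').value_ext fun x => by
      change (constPredicate f Q).value (ψ.app U (r • n)) x * _ =
        _ • ((constPredicate f Q).value (ψ.app U n) x * _)
      rw [Scheme.Modules.Hom.app_smul, LinearPredicate.value_smul, smul_mul_assoc])
    (fun U r n s => (constPredicate f Q').value_ext fun x => by
      change _ * algebraMap _ (RationalFunctions f) (sectionValue _ (r • s)) =
        Y.presheaf.germ U x.1 x.2 r • (_ * algebraMap _ (RationalFunctions f) (sectionValue _ s))
      rw [sectionValue_smul, map_mul, germ_smul_rationalFunctions, Algebra.smul_def,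
        mul_left_comm])
    (fun U V i n s => (constPredicate f Q').value_ext fun x => by
      change (constPredicate f Q).value (ψ.app U (_)) x * _ =
        (constPredicate f Q).value (ψ.app V n) (i x) * _
      rw [value_app_map]
      rfl)

lemma value_twistHom_app_tensorSection {U : Y.Opens} (n : Γ(N, U)) (s : Γ(E.sheaf, U)) (x : U) :
    (constPredicate f Q').value ((twistHom ψ E hE).app U (tensorSection _ _ n s)) x =
      (constPredicate f Q).value (ψ.app U n) x * algebraMap Y.functionField (RationalFunctions f)
        (sectionValue (genericPoint_mem_of_mem x.2) s) :=
  congrArg (fun t => (constPredicate f Q').value (U := U) t x)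
    (tensorLift_app_tensorSection (twistPairing ψ E hE) _ _ _ _ _ n s)

end TwistHom

section SectionsFromFWP
variable {X Y : Scheme.{u}} [IsIntegral X] [IsIntegral Y] {f : X ⟶ Y} [IsDominant f]

lemma pow_mem_span_pow {R A ι : Type*} [CommRing R] [CommRing A] [Algebra R A] {p : ℕ}
    (hp : p.Prime) (h : (p : A) = 0) (e : ℕ) (v : ι → A) {a : A}
    (ha : a ∈ Submodule.span R (Set.range v)) :
    a ^ p ^ e ∈ Submodule.span R (Set.range fun i => v i ^ p ^ e) := by
  induction ha using Submodule.span_induction with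
  | mem a ha => obtain ⟨i, rfl⟩ := ha; exact Submodule.subset_span ⟨i, rfl⟩
  | zero => rw [zero_pow (pow_ne_zero _ hp.ne_zero)]; exact zero_mem _
  | add a b _ _ ha hb => rw [add_pow_of_natCast_eq_zero hp h]; exact add_mem ha hb
  | smul r a _ ha => rw [smul_pow]; exact Submodule.smul_mem _ _ ha

/-- A linear functional regular on the `p ^ e`-th powers of all values of `M` and equal to `1` on
one of them maps the fibre at a closed point non-trivially to the residue field, so its image of
some global section is non-zero. -/
lemma exists_mem_stalk_of_isGenericallyGloballyGenerated {p : ℕ} (hp : p.Prime)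
    (h : (p : Γ(Y, ⊤)) = 0) [JacobsonSpace Y] {M : Y.Modules} (hM : IsCoherent M)
    (hM0 : ¬ Limits.IsZero M) {Z : CDiv X}
    (j : M ⟶ (constPredicate f (stalkFamily f Z)).sheaf)
    (hj : ∀ U : Y.Opens, Function.Injective (j.app U)) (e : ℕ) (E : CDiv Y)
    (hG : IsGenericallyGloballyGenerated
      (tensor ((Scheme.Modules.pullback (absFrobenius hp h e)).obj M) E.sheaf)) :
    ∃ c : X.functionField, c ≠ 0 ∧ ∀ x, c ∈ (p ^ e • Z + CDiv.pullback f E).stalk x := by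
  obtain ⟨W, hηW, ι, _, m, v, hmv, hspan⟩ := exists_generating_values hM j
  obtain ⟨l₀, hl₀⟩ := exists_generating_value_ne_zero hM0 j hj hηW hspan
  obtain ⟨U, ⟨u, hu⟩, hU⟩ := hG
  obtain ⟨V, hηV, g, hg⟩ := E.exists_equation (genericPoint Y)
  obtain ⟨ell, O, hell, hO, hηO, hreg⟩ := exists_regular_dual (fun l => v l ^ p ^ e)
    (pow_ne_zero (p ^ e) hl₀) (U ⊓ V ⊓ W) ⟨⟨genericPoint_mem_of_mem hu, hηV⟩, hηW⟩
  obtain ⟨y, hyO, hy⟩ : ((O : Set Y) ∩ closedPoints Y).Nonempty :=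
    nonempty_inter_closedPoints ⟨_, hηO⟩ O.2.isLocallyClosed
  let Q (y : Y) := stalkFamily f (p ^ e • Z) y ⊓ regularFamily O ell y
  have hQ (U : Y.Opens) (m : Γ(M, U)) (x : U) :
      (constPredicate f (stalkFamily f Z)).value (j.app U m) x ^ p ^ e ∈ Q x :=
    ⟨pow_value_mem_stalkFamily j _ m x, mem_regularFamily.mpr fun hx => mem_regularFamily.mp
      (hreg _ (pow_mem_span_pow hp (natCast_rationalFunctions_eq_zero f h) e v
        (hspan U m x (hO hx).2))) hx⟩
  let Q' (y : Y) := stalkFamily f (p ^ e • Z + CDiv.pullback f E) y ⊓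
    regularFamily O ((g : Y.functionField) • ell) y
  let χ := twistHom (Q := Q) (Q' := Q') (frobLift hp h e j hQ) E fun y c hc s hs =>
    ⟨mul_algebraMap_mem_stalkFamily hc.1 hs,
      mul_algebraMap_mem_regularFamily (fun y hy => hg y (hO hy).1.2) hc.2 hs⟩
  obtain ⟨s, hs⟩ := exists_sectionValue_eq (D := E) (V := V ⊓ W)
    (genericPoint_mem_of_mem ⟨hηV, hηW⟩) (c := (g : Y.functionField)⁻¹) fun x hx => by
      rw [CDiv.mem_stalk_iff (hg x hx.1), inv_mul_cancel₀ g.ne_zero]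
      exact one_mem _
  have hyVW : y ∈ V ⊓ W := ⟨(hO hyO).1.2, (hO hyO).2⟩
  obtain ⟨γ, hγ⟩ := exists_app_top_ne_zero (hU y (hO hyO).1.1 hy) χ ((g : Y.functionField) • ell)
    (fun c hc => mem_regularFamily.mp hc.2 hyO) hyVW
    (tensorSection _ _ (frobSection hp h e M (M.presheaf.map (homOfLE inf_le_right).op (m l₀))) s)
    (by
      refine (congrArg ((g : Y.functionField) • ell)
        (value_twistHom_app_tensorSection _ _ _ _ _ _)).trans ?_
      rw [value_frobLift_app_frobSection, value_app_map, hmv, hs, mul_comm, ← Algebra.smul_def,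
        map_smul, LinearMap.smul_apply, hell]
      exact inv_smul_smul₀ g.ne_zero _)
  let η : (⊤ : Y.Opens) := ⟨genericPoint Y, trivial⟩
  refine ⟨(constPredicate f Q').value (χ.app ⊤ γ) η,
    fun h0 => hγ ((constPredicate f Q').value_ext fun x => ?_), fun x => ?_⟩
  · exact (constPredicate_value_eq _ _ x η).trans h0
  · rw [constPredicate_value_eq _ _ η ⟨f x, trivial⟩]
    exact ((constPredicate f Q').value_pred (χ.app ⊤ γ) ⟨f x, trivial⟩).1.1 x rfl

theorem IsFWP.exists_mem_stalk {p : ℕ} (hp : p.Prime) (h : (p : Γ(Y, ⊤)) = 0) [JacobsonSpace Y]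
    (hsep : IsSeparableMorphism f) (D : CDiv X) (e : ℕ) {M : Y.Modules}
    (i : M ⟶ (Scheme.Modules.pullback (absFrobenius hp h e)).obj
      ((Scheme.Modules.pushforward f).obj D.sheaf)) [Mono i] (hM0 : ¬ Limits.IsZero M)
    (hM : IsCoherent M) (hM' : IsTorsionFree M) (e' : ℕ) (E : CDiv Y)
    (hG : IsGenericallyGloballyGenerated
      (tensor ((Scheme.Modules.pullback (absFrobenius hp h e')).obj M) E.sheaf)) :
    ∃ c : X.functionField, c ≠ 0 ∧
      ∀ x, c ∈ ((p ^ e' * p ^ e) • D + CDiv.pullback f E).stalk x := by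
  have hQ (U : Y.Opens) (m : Γ((Scheme.Modules.pushforward f).obj D.sheaf, U)) (x : U) :=
    pow_value_mem_stalkFamily (pushforwardHom f D) (p ^ e) m x
  obtain ⟨c, hc, hc'⟩ := exists_mem_stalk_of_isGenericallyGloballyGenerated hp h hM hM0
    (i ≫ frobLift hp h e (pushforwardHom f D) hQ)
    (comp_frobLift_app_injective hp h e hsep _ (pushforwardHom_app_injective f D) hQ i hM') e' E hG
  exact ⟨c, hc, by rwa [mul_smul]⟩

end SectionsFromFWP

section PrimeChains
open MvPolynomial

lemma exists_ne_zero_forall_exists_comap_eq {A R : Type*} [CommRing A] [IsDomain A]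
    [IsNoetherianRing A] [CommRing R] [IsDomain R] (φ : A →+* R) (hφ : Function.Injective φ)
    (hfin : φ.FiniteType) :
    ∃ b : A, b ≠ 0 ∧ ∀ q : Ideal A, q.IsPrime → b ∉ q →
      ∃ P : Ideal R, P.IsPrime ∧ P.comap φ = q := by
  obtain ⟨S, hS⟩ := PrimeSpectrum.exists_constructibleSetData_iff.mpr
    (PrimeSpectrum.isConstructible_range_comap (RingHom.FinitePresentation.of_finiteType.mp hfin))
  have hbot : (⟨⊥, Ideal.isPrime_bot⟩ : PrimeSpectrum A) ∈ S.toSet := by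
    rw [hS]
    exact ⟨⟨⊥, Ideal.isPrime_bot⟩,
      PrimeSpectrum.ext ((RingHom.injective_iff_ker_eq_bot φ).mp hφ)⟩
  rw [PrimeSpectrum.ConstructibleSetData.toSet, Set.mem_iUnion₂] at hbot
  obtain ⟨C, hCS, hCg, hCf⟩ := hbot
  refine ⟨C.f, fun h0 => hCf (by simp [h0]), fun q hq hb => ?_⟩
  have hqS : (⟨q, hq⟩ : PrimeSpectrum A) ∈ S.toSet := by
    rw [PrimeSpectrum.ConstructibleSetData.toSet, Set.mem_iUnion₂]
    refine ⟨C, hCS, ?_, by simpa [PrimeSpectrum.mem_zeroLocus] using hb⟩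
    rw [PrimeSpectrum.mem_zeroLocus] at hCg ⊢
    exact hCg.trans (SetLike.coe_subset_coe.mpr bot_le)
  rw [hS] at hqS
  obtain ⟨P, hP⟩ := hqS
  exact ⟨P.asIdeal, P.2, congrArg PrimeSpectrum.asIdeal hP⟩

section Specialize
variable {k : Type*} [Field k] {r : ℕ}

lemma exists_aeval_cons_ne_zero [Infinite k] {b : MvPolynomial (Fin (r + 1)) k} (hb : b ≠ 0) :
    ∃ c : k, aeval (Fin.cons (C c) X : Fin (r + 1) → MvPolynomial (Fin r) k) b ≠ 0 := by
  by_contra! hc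
  have hcomp (c : k) : (aeval (Fin.cons (C c) X : Fin (r + 1) → MvPolynomial (Fin r) k)) =
      ((Polynomial.aeval (R := MvPolynomial (Fin r) k) (C c)).restrictScalars k).comp
        (finSuccEquiv k r).toAlgHom := by
    refine MvPolynomial.algHom_ext fun i => ?_
    induction i using Fin.cases with
    | zero => simp [finSuccEquiv_X_zero]
    | succ i => simp [finSuccEquiv_X_succ]
  refine hb ((finSuccEquiv k r).injective ?_)
  rw [map_zero]
  refine Polynomial.eq_zero_of_infinite_isRoot _
    ((Set.infinite_range_of_injective (C_injective (Fin r) k)).mono ?_)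
  rintro _ ⟨c, rfl⟩
  have hroot := hc c
  rw [hcomp] at hroot
  simpa [Polynomial.IsRoot, Polynomial.aeval_def, Polynomial.eval₂_eq_eval_map] using hroot

variable {R : Type*} [CommRing R] [Algebra k R]

lemma algebraicIndependent_mk_succ {x : Fin (r + 1) → R} {c : k} {P : Ideal R}
    (hP : ∀ G : MvPolynomial (Fin (r + 1)) k, aeval x G ∈ P ↔
      aeval (Fin.cons (C c) X : Fin (r + 1) → MvPolynomial (Fin r) k) G = 0) :
    AlgebraicIndependent k fun i : Fin r => Ideal.Quotient.mk P (x i.succ) := by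
  rw [algebraicIndependent_iff]
  intro G hG
  have hrename : aeval (fun i : Fin r => Ideal.Quotient.mk P (x i.succ)) G =
      Ideal.Quotient.mkₐ k P (aeval x (rename Fin.succ G)) := by
    rw [aeval_rename, ← AlgHom.comp_apply, comp_aeval]
    rfl
  rw [hrename, Ideal.Quotient.mkₐ_eq_mk, Ideal.Quotient.eq_zero_iff_mem, hP, aeval_rename] at hG
  exact (aeval_X_left_apply G).symm.trans hG

lemma finiteType_aeval [Algebra.FiniteType k R] {σ : Type*} (x : σ → R) :
    (aeval x : MvPolynomial σ k →ₐ[k] R).toRingHom.FiniteType := by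
  refine AlgHom.FiniteType.of_comp_finiteType (f := Algebra.ofId k (MvPolynomial σ k)) ?_
  rw [Subsingleton.elim ((aeval x).comp (Algebra.ofId k _)) (Algebra.ofId k R)]
  exact RingHom.finiteType_algebraMap.mpr inferInstance

end Specialize

theorem exists_chain_of_algebraicIndependent {k : Type*} [Field k] [Infinite k] (r : ℕ)
    {R : Type u} [CommRing R] [IsDomain R] [Algebra k R] [Algebra.FiniteType k R]
    (x : Fin r → R) (hx : AlgebraicIndependent k x) :
    ∃ (c : Fin r → k) (P : Fin (r + 1) → Ideal R), (∀ i, (P i).IsPrime) ∧ Monotone P ∧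
      ∀ i : Fin r, x i - algebraMap k R (c i) ∈ P i.succ ∧
        x i - algebraMap k R (c i) ∉ P i.castSucc := by
  induction r generalizing R with
  | zero =>
    exact ⟨Fin.elim0, fun _ => ⊥, fun _ => Ideal.isPrime_bot, monotone_const, fun i => i.elim0⟩
  | succ r ih =>
    obtain ⟨b, hb0, hb⟩ := exists_ne_zero_forall_exists_comap_eq _ hx (finiteType_aeval x)
    obtain ⟨c, hc⟩ := exists_aeval_cons_ne_zero hb0
    obtain ⟨P₁, hP₁, hcomap⟩ := hb _ (RingHom.ker_isPrime (aeval (R := k)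
      (Fin.cons (C c) X : Fin (r + 1) → MvPolynomial (Fin r) k)).toRingHom) hc
    have hmem (G) : aeval x G ∈ P₁ ↔ aeval (Fin.cons (C c) X) G = 0 := SetLike.ext_iff.mp hcomap G
    obtain ⟨c', P', hP', hmono, hchain⟩ := ih _ (algebraicIndependent_mk_succ hmem)
    have hx0 : x 0 - algebraMap k R c ∈ P₁ := by
      rw [← aeval_X (R := k) x 0, ← aeval_C x c, ← map_sub, hmem]
      simp
    refine ⟨Fin.cons c c', Fin.cons ⊥ fun i => (P' i).comap (Ideal.Quotient.mk P₁),
      fun i => ?_, fun i j hij => ?_, fun i => ?_⟩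
    · induction i using Fin.cases with
      | zero => exact Ideal.isPrime_bot
      | succ i => exact Ideal.comap_isPrime (Ideal.Quotient.mk P₁) (P' i)
    · induction i using Fin.cases with
      | zero => exact bot_le
      | succ i =>
        induction j using Fin.cases with
        | zero => exact absurd hij (by simp)
        | succ j => exact Ideal.comap_mono (hmono (Fin.succ_le_succ_iff.mp hij))
    · induction i using Fin.cases with
      | zero =>
        refine ⟨?_, sub_ne_zero.mpr fun h => hx.transcendental 0 (h ▸ isAlgebraic_algebraMap c)⟩
        change Ideal.Quotient.mk P₁ (x 0 - algebraMap k R c) ∈ P' 0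
        rw [Ideal.Quotient.eq_zero_iff_mem.mpr hx0]
        exact zero_mem _
      | succ i =>
        refine ⟨(hchain i).1, ?_⟩
        rw [← Fin.succ_castSucc]
        exact (hchain i).2

lemma eq_bot_of_chain {F : Type*} [Field F] {n : ℕ}
    (P : Fin (n + 1) → Ideal (MvPolynomial (Fin n) F)) (hP : ∀ i, (P i).IsPrime)
    (h : ∀ i : Fin n, P i.castSucc < P i.succ) : P 0 = ⊥ := by
  by_contra h0
  let Q : Fin (n + 2) → PrimeSpectrum (MvPolynomial (Fin n) F) :=
    Fin.cons ⟨⊥, Ideal.isPrime_bot⟩ fun i => ⟨P i, hP i⟩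
  have hQ : StrictMono Q := Fin.strictMono_iff_lt_succ.mpr fun i => by
    induction i using Fin.cases with
    | zero => exact (bot_lt_iff_ne_bot.mpr h0 : (⊥ : Ideal (MvPolynomial (Fin n) F)) < P 0)
    | succ i => exact h i
  have hdim : ((n + 1 : ℕ) : WithBot ℕ∞) ≤ ringKrullDim (MvPolynomial (Fin n) F) :=
    Order.le_krullDim_iff.mpr ⟨LTSeries.mk (n + 1) Q hQ, rfl⟩
  rw [MvPolynomial.ringKrullDim_of_isNoetherianRing, ringKrullDim_eq_zero_of_field, zero_add,
    Nat.card_eq_fintype_card, Fintype.card_fin] at hdim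
  exact absurd (by exact_mod_cast hdim) (Nat.not_succ_le_self n)

end PrimeChains

section Dehomogenization
open MvPolynomial
variable {F : Type*} [Field F] {σ : Type*}

lemma exists_isHomogeneous_aeval_eq {ι : Type*} (a : σ) (f : ι → MvPolynomial σ F) (n : ι → ℕ)
    (hf : ∀ i, (f i).IsHomogeneous (n i)) (G : MvPolynomial ι F) :
    ∃ (N : ℕ) (H : MvPolynomial σ F), 0 < N ∧ H.IsHomogeneous N ∧
      ∀ (L : Type u) [Field L] [Algebra F L] (s : σ → L), s a ≠ 0 →
        aeval s H = s a ^ N * aeval (fun i => aeval s (f i) / s a ^ n i) G := by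
  induction G using MvPolynomial.induction_on with
  | C c =>
    refine ⟨1, C c * X a, one_pos, ?_, fun L _ _ s _ => ?_⟩
    · simpa using (isHomogeneous_C σ c).mul (isHomogeneous_X F a)
    · simp [mul_comm]
  | add G₁ G₂ h₁ h₂ =>
    obtain ⟨N₁, H₁, hN₁, hH₁, e₁⟩ := h₁
    obtain ⟨N₂, H₂, hN₂, hH₂, e₂⟩ := h₂
    refine ⟨N₁ + N₂, H₁ * X a ^ N₂ + X a ^ N₁ * H₂, by omega,
      (hH₁.mul (isHomogeneous_X_pow a N₂)).add ((isHomogeneous_X_pow a N₁).mul hH₂),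
      fun L _ _ s hs => ?_⟩
    simp only [map_add, map_mul, map_pow, aeval_X, e₁ L s hs, e₂ L s hs]
    ring
  | mul_X G i h =>
    obtain ⟨N, H, hN, hH, e⟩ := h
    refine ⟨N + n i, H * f i, by omega, hH.mul (hf i), fun L _ _ s hs => ?_⟩
    simp only [map_mul, aeval_X, e L s hs]
    field_simp
    ring

lemma exists_isHomogeneous_aeval_eq_zero_iff {ι : Type*} (a : σ) (f : ι → MvPolynomial σ F)
    (n : ι → ℕ) (hf : ∀ i, (f i).IsHomogeneous (n i)) (G : MvPolynomial ι F) :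
    ∃ (N : ℕ) (H : MvPolynomial σ F), 0 < N ∧ H.IsHomogeneous N ∧
      ∀ (L : Type u) [Field L] [Algebra F L] (s : σ → L), s a ≠ 0 →
        (aeval s H = 0 ↔ aeval (fun i => aeval s (f i) / s a ^ n i) G = 0) := by
  obtain ⟨N, H, hN, hH, h⟩ := exists_isHomogeneous_aeval_eq.{u} a f n hf G
  refine ⟨N, H, hN, hH, fun L _ _ s hs => ?_⟩
  rw [h L s hs, mul_eq_zero, or_iff_right (pow_ne_zero _ hs)]

lemma exists_field_aeval_eq_zero_iff_mem {F σ : Type u} [Field F] (q : Ideal (MvPolynomial σ F))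
    [q.IsPrime] :
    ∃ (L : Type u) (_ : Field L) (_ : Algebra F L) (t : σ → L), ∀ r, aeval t r = 0 ↔ r ∈ q := by
  let φ : MvPolynomial σ F →ₐ[F] FractionRing (MvPolynomial σ F ⧸ q) :=
    (IsScalarTower.toAlgHom F (MvPolynomial σ F ⧸ q) _).comp (Ideal.Quotient.mkₐ F q)
  refine ⟨_, inferInstance, inferInstance, fun j => φ (X j), fun r => ?_⟩
  rw [← show φ = aeval fun j => φ (X j) from aeval_unique φ]
  exact (map_eq_zero_iff _ (IsFractionRing.injective (MvPolynomial σ F ⧸ q) _)).trans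
    Ideal.Quotient.eq_zero_iff_mem

/- Each prime of the chain has a generic point, at which the ratios `fᵢ / X_a ^ dᵢ` satisfy a prime
ideal of relations. These ideals form a chain of maximal length in a polynomial ring in `n`
variables, so the smallest one, which contains the relations between the ratios at `s`, is zero. -/
lemma algebraicIndependent_aeval_div_pow {F σ K : Type u} [Field F] [Field K] [Algebra F K] {n : ℕ}
    {q : Fin (n + 1) → Ideal (MvPolynomial σ F)} (hq : ∀ i, (q i).IsPrime)
    (hmono : ∀ i : Fin n, q i.castSucc ≤ q i.succ) {a : σ} (ha : ∀ i, X a ∉ q i)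
    {f : Fin n → MvPolynomial σ F} {d : Fin n → ℕ} (hfd : ∀ i, (f i).IsHomogeneous (d i))
    (hf : ∀ i, f i ∈ q i.succ) (hf' : ∀ i, f i ∉ q i.castSucc) {s : σ → K}
    (hs : ∀ (N : ℕ) (H : MvPolynomial σ F), 0 < N → H.IsHomogeneous N → aeval s H = 0 → H ∈ q 0) :
    AlgebraicIndependent F fun i => aeval s (f i) / s a ^ d i := by
  have hsa : s a ≠ 0 := fun h0 =>
    ha 0 (hs 1 (X a) one_pos (isHomogeneous_X F a) (by rwa [aeval_X]))
  choose L _ _ t ht using fun i => exists_field_aeval_eq_zero_iff_mem (q i)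
  have hta (i) : t i a ≠ 0 := fun h0 => ha i ((ht i _).mp (by rwa [aeval_X]))
  let χ (i : Fin (n + 1)) : MvPolynomial (Fin n) F →ₐ[F] L i :=
    aeval fun j => aeval (t i) (f j) / t i a ^ d j
  have hX (i j) : X j ∈ RingHom.ker (χ i) ↔ f j ∈ q i := by
    rw [RingHom.mem_ker, aeval_X, div_eq_zero_iff, or_iff_left (pow_ne_zero _ (hta i)), ht]
  have hlt (i : Fin n) : RingHom.ker (χ i.castSucc) < RingHom.ker (χ i.succ) := by
    refine lt_of_le_of_ne (fun G hG => ?_)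
      fun heq => hf' i ((hX _ i).mp (heq ▸ (hX _ i).mpr (hf i)))
    obtain ⟨N, H, -, -, hH⟩ := exists_isHomogeneous_aeval_eq_zero_iff.{u} a f d hfd G
    have hmem := (ht _ H).mp ((hH _ (t i.castSucc) (hta _)).mpr hG)
    exact (hH _ (t i.succ) (hta _)).mp ((ht _ H).mpr (hmono i hmem))
  rw [algebraicIndependent_iff]
  intro G hG
  obtain ⟨N, H, hN, hHN, hH⟩ := exists_isHomogeneous_aeval_eq_zero_iff.{u} a f d hfd G
  have hG0 : G ∈ RingHom.ker (χ 0) :=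
    (hH _ (t 0) (hta 0)).mp ((ht 0 H).mpr (hs N H hN hHN ((hH K s hsa).mpr hG)))
  rwa [eq_bot_of_chain _ (fun i => RingHom.ker_isPrime (χ i)) hlt] at hG0

end Dehomogenization

lemma le_topologicalKrullDim_iff {α : Type*} [TopologicalSpace α] [QuasiSober α] {n : ℕ} :
    (n : WithBot ℕ∞) ≤ topologicalKrullDim α ↔
      ∃ q : Fin (n + 1) → α, ∀ i : Fin n, q i.castSucc ⤳ q i.succ ∧ ¬ q i.succ ⤳ q i.castSucc := by
  rw [topologicalKrullDim, Order.le_krullDim_iff]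
  constructor
  · rintro ⟨l, rfl⟩
    refine ⟨fun i => (l i.rev).isIrreducible.genericPoint, fun i => ?_⟩
    have hlt : l i.succ.rev < l i.castSucc.rev := l.strictMono (by simp [Fin.rev_lt_rev])
    simp only [specializes_iff_closure_subset,
      IsIrreducible.closure_genericPoint _ (IrreducibleCloseds.isClosed _)]
    exact hlt
  · rintro ⟨q, hq⟩
    refine ⟨LTSeries.mk n (fun i => ⟨closure {q i.rev}, isIrreducible_singleton.closure,
      isClosed_closure⟩) (Fin.strictMono_iff_lt_succ.mpr fun i => ?_), rfl⟩
    have hlt := hq i.rev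
    rw [specializes_iff_closure_subset, specializes_iff_closure_subset] at hlt
    rw [Fin.rev_castSucc, Fin.rev_succ]
    exact hlt

section ProjectiveSpace
attribute [local instance] MvPolynomial.gradedAlgebra
open MvPolynomial
variable {F : Type u} [Field F] {σ : Type u}

lemma exists_X_notMem (q : Proj (homogeneousSubmodule σ F)) :
    ∃ a, (X a : MvPolynomial σ F) ∉ q.asHomogeneousIdeal.toIdeal := by
  by_contra! hc
  refine q.not_irrelevant_le fun r hr => ?_
  have hcoeff : coeff 0 r = 0 := by
    rw [HomogeneousIdeal.mem_irrelevant_iff] at hr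
    have hr0 : homogeneousComponent 0 r = 0 :=
      (decomposition.decompose'_apply r 0).symm.trans hr
    simpa using hr0
  change r ∈ q.asHomogeneousIdeal.toIdeal
  rw [r.as_sum]
  refine Ideal.sum_mem _ fun d hd => ?_
  have hd0 : d ≠ 0 := by
    rintro rfl
    exact mem_support_iff.mp hd hcoeff
  obtain ⟨a, ha⟩ := Finsupp.ne_iff.mp hd0
  exact Ideal.mem_of_dvd _ (X_dvd_monomial.mpr (Or.inr ha)) (hc a)

lemma le_iff_specializes {q q' : Proj (homogeneousSubmodule σ F)} :
    q'.asHomogeneousIdeal.toIdeal ≤ q.asHomogeneousIdeal.toIdeal ↔ q' ⤳ q := by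
  rw [specializes_iff_mem_closure]
  exact ProjectiveSpectrum.le_iff_mem_closure _ _ _

lemma specializes_iff_forall_isHomogeneous {q q' : Proj (homogeneousSubmodule σ F)} :
    q' ⤳ q ↔ ∀ (n : ℕ) (r : MvPolynomial σ F), 0 < n → r.IsHomogeneous n →
      r ∈ q'.asHomogeneousIdeal.toIdeal → r ∈ q.asHomogeneousIdeal.toIdeal := by
  rw [← le_iff_specializes]
  refine ⟨fun h _ r _ _ hr => h hr, fun h r hr => ?_⟩
  obtain ⟨a, ha⟩ := exists_X_notMem q
  rw [← r.sum_homogeneousComponent]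
  refine Ideal.sum_mem _ fun n _ => ?_
  have hcomp : homogeneousComponent n r ∈ q'.asHomogeneousIdeal.toIdeal := by
    rw [← decomposition.decompose'_apply]
    exact q'.asHomogeneousIdeal.isHomogeneous n hr
  exact (q.isPrime.mem_or_mem (h (n + 1) (homogeneousComponent n r * X a) n.succ_pos
    ((homogeneousComponent_isHomogeneous n r).mul (isHomogeneous_X F a))
    (Ideal.mul_mem_right _ _ hcomp))).resolve_right ha

lemma mem_fromOfGlobalSections_iff {A : CommRingCat.{u}} {ψ : MvPolynomial σ F →+* A}
    (hψ : (HomogeneousIdeal.irrelevant (homogeneousSubmodule σ F)).toIdeal.map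
      ((Scheme.ΓSpecIso A).inv.hom.comp ψ) = ⊤) {n : ℕ} (hn : 0 < n) {r : MvPolynomial σ F}
    (hr : r.IsHomogeneous n) (p : Spec A) :
    r ∈ (Proj.fromOfGlobalSections (homogeneousSubmodule σ F) _ hψ p).asHomogeneousIdeal.toIdeal ↔
      ψ r ∈ p.asIdeal := by
  have hpre := Proj.fromOfGlobalSections_preimage_basicOpen (homogeneousSubmodule σ F) _ hψ hn hr
  have hp : p ∈ Proj.fromOfGlobalSections (homogeneousSubmodule σ F) _ hψ ⁻¹ᵁ
      Proj.basicOpen (homogeneousSubmodule σ F) r ↔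
        p ∈ (Spec A).basicOpen ((Scheme.ΓSpecIso A).inv (ψ r)) := by
    rw [hpre]
    rfl
  rw [basicOpen_eq_of_affine] at hp
  exact not_iff_not.mp hp

end ProjectiveSpace

section LinearSystem
attribute [local instance] MvPolynomial.gradedAlgebra
open MvPolynomial
variable {X : Scheme.{u}} [IsIntegral X] {F : Type u} [Field F] (π : X ⟶ Spec (.of F))

lemma baseFieldMap_mem_localRing (x : X) (c : F) : baseFieldMap π c ∈ localRing x :=
  ⟨_, (baseFieldMap_eq π x c).symm⟩

lemma H0Basis_mem_stalk (E : CDiv X) (i : H0Index π E) (x : X) : H0Basis π E i ∈ E.stalk x :=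
  letI := functionFieldAlgebra π
  (Module.Basis.ofVectorSpace F (H0 π E) i : H0 π E).2 x

lemma sum_apply_eq_of_isHomogeneous {R σ : Type*} [CommSemiring R] {n : ℕ} {f : MvPolynomial σ R}
    (hf : f.IsHomogeneous n) {d : σ →₀ ℕ} (hd : d ∈ f.support) : ∑ i ∈ d.support, d i = n := by
  simpa [Finsupp.weight_apply, Finsupp.sum] using hf (mem_support_iff.mp hd)

lemma eval₂_mem_stalk {σ : Type*} {E : CDiv X} {s : σ → X.functionField} {x : X}
    (hs : ∀ i, s i ∈ E.stalk x) {n : ℕ} {f : MvPolynomial σ F} (hf : f.IsHomogeneous n) :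
    eval₂ (baseFieldMap π) s f ∈ (n • E).stalk x := by
  rw [eval₂_eq]
  refine Submodule.sum_mem _ fun d hd => ?_
  refine CDiv.localRing_mul_mem_stalk (baseFieldMap_mem_localRing π x _) ?_
  have hprod := CDiv.prod_mem_stalk d.support (D := fun i => d i • E) (φ := fun i => s i ^ d i)
    fun i _ => CDiv.pow_mem_stalk (hs i) _
  rwa [← Finset.sum_smul, sum_apply_eq_of_isHomogeneous hf hd] at hprod

/-- The generic point of the image of the linear system `|E|`, a point of projective space. -/
def linearSystemPoint (E : CDiv X) (h : H0 π E ≠ ⊥) :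
    Proj (homogeneousSubmodule (H0Index π E) F) :=
  linearSystemMap π E h (⊥ : PrimeSpectrum X.functionField)

variable {π} {E : CDiv X} {h : H0 π E ≠ ⊥}

lemma range_linearSystemMap : Set.range (linearSystemMap π E h) = {linearSystemPoint π E h} := by
  have heq (z : Spec X.functionField) : z = (⊥ : PrimeSpectrum X.functionField) :=
    PrimeSpectrum.ext (@Ideal.eq_bot_of_prime _ _ z.asIdeal z.2)
  refine Set.eq_singleton_iff_unique_mem.mpr ⟨⟨_, rfl⟩, ?_⟩
  rintro _ ⟨z, rfl⟩
  rw [heq z]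
  rfl

lemma mem_linearSystemPoint_iff {n : ℕ} (hn : 0 < n) {r : MvPolynomial (H0Index π E) F}
    (hr : r.IsHomogeneous n) :
    r ∈ (linearSystemPoint π E h).asHomogeneousIdeal.toIdeal ↔
      eval₂ (baseFieldMap π) (H0Basis π E) r = 0 :=
  (mem_fromOfGlobalSections_iff (map_irrelevant_linearSystemRingHom π E h) hn hr
    (⊥ : PrimeSpectrum X.functionField)).trans Iff.rfl

lemma linearSystemPoint_specializes_iff {q : Proj (homogeneousSubmodule (H0Index π E) F)} :
    linearSystemPoint π E h ⤳ q ↔ ∀ (n : ℕ) (r : MvPolynomial (H0Index π E) F), 0 < n →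
      r.IsHomogeneous n → eval₂ (baseFieldMap π) (H0Basis π E) r = 0 →
        r ∈ q.asHomogeneousIdeal.toIdeal := by
  rw [specializes_iff_forall_isHomogeneous]
  refine forall₄_congr fun n r hn hr => ?_
  rw [mem_linearSystemPoint_iff hn hr]

lemma le_dimLinearSystemImage_iff {n : ℕ} :
    (n : WithBot ℕ∞) ≤ dimLinearSystemImage π E h ↔
      ∃ q : Fin (n + 1) → Proj (homogeneousSubmodule (H0Index π E) F),
        (∀ i, linearSystemPoint π E h ⤳ q i) ∧
          ∀ i : Fin n, q i.castSucc ⤳ q i.succ ∧ ¬ q i.succ ⤳ q i.castSucc := by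
  have hC : IsClosed (closure (Set.range (linearSystemMap π E h))) := isClosed_closure
  have : QuasiSober (closure (Set.range (linearSystemMap π E h))) :=
    hC.isClosedEmbedding_subtypeVal.quasiSober
  have hmem (q) : linearSystemPoint π E h ⤳ q ↔
      q ∈ closure (Set.range (linearSystemMap π E h)) := by
    rw [range_linearSystemMap, specializes_iff_mem_closure]
  refine le_topologicalKrullDim_iff.trans ⟨?_, ?_⟩
  · rintro ⟨q, hq⟩
    simp only [subtype_specializes_iff] at hq
    exact ⟨fun i => (q i).1, fun i => (hmem _).mpr (q i).2, hq⟩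
  · rintro ⟨q, hξ, hq⟩
    refine ⟨fun i => ⟨q i, (hmem _).mp (hξ i)⟩, ?_⟩
    simpa only [subtype_specializes_iff] using hq

theorem exists_algebraicIndependent_of_le_dim {n : ℕ}
    (hn : (n : WithBot ℕ∞) ≤ dimLinearSystemImage π E h) :
    letI := functionFieldAlgebra π
    ∃ z : Fin n → X.functionField, AlgebraicIndependent F z ∧ ∃ N : ℕ, 0 < N ∧
      ∃ σ : X.functionField, σ ≠ 0 ∧ (∀ x, σ ∈ (N • E).stalk x) ∧
        ∀ i x, z i * σ ∈ (N • E).stalk x := by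
  let _ := functionFieldAlgebra π
  obtain ⟨q, hξ, hq⟩ := le_dimLinearSystemImage_iff.mp hn
  have hlast (i) : q i ⤳ q (Fin.last n) := by
    induction i using Fin.reverseInduction with
    | last => exact specializes_rfl
    | cast i ih => exact (hq i).1.trans ih
  obtain ⟨a, ha⟩ := exists_X_notMem (q (Fin.last n))
  have hqa (i) : MvPolynomial.X a ∉ (q i).asHomogeneousIdeal.toIdeal :=
    fun hi => ha (le_iff_specializes.mpr (hlast i) hi)
  have hsa : H0Basis π E a ≠ 0 := fun h0 => hqa 0
    (linearSystemPoint_specializes_iff.mp (hξ 0) 1 _ one_pos (isHomogeneous_X F a)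
      (by rwa [eval₂_X]))
  have hnot (i : Fin n) := (hq i).2
  simp only [specializes_iff_forall_isHomogeneous, not_forall, exists_prop] at hnot
  choose d f _ hfd hf hf' using hnot
  have hd (i) : d i ≤ 1 + ∑ i, d i :=
    (Finset.single_le_sum (fun _ _ => Nat.zero_le _) (Finset.mem_univ i)).trans (by omega)
  refine ⟨fun i => eval₂ (baseFieldMap π) (H0Basis π E) (f i) / H0Basis π E a ^ d i,
    algebraicIndependent_aeval_div_pow (fun i => (q i).isPrime)
      (fun i => le_iff_specializes.mpr (hq i).1) hqa hfd hf hf'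
      (linearSystemPoint_specializes_iff.mp (hξ 0)),
    1 + ∑ i, d i, by omega, H0Basis π E a ^ (1 + ∑ i, d i), pow_ne_zero _ hsa,
    fun x => CDiv.pow_mem_stalk (H0Basis_mem_stalk π E a x) _, fun i x => ?_⟩
  have hmem := CDiv.mul_mem_stalk
    (eval₂_mem_stalk π (fun j => H0Basis_mem_stalk π E j x) (hfd i))
    (CDiv.pow_mem_stalk (H0Basis_mem_stalk π E a x) (1 + ∑ i, d i - d i))
  rw [← add_smul, Nat.add_sub_cancel' (hd i)] at hmem
  convert hmem using 1
  rw [← pow_mul_pow_sub _ (hd i), ← mul_assoc, div_mul_cancel₀ _ (pow_ne_zero _ hsa)]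

end LinearSystem

section Gluing
variable {X : Scheme.{u}} [IsIntegral X]

lemma exists_germ_eq_of_forall_mem_localRing {U : X.Opens} (hU : genericPoint X ∈ U)
    {c : X.functionField} (hc : ∀ x ∈ U, c ∈ localRing x) :
    ∃ s : Γ(X, U), X.presheaf.germ U (genericPoint X) hU s = c := by
  have hlocal (x : U) : ∃ (W : X.Opens) (_ : W ⟶ U) (_ : x.1 ∈ W) (t : Γ(X, W)),
      ∀ hη, X.presheaf.germ W (genericPoint X) hη t = c := by
    obtain ⟨a, ha⟩ := hc x.1 x.2
    obtain ⟨W, i, hW, T, hT⟩ := exists_germ_eq_of_finite (ι := Unit) (fun _ => a) x.2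
    refine ⟨W, i, hW, T (), fun hη => ?_⟩
    rw [← algebraMap_germ_eq W hW hη, hT, ha]
  choose W i hW t ht using hlocal
  obtain ⟨s, hs, -⟩ := TopCat.Sheaf.existsUnique_gluing' X.sheaf W U i
    (fun x hx => Opens.mem_iSup.mpr ⟨⟨x, hx⟩, hW _⟩) t (fun x y => by
      have hη : genericPoint X ∈ W x ⊓ W y :=
        ⟨genericPoint_mem_of_mem (hW x), genericPoint_mem_of_mem (hW y)⟩
      apply germ_genericPoint_injective _ hη
      refine (X.presheaf.germ_res_apply (homOfLE inf_le_left) _ hη (t x)).trans ?_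
      refine Eq.trans ?_ (X.presheaf.germ_res_apply (homOfLE inf_le_right) _ hη (t y)).symm
      rw [ht, ht])
  refine ⟨s, ?_⟩
  rw [← ht ⟨_, hU⟩ (hW ⟨_, hU⟩), ← hs ⟨_, hU⟩]
  exact (X.presheaf.germ_res_apply (i ⟨_, hU⟩) _ (hW ⟨_, hU⟩) s).symm

lemma germ_mem_localRing {U : X.Opens} {x : X} (hx : x ∈ U) (hU : genericPoint X ∈ U)
    (s : Γ(X, U)) : X.presheaf.germ U (genericPoint X) hU s ∈ localRing x :=
  ⟨_, algebraMap_germ_eq U hx hU s⟩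

lemma exists_isAffineOpen_forall_mem_localRing {ι : Type*} [Finite ι] (t : ι → X.functionField)
    (V : X.Opens) (hV : genericPoint X ∈ V) :
    ∃ W : X.Opens, IsAffineOpen W ∧ W ≤ V ∧ genericPoint X ∈ W ∧
      ∀ x ∈ W, ∀ l, t l ∈ localRing x := by
  obtain ⟨W, hWV, hW, h⟩ := exists_opens_forall_mem_localRing t V hV
  obtain ⟨W', hW', hη, hle⟩ := exists_isAffineOpen_mem_and_subset hW
  exact ⟨W', hW', hle.trans hWV, hη, fun x hx => h x (hle hx)⟩

lemma exists_isAffineOpen_forall_mul_inv_mem_localRing (E : CDiv X) (s : X.functionField)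
    {ι : Type*} [Finite ι] (z : ι → X.functionField) :
    ∃ U : X.Opens, IsAffineOpen U ∧ genericPoint X ∈ U ∧ (∀ x ∈ U, ∀ i, z i ∈ localRing x) ∧
      ∀ x ∈ U, ∀ v ∈ E.stalk x, v * s⁻¹ ∈ localRing x := by
  obtain ⟨V, hηV, g, hg⟩ := E.exists_equation (genericPoint X)
  obtain ⟨U, hU, hUV, hη, hreg⟩ := exists_isAffineOpen_forall_mem_localRing
    (fun o : Option ι => o.elim (s * (g : X.functionField))⁻¹ z) V hηV
  refine ⟨U, hU, hη, fun x hx i => hreg x hx (some i), fun x hx v hv => ?_⟩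
  convert mul_mem ((CDiv.mem_stalk_iff (hg x (hUV hx))).mp hv) (hreg x hx none) using 1
  change v * s⁻¹ = v * g * (s * g)⁻¹
  rw [mul_inv, mul_comm s⁻¹, ← mul_assoc, mul_inv_cancel_right₀ g.ne_zero]

end Gluing

section StructureMap
variable {X : Scheme.{u}} {k : Type u} [Field k] (π : X ⟶ Spec (.of k))

/-- The structure map `k → Γ(X, U)` of a `k`-scheme. -/
def baseSectionMap (U : X.Opens) : k →+* Γ(X, U) :=
  ((Scheme.ΓSpecIso (.of k)).inv ≫ π.appLE ⊤ U le_top).hom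

lemma germ_baseSectionMap [IsIntegral X] {U : X.Opens} (hU : genericPoint X ∈ U) (c : k) :
    X.presheaf.germ U (genericPoint X) hU (baseSectionMap π U c) = baseFieldMap π c := by
  change X.presheaf.germ U (genericPoint X) hU (π.appLE ⊤ U le_top _) = _
  exact X.presheaf.germ_res_apply (homOfLE le_top) _ hU _

lemma finiteType_baseSectionMap [LocallyOfFiniteType π] {U : X.Opens} (hU : IsAffineOpen U) :
    (baseSectionMap π U).FiniteType :=
  RingHom.FiniteType.comp (π.finiteType_appLE (isAffineOpen_top (Spec (.of k))) hU le_top)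
    (RingHom.FiniteType.of_surjective _
      (ConcreteCategory.bijective_of_isIso (Scheme.ΓSpecIso (.of k)).inv).2)

lemma exists_chain_of_germ [IsIntegral X] [Infinite k] [LocallyOfFiniteType π] {U : X.Opens}
    (hU : IsAffineOpen U) (hη : genericPoint X ∈ U) {r : ℕ} {z : Fin r → X.functionField}
    (hz : letI := functionFieldAlgebra π; AlgebraicIndependent k z) {y : Fin r → Γ(X, U)}
    (hy : ∀ i, X.presheaf.germ U (genericPoint X) hη (y i) = z i) :
    ∃ (c : Fin r → k) (P : Fin (r + 1) → Ideal Γ(X, U)), (∀ i, (P i).IsPrime) ∧ Monotone P ∧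
      ∀ i : Fin r, y i - baseSectionMap π U (c i) ∈ P i.succ ∧
        y i - baseSectionMap π U (c i) ∉ P i.castSucc := by
  let _ := functionFieldAlgebra π
  have : Nonempty U := ⟨⟨_, hη⟩⟩
  let _ : Algebra k Γ(X, U) := (baseSectionMap π U).toAlgebra
  have : Algebra.FiniteType k Γ(X, U) := finiteType_baseSectionMap π hU
  let φ : Γ(X, U) →ₐ[k] X.functionField :=
    { (X.presheaf.germ U (genericPoint X) hη).hom with
      commutes' := germ_baseSectionMap π hη }
  obtain rfl : φ ∘ y = z := funext hy
  exact exists_chain_of_algebraicIndependent r y (AlgebraicIndependent.of_comp φ hz)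

theorem le_topologicalKrullDim_of_algebraicIndependent [IsIntegral X] [Infinite k]
    [LocallyOfFiniteType π] {r : ℕ} {z : Fin r → X.functionField}
    (hz : letI := functionFieldAlgebra π; AlgebraicIndependent k z) :
    (r : WithBot ℕ∞) ≤ topologicalKrullDim X := by
  obtain ⟨U, hU, -, hη, hreg⟩ := exists_isAffineOpen_forall_mem_localRing z ⊤ trivial
  choose y hy using fun i => exists_germ_eq_of_forall_mem_localRing hη fun x hx => hreg x hx i
  obtain ⟨c, P, hP, hmono, hchain⟩ := exists_chain_of_germ π hU hη hz hy
  refine le_trans ?_ hU.fromSpec.isOpenEmbedding.isInducing.topologicalKrullDim_le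
  exact le_topologicalKrullDim_iff.mpr
    ⟨fun i => (⟨P i, hP i⟩ : PrimeSpectrum Γ(X, U)), fun i =>
      ⟨(PrimeSpectrum.le_iff_specializes _ _).mp (hmono Fin.castSucc_lt_succ.le),
        fun hs => (hchain i).2 ((PrimeSpectrum.le_iff_specializes _ _).mpr hs (hchain i).1)⟩⟩

attribute [local instance] MvPolynomial.gradedAlgebra
open MvPolynomial

lemma eval₂_mul_of_isHomogeneous {R S σ : Type*} [CommSemiring R] [CommSemiring S] (φ : R →+* S)
    (a : S) (s : σ → S) {n : ℕ} {f : MvPolynomial σ R} (hf : f.IsHomogeneous n) :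
    eval₂ φ (fun i => a * s i) f = a ^ n * eval₂ φ s f := by
  rw [eval₂_eq, eval₂_eq, Finset.mul_sum]
  refine Finset.sum_congr rfl fun d hd => ?_
  simp only [mul_pow]
  rw [Finset.prod_mul_distrib, Finset.prod_pow_eq_pow_sum, sum_apply_eq_of_isHomogeneous hf hd,
    mul_left_comm]

lemma map_irrelevant_eq_top {F σ A : Type*} [Field F] [CommRing A] {φ : MvPolynomial σ F →+* A}
    {l : MvPolynomial σ F} (hl : l.IsHomogeneous 1) (h1 : φ l = 1) :
    (HomogeneousIdeal.irrelevant (homogeneousSubmodule σ F)).toIdeal.map φ = ⊤ := by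
  have hmem : l ∈ (HomogeneousIdeal.irrelevant (homogeneousSubmodule σ F)).toIdeal := by
    change _ ∈ HomogeneousIdeal.irrelevant _
    rw [HomogeneousIdeal.mem_irrelevant_iff]
    exact DirectSum.decompose_of_mem_ne (homogeneousSubmodule σ F)
      (show l ∈ homogeneousSubmodule σ F 1 from hl) one_ne_zero
  exact (Ideal.eq_top_iff_one _).mpr (h1 ▸ Ideal.mem_map_of_mem φ hmem)

variable [IsIntegral X]

lemma exists_linear_form_eval₂_eq (E : CDiv X) {v : X.functionField}
    (hv : ∀ x, v ∈ E.stalk x) : ∃ l : MvPolynomial (H0Index π E) k, l.IsHomogeneous 1 ∧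
      eval₂ (baseFieldMap π) (H0Basis π E) l = v := by
  let _ := functionFieldAlgebra π
  let b := Module.Basis.ofVectorSpace k (H0 π E)
  let v' : H0 π E := ⟨v, hv⟩
  refine ⟨(b.repr v').sum fun i c => C c * MvPolynomial.X i, ?_, ?_⟩
  · refine IsHomogeneous.sum _ _ _ fun i _ => ?_
    simpa using (isHomogeneous_C _ _).mul (isHomogeneous_X k i)
  · have hrepr := congrArg (Submodule.subtype (H0 π E)) (b.linearCombination_repr v')
    rw [Finsupp.linearCombination_apply, Finsupp.sum, map_sum] at hrepr
    refine Eq.trans ?_ hrepr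
    rw [Finsupp.sum, eval₂_sum]
    refine Finset.sum_congr rfl fun i _ => ?_
    rw [eval₂_mul, eval₂_C, eval₂_X, map_smul, Algebra.smul_def]
    rfl

lemma eval₂_eq_pow_mul_germ {U : X.Opens} (hη : genericPoint X ∈ U) {σ : Type*}
    {s : σ → X.functionField} {s₀ : X.functionField} (hs₀ : s₀ ≠ 0) {ρ : σ → Γ(X, U)}
    (hρ : ∀ j, X.presheaf.germ U (genericPoint X) hη (ρ j) = s j * s₀⁻¹) {n : ℕ}
    {f : MvPolynomial σ k} (hf : f.IsHomogeneous n) :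
    eval₂ (baseFieldMap π) s f =
      s₀ ^ n * X.presheaf.germ U (genericPoint X) hη (eval₂ (baseSectionMap π U) ρ f) := by
  let germHom : Γ(X, U) →+* X.functionField := (X.presheaf.germ U (genericPoint X) hη).hom
  have hcomp : germHom.comp (baseSectionMap π U) = baseFieldMap π :=
    RingHom.ext (germ_baseSectionMap π hη)
  have hgerm : germHom (eval₂ (baseSectionMap π U) ρ f) =
      eval₂ (baseFieldMap π) (fun j => s j * s₀⁻¹) f := by
    rw [eval₂_comp_left, hcomp]
    exact congrArg (eval₂ _ · f) (funext hρ)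
  refine Eq.trans ?_ (congrArg (s₀ ^ n * ·) hgerm.symm)
  rw [← eval₂_mul_of_isHomogeneous _ _ _ hf]
  simp only [mul_comm s₀, inv_mul_cancel_right₀ hs₀]

theorem le_dimLinearSystemImage [Infinite k] [LocallyOfFiniteType π] (E : CDiv X)
    {r : ℕ} {z : Fin r → X.functionField}
    (hz : letI := functionFieldAlgebra π; AlgebraicIndependent k z) {s₀ : X.functionField}
    (hs₀ : s₀ ≠ 0) (hs : ∀ x, s₀ ∈ E.stalk x) (hzs : ∀ i x, z i * s₀ ∈ E.stalk x) :
    ∃ h : H0 π E ≠ ⊥, (r : WithBot ℕ∞) ≤ dimLinearSystemImage π E h := by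
  let _ := functionFieldAlgebra π
  refine ⟨(Submodule.ne_bot_iff _).mpr ⟨s₀, hs, hs₀⟩, le_dimLinearSystemImage_iff.mpr ?_⟩
  obtain ⟨U, hU, hη, hreg, hdiv⟩ := exists_isAffineOpen_forall_mul_inv_mem_localRing E s₀ z
  choose y hy using fun i => exists_germ_eq_of_forall_mem_localRing hη fun x hx => hreg x hx i
  choose ρ hρ using fun j => exists_germ_eq_of_forall_mem_localRing hη fun x hx =>
    hdiv x hx _ (H0Basis_mem_stalk π E j x)
  obtain ⟨c, P, hP, hmono, hchain⟩ := exists_chain_of_germ π hU hη hz hy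
  let ψ : MvPolynomial (H0Index π E) k →+* Γ(X, U) := eval₂Hom (baseSectionMap π U) ρ
  have hψ {n : ℕ} {f : MvPolynomial (H0Index π E) k} (hf : f.IsHomogeneous n) {t : Γ(X, U)}
      (h : eval₂ (baseFieldMap π) (H0Basis π E) f =
        s₀ ^ n * X.presheaf.germ U (genericPoint X) hη t) : ψ f = t :=
    germ_genericPoint_injective U hη (mul_left_cancel₀ (pow_ne_zero n hs₀)
      ((eval₂_eq_pow_mul_germ π hη hs₀ hρ hf).symm.trans h))
  obtain ⟨l₀, hl₀, hl₀s⟩ := exists_linear_form_eval₂_eq π E hs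
  choose l hl hls using fun i => exists_linear_form_eval₂_eq π E (hzs i)
  have hψl₀ : ψ l₀ = 1 := hψ hl₀ (by rw [hl₀s, map_one, pow_one, mul_one])
  have hψl (i) : ψ (l i) = y i := hψ (hl i) (by rw [hls, hy, pow_one, mul_comm])
  have hirr := map_irrelevant_eq_top (φ := (Scheme.ΓSpecIso Γ(X, U)).inv.hom.comp ψ) hl₀
    (by rw [RingHom.comp_apply, hψl₀, map_one])
  let θ := Proj.fromOfGlobalSections (homogeneousSubmodule (H0Index π E) k) _ hirr
  let p (i : Fin (r + 1)) : Spec Γ(X, U) := (⟨P i, hP i⟩ : PrimeSpectrum Γ(X, U))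
  refine ⟨fun i => θ (p i), fun i => linearSystemPoint_specializes_iff.mpr fun n f hn hf h0 => ?_,
    fun i => ⟨?_, fun hspec => ?_⟩⟩
  · refine (mem_fromOfGlobalSections_iff hirr hn hf _).mpr ?_
    rw [hψ (t := 0) hf (by rw [h0, map_zero, mul_zero])]
    exact zero_mem _
  · exact ((PrimeSpectrum.le_iff_specializes (p _) (p _)).mp
      (hmono Fin.castSucc_lt_succ.le)).map θ.continuous
  · have hlin : (l i - C (c i) * l₀).IsHomogeneous 1 :=
      (hl i).sub (by simpa using (isHomogeneous_C _ (c i)).mul hl₀)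
    have hψlin : ψ (l i - C (c i) * l₀) = y i - baseSectionMap π U (c i) := by
      rw [map_sub, map_mul, hψl, hψl₀, mul_one]
      exact congrArg (y i - ·) (eval₂_C _ _ _)
    have hmem (j) : l i - C (c i) * l₀ ∈ (θ (p j)).asHomogeneousIdeal.toIdeal ↔
        y i - baseSectionMap π U (c i) ∈ P j := by
      rw [mem_fromOfGlobalSections_iff hirr one_pos hlin, hψlin]
    exact (hchain i).2 ((hmem _).mp (specializes_iff_forall_isHomogeneous.mp hspec 1 _ one_pos hlin
      ((hmem _).mpr (hchain i).1)))

end StructureMap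

section HasRatios
variable {X Y : Scheme.{u}} [IsIntegral X] [IsIntegral Y]

lemma exists_nsmul_eq_of_tmul_eq {M : Type*} [AddCommGroup M] {a b : M}
    (h : (1 : ℚ) ⊗ₜ[ℤ] a = (1 : ℚ) ⊗ₜ[ℤ] b) : ∃ N : ℕ, 0 < N ∧ N • a = N • b := by
  have : IsLocalizedModule (nonZeroDivisors ℤ) (TensorProduct.mk ℤ ℚ M 1) :=
    (isLocalizedModule_iff_isBaseChange (nonZeroDivisors ℤ) ℚ _).mpr
      (TensorProduct.isBaseChange ℤ M ℚ)
  obtain ⟨c, hc⟩ := (IsLocalizedModule.eq_iff_exists (nonZeroDivisors ℤ)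
    (TensorProduct.mk ℤ ℚ M 1)).mp h
  refine ⟨(c : ℤ).natAbs, Int.natAbs_pos.mpr (nonZeroDivisors.coe_ne_zero c), ?_⟩
  rw [← sub_eq_zero, ← smul_sub, natAbs_nsmul_eq_zero, smul_sub, sub_eq_zero]
  exact hc

lemma CDiv.mul_pow_succ_mem_stalk {E : CDiv X} {x : X} {s z : X.functionField}
    (hs : s ∈ E.stalk x) (hz : z * s ∈ E.stalk x) (n : ℕ) :
    z * s ^ (n + 1) ∈ ((n + 1) • E).stalk x := by
  rw [pow_succ', ← mul_assoc, succ_nsmul']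
  exact mul_mem_stalk hz (pow_mem_stalk hs n)

/-- The rational functions in `S` are ratios, with a common denominator, of sections of a multiple
of the `ℚ`-Cartier divisor `Δ`. In particular, `HasRatios Δ ∅` says that some multiple of `Δ` has a
non-zero section. -/
def HasRatios (Δ : QCDiv X) (S : Set X.functionField) : Prop :=
  ∃ N : ℕ, 0 < N ∧ ∃ E : CDiv X, N • Δ = (1 : ℚ) ⊗ₜ[ℤ] E ∧
    ∃ s : X.functionField, s ≠ 0 ∧ (∀ x, s ∈ E.stalk x) ∧ ∀ z ∈ S, ∀ x, z * s ∈ E.stalk x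

variable {Δ Δ' : QCDiv X} {S S' : Set X.functionField}

lemma HasRatios.smul (h : HasRatios Δ S) {q : ℚ} (hq : 0 < q) : HasRatios (q • Δ) S := by
  obtain ⟨N, hN, E, hE, s, hs0, hs, hz⟩ := h
  obtain ⟨a, ha⟩ : ∃ a : ℕ, q.num = (a + 1 : ℕ) := Int.eq_succ_of_zero_lt (Rat.num_pos.mpr hq)
  refine ⟨N * q.den, Nat.mul_pos hN q.den_pos, (a + 1) • E, ?_, s ^ (a + 1), pow_ne_zero _ hs0,
    fun x => CDiv.pow_mem_stalk (hs x) _,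
    fun z hzS x => CDiv.mul_pow_succ_mem_stalk (hs x) (hz z hzS x) a⟩
  have hcoeff : ((N * q.den : ℕ) : ℚ) * q = ((a + 1 : ℕ) : ℚ) * (N : ℕ) := by
    rw [Nat.cast_mul, mul_assoc, Rat.den_mul_eq_num, ha, mul_comm]
    rfl
  rw [tmul_smul, ← hE]
  simp only [← Nat.cast_smul_eq_nsmul ℚ, smul_smul, hcoeff]

lemma HasRatios.add (h : HasRatios Δ S) (h' : HasRatios Δ' S') :
    HasRatios (Δ + Δ') (S ∪ S') := by
  obtain ⟨N, hN, E, hE, s, hs0, hs, hz⟩ := h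
  obtain ⟨N', hN', E', hE', s', hs0', hs', hz'⟩ := h'
  obtain ⟨n, rfl⟩ := Nat.exists_eq_succ_of_ne_zero hN.ne'
  obtain ⟨n', rfl⟩ := Nat.exists_eq_succ_of_ne_zero hN'.ne'
  refine ⟨(n + 1) * (n' + 1), by positivity, (n' + 1) • E + (n + 1) • E', ?_,
    s ^ (n' + 1) * s' ^ (n + 1), mul_ne_zero (pow_ne_zero _ hs0) (pow_ne_zero _ hs0'),
    fun x => CDiv.mul_mem_stalk (CDiv.pow_mem_stalk (hs x) _) (CDiv.pow_mem_stalk (hs' x) _), ?_⟩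
  · rw [tmul_add, tmul_smul, tmul_smul, ← hE, ← hE', smul_add, smul_smul, smul_smul,
      mul_comm (n + 1)]
  · rintro z (hzS | hzS) x
    · rw [← mul_assoc]
      exact CDiv.mul_mem_stalk (CDiv.mul_pow_succ_mem_stalk (hs x) (hz z hzS x) n')
        (CDiv.pow_mem_stalk (hs' x) _)
    · rw [mul_left_comm]
      exact CDiv.mul_mem_stalk (CDiv.pow_mem_stalk (hs x) _)
        (CDiv.mul_pow_succ_mem_stalk (hs' x) (hz' z hzS x) n)

lemma QCDiv.pullback_tmul (f : X ⟶ Y) [IsDominant f] (q : ℚ) (E : CDiv Y) :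
    QCDiv.pullback f (q ⊗ₜ[ℤ] E) = q ⊗ₜ[ℤ] CDiv.pullback f E := rfl

lemma QCDiv.pullback_smul (f : X ⟶ Y) [IsDominant f] (q : ℚ) (Θ : QCDiv Y) :
    QCDiv.pullback f (q • Θ) = q • QCDiv.pullback f Θ := by
  induction Θ using TensorProduct.induction_on with
  | zero => simp only [smul_zero, map_zero]
  | add a b ha hb => rw [smul_add, map_add, map_add, smul_add, ha, hb]
  | tmul r E => rfl

lemma HasRatios.pullback (f : X ⟶ Y) [IsDominant f] {Θ : QCDiv Y} {T : Set Y.functionField}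
    (h : HasRatios Θ T) : HasRatios (QCDiv.pullback f Θ) (functionFieldMap f '' T) := by
  obtain ⟨N, hN, E, hE, s, hs0, hs, hz⟩ := h
  refine ⟨N, hN, CDiv.pullback f E, ?_, functionFieldMap f s,
    (map_ne_zero_iff _ (functionFieldMap f).injective).mpr hs0,
    fun x => CDiv.functionFieldMap_mem_stalk f (hs _), ?_⟩
  · rw [← QCDiv.pullback_tmul, ← hE, map_nsmul]
  · rintro _ ⟨z, hzT, rfl⟩ x
    rw [← map_mul]
    exact CDiv.functionFieldMap_mem_stalk f (hz z hzT _)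

lemma HasRatios.exists_nsmul {D : CDiv X} (h : HasRatios ((1 : ℚ) ⊗ₜ[ℤ] D) S) :
    ∃ N : ℕ, 0 < N ∧ ∃ s : X.functionField, s ≠ 0 ∧ (∀ x, s ∈ (N • D).stalk x) ∧
      ∀ z ∈ S, ∀ x, z * s ∈ (N • D).stalk x := by
  obtain ⟨N, hN, E, hE, s, hs0, hs, hz⟩ := h
  rw [← tmul_smul] at hE
  obtain ⟨M, hM, hME⟩ := exists_nsmul_eq_of_tmul_eq hE
  obtain ⟨m, rfl⟩ := Nat.exists_eq_succ_of_ne_zero hM.ne'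
  refine ⟨(m + 1) * N, Nat.mul_pos hM hN, s ^ (m + 1), pow_ne_zero _ hs0, ?_⟩
  rw [mul_smul, hME]
  exact ⟨fun x => CDiv.pow_mem_stalk (hs x) _,
    fun z hzS x => CDiv.mul_pow_succ_mem_stalk (hs x) (hz z hzS x) m⟩

end HasRatios

section Kappa
variable {X : Scheme.{u}} [IsIntegral X] {F : Type u} [Field F] {π : X ⟶ Spec (.of F)} {Δ : QCDiv X}

lemma le_of_lt_natCast_succ {x : WithBot ℕ∞} {n : ℕ} (h : x < ((n + 1 : ℕ) : WithBot ℕ∞)) :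
    x ≤ n := by
  induction x using WithBot.recBotCoe with
  | bot => exact bot_le
  | coe x =>
    have hx : x < ((n + 1 : ℕ) : ℕ∞) := WithBot.coe_lt_coe.mp h
    rw [Nat.cast_succ] at hx
    exact WithBot.coe_le_coe.mpr (Order.le_of_lt_add_one hx)

lemma natCast_le_iSup_iff {ι : Sort*} {g : ι → WithBot ℕ∞} {n : ℕ} :
    (n : WithBot ℕ∞) ≤ ⨆ i, g i ↔ ∃ i, (n : WithBot ℕ∞) ≤ g i := by
  refine ⟨fun h => ?_, fun ⟨i, hi⟩ => hi.trans (le_iSup g i)⟩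
  by_contra! hlt
  rcases n with _ | n
  · have hbot : ⨆ i, g i ≤ ⊥ := iSup_le fun i => (WithBot.lt_coe_bot.mp (hlt i)).le
    exact WithBot.coe_ne_bot (le_bot_iff.mp (h.trans hbot))
  · have hle : ⨆ i, g i ≤ n := iSup_le fun i => le_of_lt_natCast_succ (hlt i)
    have : n + 1 ≤ n := by exact_mod_cast h.trans hle
    omega

lemma natCast_le_kappa_iff {n : ℕ} : (n : WithBot ℕ∞) ≤ kappa π Δ ↔
    ∃ (m : ℕ) (E : CDiv X) (_ : 0 < m ∧ m • Δ = (1 : ℚ) ⊗ₜ[ℤ] E) (h : H0 π E ≠ ⊥),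
      (n : WithBot ℕ∞) ≤ dimLinearSystemImage π E h := by
  simp only [kappa, natCast_le_iSup_iff]

lemma exists_algebraicIndependent_of_le_kappa {n : ℕ} (h : (n : WithBot ℕ∞) ≤ kappa π Δ) :
    letI := functionFieldAlgebra π
    ∃ z : Fin n → X.functionField, AlgebraicIndependent F z ∧ HasRatios Δ (Set.range z) := by
  obtain ⟨m, E, ⟨hm, hE⟩, h0, hn⟩ := natCast_le_kappa_iff.mp h
  obtain ⟨z, hz, N, hN, s, hs0, hs, hzs⟩ := exists_algebraicIndependent_of_le_dim hn
  refine ⟨z, hz, N * m, Nat.mul_pos hN hm, N • E, ?_, s, hs0, hs, ?_⟩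
  · rw [mul_smul, hE, tmul_smul]
  · rintro _ ⟨i, rfl⟩
    exact hzs i

lemma HasRatios.le_kappa [Infinite F] [LocallyOfFiniteType π] {n : ℕ} {z : Fin n → X.functionField}
    (hz : letI := functionFieldAlgebra π; AlgebraicIndependent F z)
    (h : HasRatios Δ (Set.range z)) : (n : WithBot ℕ∞) ≤ kappa π Δ := by
  obtain ⟨N, hN, E, hE, s, hs0, hs, hzs⟩ := h
  obtain ⟨h0, hle⟩ := le_dimLinearSystemImage π E hz hs0 hs fun i => hzs _ ⟨i, rfl⟩
  exact natCast_le_kappa_iff.mpr ⟨N, E, ⟨hN, hE⟩, h0, hle⟩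

end Kappa

section Extension
variable {X : Scheme.{u}} [IsIntegral X]

lemma exists_isAffineOpen_equations (L B : CDiv X) (x : X) :
    ∃ (V : X.Opens) (g h : (X.functionField)ˣ), IsAffineOpen V ∧ x ∈ V ∧
      (∀ y ∈ V, L.germ y = QuotientGroup.mk g) ∧ ∀ y ∈ V, B.germ y = QuotientGroup.mk h := by
  obtain ⟨U, hU, g, hg⟩ := L.exists_equation x
  obtain ⟨U', hU', h, hh⟩ := B.exists_equation x
  obtain ⟨V, hV, hx, hle⟩ := exists_isAffineOpen_mem_and_subset (show x ∈ U ⊓ U' from ⟨hU, hU'⟩)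
  exact ⟨V, g, h, hV, hx, fun y hy => hg y (hle hy).1, fun y hy => hh y (hle hy).2⟩

lemma exists_pow_mul_germ_eq {X : Scheme.{u}} {V : X.Opens} (hV : IsAffineOpen V) {b : Γ(X, V)}
    {x : X} (hx : x ∈ X.basicOpen b) (t : Γ(X, X.basicOpen b)) :
    ∃ (N : ℕ) (t' : Γ(X, V)), X.presheaf.germ V x (X.basicOpen_le b hx) b ^ N *
      X.presheaf.germ (X.basicOpen b) x hx t = X.presheaf.germ V x (X.basicOpen_le b hx) t' := by
  have := hV.isLocalization_basicOpen b
  obtain ⟨N, t', ht'⟩ := IsLocalization.Away.surj b t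
  have hgerm (r : Γ(X, V)) : X.presheaf.germ (X.basicOpen b) x hx
      (algebraMap Γ(X, V) Γ(X, X.basicOpen b) r) =
        X.presheaf.germ V x (X.basicOpen_le b hx) r :=
    X.presheaf.germ_res_apply (homOfLE (X.basicOpen_le b)) _ hx r
  refine ⟨N, t', ?_⟩
  rw [← hgerm, ← hgerm, ← ht', map_mul, map_pow, mul_comm]

lemma exists_pow_mul_mem_localRing {V : X.Opens} (hV : IsAffineOpen V) {b : Γ(X, V)}
    (hη : genericPoint X ∈ X.basicOpen b) {c : X.functionField}
    (hc : ∀ y ∈ X.basicOpen b, c ∈ localRing y) :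
    ∃ N : ℕ, ∀ y ∈ V,
      X.presheaf.germ V (genericPoint X) (X.basicOpen_le b hη) b ^ N * c ∈ localRing y := by
  obtain ⟨t, rfl⟩ := exists_germ_eq_of_forall_mem_localRing hη hc
  obtain ⟨N, t', ht'⟩ := exists_pow_mul_germ_eq hV hη t
  refine ⟨N, fun y hy => ?_⟩
  rw [ht']
  exact germ_mem_localRing hy _ t'

lemma CDiv.generates_of_mem_basicOpen {B : CDiv X} {V : X.Opens} {h : (X.functionField)ˣ} {y : X}
    (hy : y ∈ V) (hh : B.germ y = QuotientGroup.mk h) (hη : genericPoint X ∈ V) {b : Γ(X, V)}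
    {a : X.functionField} (hb : X.presheaf.germ V (genericPoint X) hη b = a * h)
    (hyb : y ∈ X.basicOpen b) : B.Generates a y := by
  rw [generates_iff hh]
  refine ⟨((Scheme.mem_basicOpen _ _ _ hy).mp hyb).unit, ?_⟩
  rw [IsUnit.unit_spec, algebraMap_germ_eq _ hy hη, hb]

lemma exists_pow_mul_mem_stalk_of_equations {L B : CDiv X} {V : X.Opens} (hV : IsAffineOpen V)
    (hη : genericPoint X ∈ V) {g h : (X.functionField)ˣ}
    (hg : ∀ y ∈ V, L.germ y = QuotientGroup.mk g) (hh : ∀ y ∈ V, B.germ y = QuotientGroup.mk h)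
    {a c : X.functionField} (ha0 : a ≠ 0) (ha : ∀ y ∈ V, a ∈ B.stalk y)
    (hc : ∀ y ∈ V, B.Generates a y → c ∈ L.stalk y) :
    ∃ N : ℕ, ∀ M, N ≤ M → ∀ y ∈ V, a ^ M * c ∈ (L + M • B).stalk y := by
  have hreg : ∀ y ∈ V, a * h ∈ localRing y := fun y hy =>
    (CDiv.mem_stalk_iff (hh y hy)).mp (ha y hy)
  obtain ⟨b, hb⟩ := exists_germ_eq_of_forall_mem_localRing hη hreg
  have hηb : genericPoint X ∈ X.basicOpen b := by
    rw [Scheme.mem_basicOpen _ _ _ hη, hb]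
    exact IsUnit.mk0 _ (mul_ne_zero ha0 h.ne_zero)
  obtain ⟨N, hN⟩ := exists_pow_mul_mem_localRing hV hηb (c := c * g) fun y hy =>
    have hyV : y ∈ V := X.basicOpen_le b hy
    (CDiv.mem_stalk_iff (hg y hyV)).mp
      (hc y hyV (CDiv.generates_of_mem_basicOpen hyV (hh y hyV) hη hb hy))
  refine ⟨N, fun M hM y hy => ?_⟩
  have hgerm : (L + M • B).germ y = QuotientGroup.mk (g * h ^ M) := by
    rw [CDiv.germ_add, CDiv.germ_nsmul, hg y hy, hh y hy]
    rfl
  have hNy := hN y hy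
  rw [hb] at hNy
  rw [CDiv.mem_stalk_iff hgerm]
  convert mul_mem (pow_mem (hreg y hy) (M - N)) hNy using 1
  rw [← mul_assoc, ← pow_add, Nat.sub_add_cancel hM]
  push_cast
  ring

theorem exists_pow_mul_mem_stalk [CompactSpace X] (L B : CDiv X) {a c : X.functionField}
    (ha : ∀ x, a ∈ B.stalk x) (hc : ∀ x, B.Generates a x → c ∈ L.stalk x) :
    ∃ N : ℕ, ∀ M, N ≤ M → ∀ x, a ^ M * c ∈ (L + M • B).stalk x := by
  rcases eq_or_ne a 0 with rfl | ha0
  · refine ⟨1, fun M hM x => ?_⟩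
    rw [zero_pow (by omega), zero_mul]
    exact zero_mem _
  choose V g h hV hxV hg hh using exists_isAffineOpen_equations L B
  choose N hN using fun x => exists_pow_mul_mem_stalk_of_equations (hV x)
    (genericPoint_mem_of_mem (hxV x)) (hg x) (hh x) ha0 (fun y _ => ha y) fun y _ => hc y
  obtain ⟨t, ht⟩ := CompactSpace.elim_nhds_subcover (fun x => (V x : Set X))
    fun x => (V x).2.mem_nhds (hxV x)
  refine ⟨t.sup N, fun M hM y => ?_⟩
  obtain ⟨x, hx, hy⟩ := Set.mem_iUnion₂.mp (ht.ge (Set.mem_univ y))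
  exact hN x M ((Finset.le_sup hx).trans hM) y hy

end Extension

section Ample
variable {Y : Scheme.{u}} [IsIntegral Y]

lemma CDiv.IsAmple.exists_sections {A : CDiv Y} (hA : A.IsAmple) :
    ∃ b : ℕ, 0 < b ∧ ∃ t : Finset Y.functionField, (∀ a ∈ t, ∀ y, a ∈ (b • A).stalk y) ∧
      ∀ y, ∃ a ∈ t, (b • A).Generates a y := by
  classical
  obtain ⟨_, h⟩ := hA
  choose n hn s hs U hU _ hgen using h
  obtain ⟨t, ht⟩ := CompactSpace.elim_nhds_subcover (fun x => (U x : Set Y))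
    fun x => (U x).2.mem_nhds (hU x)
  have hmul : ∀ x ∈ t, ((∏ x ∈ t, n x) / n x) • n x • A = (∏ x ∈ t, n x) • A := fun x hx => by
    rw [smul_smul, Nat.div_mul_cancel (Finset.dvd_prod_of_mem n hx)]
  refine ⟨∏ x ∈ t, n x, Finset.prod_pos fun x _ => hn x,
    t.image fun x => s x ^ ((∏ x ∈ t, n x) / n x), fun a ha y => ?_, fun y => ?_⟩
  · obtain ⟨x, hx, rfl⟩ := Finset.mem_image.mp ha
    rw [← hmul x hx]
    exact CDiv.pow_mem_stalk (hs x y) _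
  · obtain ⟨x, hx, hy⟩ := Set.mem_iUnion₂.mp (ht.ge (Set.mem_univ y))
    refine ⟨_, Finset.mem_image_of_mem _ hx, ?_⟩
    rw [← hmul x hx]
    exact ((hgen x y).mp hy).pow _

lemma QCDiv.IsAmple.hasRatios {A : QCDiv Y} (hA : A.IsAmple) : HasRatios A ∅ := by
  obtain ⟨m, hm, E, hE, hE'⟩ := hA
  obtain ⟨b, hb, t, ht, ht'⟩ := hE'.exists_sections
  obtain ⟨a, ha, hgen⟩ := ht' (genericPoint Y)
  exact ⟨b * m, Nat.mul_pos hb hm, b • E, by rw [mul_smul, hE, tmul_smul], a, hgen.ne_zero, ht a ha,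
    fun z hz => hz.elim⟩

end Ample

section Kodaira
variable {Y : Scheme.{u}} [IsIntegral Y] {k : Type u} [Field k] (π : Y ⟶ Spec (.of k))

lemma exists_mul_pow_mem_stalk_of_mem_adjoin {E : CDiv Y} {T : Set Y.functionField}
    {s : Y.functionField} (hs : ∀ y, s ∈ E.stalk y) (hT : ∀ z ∈ T, ∀ y, z * s ∈ E.stalk y)
    {c : Y.functionField} (hc : letI := functionFieldAlgebra π; c ∈ Algebra.adjoin k T) :
    ∃ l : ℕ, ∀ m, l ≤ m → ∀ y, c * s ^ m ∈ (m • E).stalk y := by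
  let _ := functionFieldAlgebra π
  induction hc using Algebra.adjoin_induction with
  | mem z hz =>
    refine ⟨1, fun m hm y => ?_⟩
    obtain ⟨m, rfl⟩ := Nat.exists_eq_add_of_le' hm
    exact CDiv.mul_pow_succ_mem_stalk (hs y) (hT z hz y) m
  | algebraMap r =>
    exact ⟨0, fun m _ y => CDiv.localRing_mul_mem_stalk (baseFieldMap_mem_localRing π y r)
      (CDiv.pow_mem_stalk (hs y) m)⟩
  | add a b _ _ ha hb =>
    obtain ⟨l, hl⟩ := ha
    obtain ⟨l', hl'⟩ := hb
    refine ⟨max l l', fun m hm y => ?_⟩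
    rw [add_mul]
    exact add_mem (hl m (le_of_max_le_left hm) y) (hl' m (le_of_max_le_right hm) y)
  | mul a b _ _ ha hb =>
    obtain ⟨l, hl⟩ := ha
    obtain ⟨l', hl'⟩ := hb
    refine ⟨l + l', fun m hm y => ?_⟩
    obtain ⟨n, rfl⟩ := Nat.exists_eq_add_of_le hm
    convert CDiv.mul_mem_stalk (hl l le_rfl y) (hl' (l' + n) (by omega) y) using 1
    · rw [← add_smul, add_assoc]
    · ring

lemma exists_aeval_eq_zero_coeff_zero_ne_zero {R K : Type*} [CommRing R] [IsDomain R] [Field K]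
    [Algebra R K] {y : K} (hy0 : y ≠ 0) (hy : IsAlgebraic R y) :
    ∃ q : Polynomial R, q.coeff 0 ≠ 0 ∧ Polynomial.aeval y q = 0 := by
  obtain ⟨q, hq0, hq⟩ := hy
  obtain ⟨q', hq', hX⟩ := Polynomial.exists_eq_pow_rootMultiplicity_mul_and_not_dvd q hq0 0
  rw [Polynomial.C_0, sub_zero] at hq' hX
  refine ⟨q', fun h => hX (Polynomial.X_dvd_iff.mpr h), ?_⟩
  rw [hq', map_mul, map_pow, Polynomial.aeval_X] at hq
  exact (mul_eq_zero.mp hq).resolve_left (pow_ne_zero _ hy0)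

lemma coeff_zero_mul_inv_eq_of_aeval_div_eq_zero {R K : Type*} [CommRing R] [Field K] [Algebra R K]
    {q : Polynomial R} {a a' : K} (ha : a ≠ 0) (ha' : a' ≠ 0)
    (h : Polynomial.aeval (a' * a⁻¹) q = 0) :
    algebraMap R K (q.coeff 0) * a'⁻¹ = -∑ i ∈ Finset.range q.natDegree,
      (a' * a⁻¹) ^ i * (algebraMap R K (q.coeff (i + 1)) * a⁻¹) := by
  rw [Polynomial.aeval_eq_sum_range, Finset.sum_range_succ', add_comm, add_eq_zero_iff_eq_neg,
    pow_zero, Algebra.smul_def, mul_one] at h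
  rw [h, neg_mul, Finset.sum_mul]
  congr 1
  refine Finset.sum_congr rfl fun i _ => ?_
  rw [Algebra.smul_def, pow_succ]
  field_simp

/-- An equation for the algebraic element `a' / a` with non-zero constant term `Q` writes `Q / a'`
as `1 / a` times a polynomial in `a' / a`, and `a' / a` is regular where `a` generates `B`. -/
lemma exists_section_div_mem_stalk {E B : CDiv Y} {T : Set Y.functionField}
    {s : Y.functionField} (hs0 : s ≠ 0) (hs : ∀ y, s ∈ E.stalk y)
    (hT : ∀ z ∈ T, ∀ y, z * s ∈ E.stalk y)
    (halg : letI := functionFieldAlgebra π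
      Algebra.IsAlgebraic (Algebra.adjoin k T) Y.functionField)
    {a a' : Y.functionField} (ha0 : a ≠ 0) (ha0' : a' ≠ 0) (ha' : ∀ y, a' ∈ B.stalk y) :
    ∃ (l : ℕ) (Q : Y.functionField), Q ≠ 0 ∧ (∀ y, Q ∈ (l • E).stalk y) ∧
      ∀ y, B.Generates a y → Q * a'⁻¹ ∈ (l • E - B).stalk y := by
  let _ := functionFieldAlgebra π
  obtain ⟨q, hq0, hq⟩ := exists_aeval_eq_zero_coeff_zero_ne_zero (y := a' * a⁻¹)
    (mul_ne_zero ha0' (inv_ne_zero ha0)) (halg.isAlgebraic (a' * a⁻¹))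
  choose l hl using fun i => exists_mul_pow_mem_stalk_of_mem_adjoin π hs hT (q.coeff i).2
  let m := (Finset.range (q.natDegree + 1)).sup l
  have hm : ∀ i ∈ Finset.range (q.natDegree + 1), ∀ y,
      (q.coeff i : Y.functionField) * s ^ m ∈ (m • E).stalk y :=
    fun i hi y => hl i m (Finset.le_sup hi) y
  refine ⟨m, q.coeff 0 * s ^ m, mul_ne_zero ?_ (pow_ne_zero _ hs0), hm 0 (by simp), fun y hy => ?_⟩
  · exact fun h0 => hq0 (Subtype.ext h0)
  have hr : a' * a⁻¹ ∈ localRing y := hy.mem_stalk_iff.mp (ha' y)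
  have hconst : (q.coeff 0 : Y.functionField) * s ^ m * a'⁻¹ =
      -∑ i ∈ Finset.range q.natDegree,
        (a' * a⁻¹) ^ i * ((q.coeff (i + 1) : Y.functionField) * s ^ m * a⁻¹) := by
    rw [mul_right_comm]
    refine (congrArg (· * s ^ m) (coeff_zero_mul_inv_eq_of_aeval_div_eq_zero ha0 ha0' hq)).trans ?_
    rw [neg_mul, Finset.sum_mul]
    refine congrArg Neg.neg (Finset.sum_congr rfl fun i _ => ?_)
    rw [mul_assoc, mul_right_comm (algebraMap _ _ _)]
    rfl
  rw [hconst, sub_eq_add_neg]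
  refine neg_mem (Submodule.sum_mem _ fun i hi => ?_)
  exact CDiv.localRing_mul_mem_stalk (pow_mem hr i) (CDiv.mul_mem_stalk
    (hm (i + 1) (by simpa using hi) y) hy.inv_mem_stalk)

lemma exists_section_nsmul_sub {E B : CDiv Y} {T : Set Y.functionField}
    {s : Y.functionField} (hs0 : s ≠ 0) (hs : ∀ y, s ∈ E.stalk y)
    (hT : ∀ z ∈ T, ∀ y, z * s ∈ E.stalk y)
    (halg : letI := functionFieldAlgebra π
      Algebra.IsAlgebraic (Algebra.adjoin k T) Y.functionField)
    {t : Finset Y.functionField} (ht : ∀ a ∈ t, ∀ y, a ∈ B.stalk y)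
    (hgen : ∀ y, ∃ a ∈ t, B.Generates a y) :
    ∃ M : ℕ, 0 < M ∧ ∃ r : Y.functionField, r ≠ 0 ∧ ∀ y, r ∈ (M • E - B).stalk y := by
  classical
  obtain ⟨a', ha't, hgen'⟩ := hgen (genericPoint Y)
  have hdiv (a : Y.functionField) : ∃ (l : ℕ) (Q : Y.functionField), Q ≠ 0 ∧
      (∀ y, Q ∈ (l • E).stalk y) ∧
      ∀ y, B.Generates a y → Q * a'⁻¹ ∈ (l • E - B).stalk y := by
    rcases eq_or_ne a 0 with rfl | ha0
    · exact ⟨1, s, hs0, fun y => by rw [one_smul]; exact hs y, fun y hy => absurd rfl hy.ne_zero⟩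
    · exact exists_section_div_mem_stalk π hs0 hs hT halg ha0 hgen'.ne_zero (ht a' ha't)
  choose l Q hQ0 hQ hdiv using hdiv
  refine ⟨∑ a ∈ t, l a + 1, Nat.succ_pos _, s * (∏ a ∈ t, Q a) * a'⁻¹,
    mul_ne_zero (mul_ne_zero hs0 (Finset.prod_ne_zero_iff.mpr fun a _ => hQ0 a))
      (inv_ne_zero hgen'.ne_zero), fun y => ?_⟩
  obtain ⟨a, ha, hgen⟩ := hgen y
  convert CDiv.mul_mem_stalk (CDiv.mul_mem_stalk (hs y)
    (CDiv.prod_mem_stalk (t.erase a) (D := fun a => l a • E) fun a _ => hQ a y))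
    (hdiv a y hgen) using 1
  · rw [← Finset.sum_smul]
    simp only [← Finset.add_sum_erase t l ha, add_smul, one_smul]
    congr 1
    abel
  · rw [← Finset.mul_prod_erase t Q ha]
    ring

theorem exists_hasRatios_sub_smul {A H : QCDiv Y} (hA : A.IsAmple) {T : Set Y.functionField}
    (hH : HasRatios H T)
    (halg : letI := functionFieldAlgebra π
      Algebra.IsAlgebraic (Algebra.adjoin k T) Y.functionField) :
    ∃ ε : ℚ, 0 < ε ∧ HasRatios (H - ε • A) ∅ := by
  obtain ⟨m, hm, A', hA', hamp⟩ := hA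
  obtain ⟨b, hb, t, ht, hgen⟩ := hamp.exists_sections
  obtain ⟨N, hN, E, hE, s, hs0, hs, hT⟩ := hH
  obtain ⟨M, hM, r, hr0, hr⟩ := exists_section_nsmul_sub π hs0 hs hT halg ht hgen
  have hMN : (0 : ℚ) < (M * N : ℕ) := by exact_mod_cast Nat.mul_pos hM hN
  have hsub : HasRatios (((M * N : ℕ) : ℚ) • H - ((b * m : ℕ) : ℚ) • A) ∅ := by
    refine ⟨1, one_pos, M • E - b • A', ?_, r, hr0, hr, fun z hz => hz.elim⟩
    rw [one_smul, tmul_sub, tmul_smul, tmul_smul, ← hE, ← hA', Nat.cast_smul_eq_nsmul,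
      Nat.cast_smul_eq_nsmul, mul_smul, mul_smul]
  refine ⟨((M * N : ℕ) : ℚ)⁻¹ * ((b * m : ℕ) : ℚ), by positivity, ?_⟩
  simpa only [smul_sub, inv_smul_smul₀ hMN.ne', smul_smul] using hsub.smul (inv_pos.mpr hMN)

end Kodaira

section Denominators
variable {X Y : Scheme.{u}} [IsIntegral X] [IsIntegral Y] (f : X ⟶ Y)

/-- The ideal of those functions `r` on `W` for which `r u` is again a function on `W`. -/
def denominatorIdeal {W : X.Opens} (hη : genericPoint X ∈ W) (u : X.functionField) :
    Ideal Γ(X, W) where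
  carrier := {r | ∃ r', X.presheaf.germ W (genericPoint X) hη r * u =
    X.presheaf.germ W (genericPoint X) hη r'}
  zero_mem' := ⟨0, by rw [map_zero, zero_mul]⟩
  add_mem' := by
    rintro a b ⟨a', ha⟩ ⟨b', hb⟩
    exact ⟨a' + b', by rw [map_add, add_mul, ha, hb, map_add]⟩
  smul_mem' := by
    rintro c a ⟨a', ha⟩
    exact ⟨c * a', by rw [smul_eq_mul, map_mul, mul_assoc, ha, map_mul]⟩

lemma exists_mem_denominatorIdeal_of_mem_localRing {W : X.Opens} (hW : IsAffineOpen W)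
    (hη : genericPoint X ∈ W) {x : X} (hx : x ∈ W) {u : X.functionField} (hu : u ∈ localRing x) :
    ∃ r ∈ denominatorIdeal hη u, x ∈ X.basicOpen r := by
  obtain ⟨a, rfl⟩ := hu
  obtain ⟨O, hO, t, rfl⟩ := X.presheaf.exists_germ_eq a
  obtain ⟨b, hbO, hxb⟩ := hW.exists_basicOpen_le ⟨x, hO⟩ hx
  have hηb := genericPoint_mem_of_mem hxb
  obtain ⟨N, t', ht'⟩ := exists_pow_mul_germ_eq hW hηb (X.presheaf.map (homOfLE hbO).op t)
  refine ⟨b ^ N, ⟨t', ?_⟩, ?_⟩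
  · rw [algebraMap_germ_eq O hO (hbO hηb), map_pow, ← ht']
    exact congrArg _ (X.presheaf.germ_res_apply (homOfLE hbO) _ hηb t).symm
  · rw [Scheme.mem_basicOpen _ _ _ hx, map_pow]
    exact ((Scheme.mem_basicOpen _ _ _ hx).mp hxb).pow N

lemma fromSpec_mem_basicOpen_iff {X : Scheme.{u}} {W : X.Opens} (hW : IsAffineOpen W)
    (P : PrimeSpectrum Γ(X, W)) (r : Γ(X, W)) :
    hW.fromSpec P ∈ X.basicOpen r ↔ r ∉ P.asIdeal := by
  change P ∈ hW.fromSpec ⁻¹ᵁ X.basicOpen r ↔ _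
  rw [hW.fromSpec_preimage_basicOpen]
  exact Iff.rfl

lemma fromSpec_mem {X : Scheme.{u}} {W : X.Opens} (hW : IsAffineOpen W)
    (P : PrimeSpectrum Γ(X, W)) : hW.fromSpec P ∈ W := by
  have : hW.fromSpec P ∈ Set.range hW.fromSpec := ⟨_, rfl⟩
  rwa [hW.range_fromSpec] at this

lemma map_fromSpec_eq_genericPoint {X : Scheme.{u}} (f : X ⟶ Y) {V : Y.Opens} (hV : IsAffineOpen V)
    (hηV : genericPoint Y ∈ V) {W : X.Opens} (hW : IsAffineOpen W) (e : W ≤ f ⁻¹ᵁ V)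
    {P : PrimeSpectrum Γ(X, W)} (hP : ∀ t : Γ(Y, V), t ≠ 0 → f.appLE V W e t ∉ P.asIdeal) :
    f (hW.fromSpec P) = genericPoint Y := by
  refine (Specializes.antisymm (genericPoint_specializes _) ?_).eq.symm
  refine specializes_iff_forall_open.mpr fun O hO hηO => ?_
  obtain ⟨b, hbO, hηb⟩ := hV.exists_basicOpen_le (V := ⟨O, hO⟩) ⟨_, hηO⟩ hηV
  have hb0 : b ≠ 0 := by
    rintro rfl
    rw [Scheme.basicOpen_zero] at hηb
    exact hηb
  have hmem := (fromSpec_mem_basicOpen_iff hW P _).mpr (hP b hb0)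
  rw [Scheme.basicOpen_appLE] at hmem
  exact hbO hmem.2

/-- A prime containing the denominators of `u` and no non-zero function on the base would be a point
of the generic fibre at which `u` is not regular. -/
lemma exists_appLE_mem_denominatorIdeal {V : Y.Opens} (hV : IsAffineOpen V)
    (hηV : genericPoint Y ∈ V) {W : X.Opens} (hW : IsAffineOpen W) (e : W ≤ f ⁻¹ᵁ V)
    (hη : genericPoint X ∈ W) {u : X.functionField}
    (hu : ∀ x ∈ W, f x = genericPoint Y → u ∈ localRing x) :
    ∃ t : Γ(Y, V), t ≠ 0 ∧ f.appLE V W e t ∈ denominatorIdeal hη u := by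
  have : Nonempty V := ⟨⟨_, hηV⟩⟩
  by_contra! hc
  obtain ⟨P, hP, hIP, hdisj⟩ := Ideal.exists_le_prime_disjoint (denominatorIdeal hη u)
    (Submonoid.map (f.appLE V W e).hom (nonZeroDivisors Γ(Y, V))) (by
      rw [Set.disjoint_left]
      rintro _ hI ⟨t, ht, rfl⟩
      exact hc t (nonZeroDivisors.ne_zero ht) hI)
  have hfP := map_fromSpec_eq_genericPoint f hV hηV hW e (P := ⟨P, hP⟩) fun t ht htP =>
    Set.disjoint_left.mp hdisj htP ⟨t, mem_nonZeroDivisors_of_ne_zero ht, rfl⟩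
  obtain ⟨r, hr, hPr⟩ := exists_mem_denominatorIdeal_of_mem_localRing hW hη (fromSpec_mem hW _)
    (hu _ (fromSpec_mem hW _) hfP)
  exact (fromSpec_mem_basicOpen_iff hW _ r).mp hPr (hIP hr)

variable [IsDominant f]

lemma functionFieldMap_germ_appLE {V : Y.Opens} {W : X.Opens} (e : W ≤ f ⁻¹ᵁ V)
    (hV : genericPoint Y ∈ V) (hW : genericPoint X ∈ W) (t : Γ(Y, V)) :
    functionFieldMap f (Y.presheaf.germ V (genericPoint Y) hV t) =
      X.presheaf.germ W (genericPoint X) hW (f.appLE V W e t) := by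
  rw [functionFieldMap_germ V hV (e hW)]
  exact (X.presheaf.germ_res_apply (homOfLE e) _ hW (f.app V t)).symm

lemma exists_functionFieldMap_mul_mem_localRing {V : Y.Opens} (hV : IsAffineOpen V)
    {W : X.Opens} (hW : IsAffineOpen W) (e : W ≤ f ⁻¹ᵁ V) (hη : genericPoint X ∈ W)
    {u : X.functionField} (hu : ∀ x ∈ W, f x = genericPoint Y → u ∈ localRing x) :
    ∃ t : Y.functionField, t ≠ 0 ∧ (∀ y ∈ V, t ∈ localRing y) ∧
      ∀ x ∈ W, functionFieldMap f t * u ∈ localRing x := by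
  have hηV : genericPoint Y ∈ V := by
    rw [← map_genericPoint f]
    exact e hη
  obtain ⟨t, ht0, r', hr'⟩ := exists_appLE_mem_denominatorIdeal f hV hηV hW e hη hu
  refine ⟨Y.presheaf.germ V (genericPoint Y) hηV t, fun h0 => ht0 ?_, fun y hy =>
    germ_mem_localRing hy hηV t, fun x hx => ?_⟩
  · exact germ_genericPoint_injective V hηV (h0.trans (map_zero _).symm)
  · rw [functionFieldMap_germ_appLE f e hηV hη, hr']
    exact germ_mem_localRing hx hη _

lemma exists_opens_functionFieldMap_mul_mem_stalk {V : Y.Opens} (hV : IsAffineOpen V)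
    (L : CDiv X) {v : X.functionField} (hv : ∀ x, f x = genericPoint Y → v ∈ L.stalk x)
    {x : X} (hx : f x ∈ V) :
    ∃ W : X.Opens, x ∈ W ∧ ∃ t : Y.functionField, t ≠ 0 ∧ (∀ y ∈ V, t ∈ localRing y) ∧
      ∀ x ∈ W, functionFieldMap f t * v ∈ L.stalk x := by
  obtain ⟨O, hO, g, hg⟩ := L.exists_equation x
  obtain ⟨W, hW, hxW, hle⟩ := exists_isAffineOpen_mem_and_subset
    (show x ∈ O ⊓ f ⁻¹ᵁ V from ⟨hO, hx⟩)
  obtain ⟨t, ht0, ht, htv⟩ := exists_functionFieldMap_mul_mem_localRing f hV hW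
    (fun y hy => (hle hy).2) (genericPoint_mem_of_mem hxW) (u := v * g)
    fun y hy hfy => (CDiv.mem_stalk_iff (hg y (hle hy).1)).mp (hv y hfy)
  refine ⟨W, hxW, t, ht0, ht, fun y hy => ?_⟩
  rw [CDiv.mem_stalk_iff (hg y (hle hy).1), mul_assoc]
  exact htv y hy

lemma functionFieldMap_prod_mul_mem_stalk {L : CDiv X} {x : X} {v : X.functionField} {ι : Type*}
    {T : Finset ι} {t : ι → Y.functionField} (ht : ∀ i ∈ T, t i ∈ localRing (f x)) {i : ι}
    (hi : i ∈ T) (h : functionFieldMap f (t i) * v ∈ L.stalk x) :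
    functionFieldMap f (∏ i ∈ T, t i) * v ∈ L.stalk x := by
  classical
  rw [← Finset.prod_erase_mul T t hi, map_mul, mul_assoc]
  exact CDiv.localRing_mul_mem_stalk (functionFieldMap_mem_localRing f
    (prod_mem fun j hj => ht j (Finset.mem_of_mem_erase hj))) h

lemma exists_functionFieldMap_mul_mem_stalk [QuasiCompact f] {V : Y.Opens} (hV : IsAffineOpen V)
    (L : CDiv X) {v : X.functionField} (hv : ∀ x, f x = genericPoint Y → v ∈ L.stalk x) :
    ∃ t : Y.functionField, t ≠ 0 ∧ (∀ y ∈ V, t ∈ localRing y) ∧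
      ∀ x, f x ∈ V → functionFieldMap f t * v ∈ L.stalk x := by
  choose W hxW t ht0 ht htv using
    fun (x : X) (hx : f x ∈ V) => exists_opens_functionFieldMap_mul_mem_stalk f hV L hv hx
  have hcomp : IsCompact (f ⁻¹ᵁ V : Set X) := f.isCompact_preimage hV.isCompact
  obtain ⟨T, hT⟩ := hcomp.elim_nhds_subcover' (fun x hx => (W x hx : Set X))
    fun x hx => (W x hx).2.mem_nhds (hxW x hx)
  refine ⟨∏ x ∈ T, t x x.2, Finset.prod_ne_zero_iff.mpr fun x _ => ht0 x x.2,
    fun y hy => prod_mem fun x _ => ht x x.2 y hy, fun x hx => ?_⟩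
  obtain ⟨x', hx', hxx'⟩ := Set.mem_iUnion₂.mp (hT hx)
  exact functionFieldMap_prod_mul_mem_stalk f (fun i _ => ht i i.2 _ hx) hx' (htv x' x'.2 x hxx')

lemma CDiv.Generates.of_pullback {B : CDiv Y} {x : X} {a : Y.functionField}
    (ha : a ∈ B.stalk (f x)) (h : (CDiv.pullback f B).Generates (functionFieldMap f a) x) :
    B.Generates a (f x) := by
  obtain ⟨g, hg⟩ := B.exists_germ_eq (f x)
  obtain ⟨r, hr⟩ := (CDiv.mem_stalk_iff hg).mp ha
  obtain ⟨u, hu⟩ := (CDiv.generates_iff (CDiv.germ_pullback f hg)).mp h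
  rw [CDiv.generates_iff hg]
  have hru : (f.stalkMap x).hom r = u := by
    apply IsFractionRing.injective (X.presheaf.stalk x) X.functionField
    refine (functionFieldMap_algebraMap f x r).symm.trans ?_
    rw [hr, map_mul, hu]
    rfl
  have hr_unit : IsUnit r := isUnit_of_map_unit (f.stalkMap x).hom r (hru ▸ u.isUnit)
  exact ⟨hr_unit.unit, hr⟩

/-- The denominators over an affine open subset of `Y` which is the non-vanishing locus of a section
of a multiple of `A` are cleared first; a power of that section removes the remaining poles. -/
theorem exists_mul_mem_stalk_of_ample [QuasiCompact f] {A : CDiv Y}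
    (hA : A.IsAmple) (L : CDiv X) {ι : Type*} [Finite ι] {v : ι → X.functionField}
    (hv : ∀ i x, f x = genericPoint Y → v i ∈ L.stalk x) :
    ∃ (M : ℕ) (w : X.functionField), 0 < M ∧ w ≠ 0 ∧
      ∀ i x, w * v i ∈ (L + M • CDiv.pullback f A).stalk x := by
  have := Fintype.ofFinite ι
  obtain ⟨_, h⟩ := hA
  have : CompactSpace X := QuasiCompact.compactSpace_of_compactSpace f
  obtain ⟨n, hn, a, ha, V, hηV, hV, hgen⟩ := h (genericPoint Y)
  have ha0 : a ≠ 0 := ((hgen _).mp hηV).ne_zero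
  choose t ht0 ht htv using fun i => exists_functionFieldMap_mul_mem_stalk f hV L (hv i)
  choose N hN using fun i => exists_pow_mul_mem_stalk L (CDiv.pullback f (n • A))
    (c := functionFieldMap f (∏ i, t i) * v i)
    (fun x => CDiv.functionFieldMap_mem_stalk f (ha (f x))) fun x hx =>
      have hfx : f x ∈ V := (hgen _).mpr (CDiv.Generates.of_pullback f (ha _) hx)
      functionFieldMap_prod_mul_mem_stalk f (fun j _ => ht j _ hfx) (Finset.mem_univ i)
        (htv i x hfx)
  let M := Finset.univ.sup N + 1
  have hinj := (functionFieldMap f).injective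
  refine ⟨M * n, functionFieldMap f a ^ M * functionFieldMap f (∏ i, t i),
    Nat.mul_pos (Nat.succ_pos _) hn, mul_ne_zero (pow_ne_zero _ ?_) ?_, fun i x => ?_⟩
  · exact (map_ne_zero_iff _ hinj).mpr ha0
  · exact (map_ne_zero_iff _ hinj).mpr (Finset.prod_ne_zero_iff.mpr fun i _ => ht0 i)
  · rw [mul_assoc, mul_smul, ← map_nsmul (CDiv.pullback f) n A]
    exact hN i M ((Finset.le_sup (Finset.mem_univ i)).trans (Nat.le_succ _)) x

end Denominators

section GenericFiber
variable {X Y : Scheme.{u}} [IsIntegral X] [IsIntegral Y] (f : X ⟶ Y) [IsDominant f]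

lemma functionFieldMap_fiberι_surjective :
    Function.Surjective (functionFieldMap (f.fiberι (genericPoint Y))) := by
  intro z
  obtain ⟨w, rfl⟩ := (bijective_stalkMap_fiberι f (genericPoint (f.fiber (genericPoint Y)))).2 z
  let heq := map_genericPoint (f.fiberι (genericPoint Y))
  have : IsIso (X.presheaf.stalkSpecializes (specializes_of_eq heq)) :=
    (TopCat.Presheaf.stalkCongr X.presheaf (.of_eq heq.symm)).isIso_hom
  obtain ⟨w', rfl⟩ := (ConcreteCategory.bijective_of_isIso
    (X.presheaf.stalkSpecializes (specializes_of_eq heq))).2 w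
  exact ⟨w', rfl⟩

lemma mem_stalk_of_functionFieldMap_fiberι {L : CDiv X} {v : X.functionField}
    {w : f.fiber (genericPoint Y)}
    (hv : functionFieldMap (f.fiberι (genericPoint Y)) v ∈
      (CDiv.pullback (f.fiberι (genericPoint Y)) L).stalk w) :
    v ∈ L.stalk (f.fiberι (genericPoint Y) w) := by
  obtain ⟨g, hg⟩ := L.exists_germ_eq (f.fiberι (genericPoint Y) w)
  rw [CDiv.mem_stalk_iff (CDiv.germ_pullback _ hg)] at hv
  rw [CDiv.mem_stalk_iff hg]
  obtain ⟨a, ha⟩ := hv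
  obtain ⟨b, rfl⟩ := (bijective_stalkMap_fiberι f w).2 a
  refine ⟨b, (functionFieldMap (f.fiberι (genericPoint Y))).injective ?_⟩
  rw [map_mul]
  exact (functionFieldMap_algebraMap _ w b).trans ha

lemma mem_stalk_of_forall_functionFieldMap_fiberι {L : CDiv X} {v : X.functionField}
    (hv : ∀ w, functionFieldMap (f.fiberι (genericPoint Y)) v ∈
      (CDiv.pullback (f.fiberι (genericPoint Y)) L).stalk w)
    {x : X} (hx : f x = genericPoint Y) : v ∈ L.stalk x := by
  obtain ⟨w, rfl⟩ : x ∈ Set.range (f.fiberι (genericPoint Y)) := by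
    rw [Scheme.Hom.range_fiberι]
    exact hx
  exact mem_stalk_of_functionFieldMap_fiberι f (hv w)

theorem HasRatios.of_fiber [QuasiCompact f] {A : QCDiv Y} (hA : A.IsAmple)
    (D : CDiv X) {n : ℕ} {z : Fin n → (f.fiber (genericPoint Y)).functionField}
    (h : HasRatios ((1 : ℚ) ⊗ₜ[ℤ] CDiv.pullback (f.fiberι (genericPoint Y)) D) (Set.range z)) :
    ∃ z' : Fin n → X.functionField,
      (∀ i, functionFieldMap (f.fiberι (genericPoint Y)) (z' i) = z i) ∧
      ∃ c : ℚ, 0 < c ∧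
        HasRatios ((1 : ℚ) ⊗ₜ[ℤ] D + c • QCDiv.pullback f A) (Set.range z') := by
  obtain ⟨N, hN, s, hs0, hs, hzs⟩ := h.exists_nsmul
  obtain ⟨m, hm, A', hA', hamp⟩ := hA
  obtain ⟨s', rfl⟩ := functionFieldMap_fiberι_surjective f s
  choose z' hz' using fun i => functionFieldMap_fiberι_surjective f (z i)
  simp only [← map_nsmul] at hs hzs
  obtain ⟨M, w, hM, hw0, hw⟩ := exists_mul_mem_stalk_of_ample f hamp (N • D)
    (v := fun o : Option (Fin n) => o.elim s' fun i => z' i * s') (by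
      rintro (_ | i) x hx
      · exact mem_stalk_of_forall_functionFieldMap_fiberι f hs hx
      · refine mem_stalk_of_forall_functionFieldMap_fiberι f (v := z' i * s') (fun y => ?_) hx
        rw [map_mul, hz']
        exact hzs _ ⟨i, rfl⟩ y)
  have hN' : (0 : ℚ) < N := by exact_mod_cast hN
  have hratios : HasRatios ((N : ℚ) • ((1 : ℚ) ⊗ₜ[ℤ] D) +
      ((M * m : ℕ) : ℚ) • QCDiv.pullback f A) (Set.range z') := by
    refine ⟨1, one_pos, N • D + M • CDiv.pullback f A', ?_, w * s', mul_ne_zero hw0 ?_,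
      fun x => hw none x, ?_⟩
    · rw [one_smul, tmul_add, tmul_smul, tmul_smul, ← QCDiv.pullback_tmul, ← hA',
        Nat.cast_smul_eq_nsmul, Nat.cast_smul_eq_nsmul, map_nsmul, mul_smul]
    · rintro rfl
      exact hs0 (map_zero _)
    · rintro _ ⟨i, rfl⟩ x
      rw [mul_left_comm]
      exact hw (some i) x
  refine ⟨z', hz', (N : ℚ)⁻¹ * ((M * m : ℕ) : ℚ), by positivity, ?_⟩
  simpa only [smul_add, inv_smul_smul₀ hN'.ne', smul_smul] using hratios.smul (inv_pos.mpr hN')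

end GenericFiber

section Projective
attribute [local instance] MvPolynomial.gradedAlgebra
variable {k : Type u} [Field k]

lemma surjective_algebraMap_homogeneousSubmodule_zero (n : ℕ) : Function.Surjective
    (algebraMap k (MvPolynomial.homogeneousSubmodule (Fin (n + 1)) k 0)) := by
  rintro ⟨q, hq⟩
  refine ⟨q.coeff 0, Subtype.ext ?_⟩
  exact (MvPolynomial.totalDegree_eq_zero_iff_eq_C.mp
    (Nat.le_zero.mp (MvPolynomial.IsHomogeneous.totalDegree_le hq))).symm

instance finiteType_homogeneousSubmodule_zero (n : ℕ) :
    Algebra.FiniteType (MvPolynomial.homogeneousSubmodule (Fin (n + 1)) k 0)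
      (MvPolynomial (Fin (n + 1)) k) :=
  have : IsScalarTower k (MvPolynomial.homogeneousSubmodule (Fin (n + 1)) k 0)
      (MvPolynomial (Fin (n + 1)) k) := ⟨fun a b c => smul_mul_assoc a b.1 c⟩
  Algebra.FiniteType.of_restrictScalars_finiteType k _ _

instance isProper_projectiveSpaceStructure (n : ℕ) : IsProper (projectiveSpaceStructure k n) := by
  have : IsClosedImmersion (Spec.map (CommRingCat.ofHom
      (algebraMap k (MvPolynomial.homogeneousSubmodule (Fin (n + 1)) k 0)))) :=
    IsClosedImmersion.spec_of_surjective _ (surjective_algebraMap_homogeneousSubmodule_zero n)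
  have hProj : IsProper (Proj.toSpecZero (MvPolynomial.homogeneousSubmodule (Fin (n + 1)) k)) :=
    inferInstance
  exact MorphismProperty.comp_mem @IsProper _ _ hProj (inferInstance : IsProper _)

lemma IsProjectiveOver.isProper {X : Scheme.{u}} {π : X ⟶ Spec (.of k)} (h : IsProjectiveOver π) :
    IsProper π := by
  obtain ⟨n, i, hi, rfl⟩ := h
  infer_instance

end Projective

section TranscendenceDegree
variable {k : Type u} [Field k] {Y : Scheme.{u}} [IsIntegral Y] (π : Y ⟶ Spec (.of k))

lemma trdeg_functionField_lt_aleph0 [LocallyOfFiniteType π] :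
    letI := functionFieldAlgebra π
    Algebra.trdeg k Y.functionField < Cardinal.aleph0 := by
  let _ := functionFieldAlgebra π
  obtain ⟨U, hU, hη, -⟩ := exists_isAffineOpen_mem_and_subset
    (show genericPoint Y ∈ (⊤ : Y.Opens) from trivial)
  have : Nonempty U := ⟨⟨_, hη⟩⟩
  have := functionField_isFractionRing_of_isAffineOpen Y U hU
  let _ : Algebra k Γ(Y, U) := (baseSectionMap π U).toAlgebra
  have : Algebra.FiniteType k Γ(Y, U) := finiteType_baseSectionMap π hU
  have : IsScalarTower k Γ(Y, U) Y.functionField :=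
    .of_algebraMap_eq fun c => (germ_baseSectionMap π hη c).symm
  have : FaithfulSMul k Γ(Y, U) :=
    (faithfulSMul_iff_algebraMap_injective _ _).mpr (baseSectionMap π U).injective
  have : Algebra.IsAlgebraic Γ(Y, U) Y.functionField :=
    IsLocalization.isAlgebraic _ (nonZeroDivisors Γ(Y, U))
  rw [← _root_.trdeg_add_eq k Γ(Y, U), trdeg_eq_zero (R := Γ(Y, U)), add_zero]
  exact trdeg_lt_aleph0_of_finiteType

lemma IsBig.exists_hasRatios [Infinite k] [LocallyOfFiniteType π] {H : QCDiv Y} (hH : IsBig π H) :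
    letI := functionFieldAlgebra π
    ∃ (n : ℕ) (z : Fin n → Y.functionField), topologicalKrullDim Y ≤ n ∧
      IsTranscendenceBasis k z ∧ HasRatios H (Set.range z) := by
  let _ := functionFieldAlgebra π
  obtain ⟨n, hn⟩ := Cardinal.lt_aleph0.mp (trdeg_functionField_lt_aleph0 π)
  have hle : ∀ {r : ℕ} {z : Fin r → Y.functionField}, AlgebraicIndependent k z → r ≤ n := by
    intro r z hz
    have := hz.lift_cardinalMk_le_trdeg
    rw [hn] at this
    simpa using this
  obtain ⟨s, hs⟩ := exists_isTranscendenceBasis k Y.functionField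
  obtain ⟨z, hz⟩ : ∃ z : Fin n → Y.functionField, AlgebraicIndependent k z := by
    have hcard := hs.cardinalMk_eq_trdeg
    rw [hn] at hcard
    obtain ⟨e⟩ : Nonempty (Fin n ≃ s) := by
      rw [← Cardinal.lift_mk_eq']
      simp [hcard]
    exact ⟨_, hs.1.comp e e.injective⟩
  have hdim := le_topologicalKrullDim_of_algebraicIndependent π hz
  rw [← hH] at hdim
  obtain ⟨w, hw, hw'⟩ := exists_algebraicIndependent_of_le_kappa hdim
  refine ⟨n, w, ?_, hw.isTranscendenceBasis_of_lift_trdeg_le_of_finite (by simp [hn]), hw'⟩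
  refine le_of_lt_natCast_succ (lt_of_not_ge fun hc => ?_)
  rw [← hH] at hc
  obtain ⟨v, hv, -⟩ := exists_algebraicIndependent_of_le_kappa hc
  exact absurd (hle hv) (by omega)

end TranscendenceDegree

section Compatibility
variable {X Y : Scheme.{u}} [IsIntegral X] [IsIntegral Y]

lemma SpecMap_functionFieldMap_fromSpecStalk (f : X ⟶ Y) [IsDominant f] :
    Spec.map (CommRingCat.ofHom (functionFieldMap f)) ≫ Y.fromSpecStalk (genericPoint Y) =
      X.fromSpecStalk (genericPoint X) ≫ f := by
  rw [← Scheme.SpecMap_stalkMap_fromSpecStalk,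
    ← Scheme.SpecMap_stalkSpecializes_fromSpecStalk (specializes_of_eq (map_genericPoint f)),
    ← Category.assoc, ← Spec.map_comp]
  rfl

lemma SpecMap_baseFieldMap {k : Type u} [Field k] (π : X ⟶ Spec (.of k)) :
    Spec.map (CommRingCat.ofHom (baseFieldMap π)) = X.fromSpecStalk (genericPoint X) ≫ π := by
  have hΓ : X.fromSpecStalk (genericPoint X) ≫ π ≫ (Spec (.of k)).toSpecΓ =
      Spec.map (π.appTop ≫ X.presheaf.germ ⊤ (genericPoint X) trivial) := by
    rw [Scheme.toSpecΓ_naturality, Scheme.fromSpecStalk_toSpecΓ_assoc, ← Spec.map_comp]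
  change Spec.map ((Scheme.ΓSpecIso (.of k)).inv ≫ π.appTop ≫ _) = _
  rw [Spec.map_comp, ← hΓ, Category.assoc, Category.assoc, toSpecΓ_SpecMap_ΓSpecIso_inv,
    Category.comp_id]

lemma functionFieldMap_comp_baseFieldMap {k : Type u} [Field k] (f : X ⟶ Y) [IsDominant f]
    (π : Y ⟶ Spec (.of k)) :
    (functionFieldMap f).comp (baseFieldMap π) = baseFieldMap (f ≫ π) := by
  have hcomp : CommRingCat.ofHom (baseFieldMap π) ≫ CommRingCat.ofHom (functionFieldMap f) =
      CommRingCat.ofHom (baseFieldMap (f ≫ π)) := by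
    apply Spec.map_injective
    rw [Spec.map_comp, SpecMap_baseFieldMap, SpecMap_baseFieldMap,
      ← Category.assoc, SpecMap_functionFieldMap_fromSpecStalk, Category.assoc]
  exact congrArg CommRingCat.Hom.hom hcomp

lemma functionFieldMap_comp_of_fac {Z : Scheme.{u}} [IsIntegral Z] {F : Type u} [Field F]
    (g : Z ⟶ X) [IsDominant g] (f : X ⟶ Y) [IsDominant f] (π : Z ⟶ Spec (.of F))
    (ρ : Y.functionField →+* F)
    (h : g ≫ f = π ≫ Spec.map (CommRingCat.ofHom ρ) ≫ Y.fromSpecStalk (genericPoint Y)) :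
    (functionFieldMap g).comp (functionFieldMap f) = (baseFieldMap π).comp ρ := by
  have hcomp : CommRingCat.ofHom (functionFieldMap f) ≫ CommRingCat.ofHom (functionFieldMap g) =
      CommRingCat.ofHom ρ ≫ CommRingCat.ofHom (baseFieldMap π) := by
    apply Spec.map_injective
    rw [← cancel_mono (Y.fromSpecStalk (genericPoint Y)), Spec.map_comp, Spec.map_comp,
      Category.assoc, Category.assoc, SpecMap_functionFieldMap_fromSpecStalk,
      SpecMap_baseFieldMap, Category.assoc, ← h, ← Category.assoc,
      SpecMap_functionFieldMap_fromSpecStalk, Category.assoc]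
  exact congrArg CommRingCat.Hom.hom hcomp

lemma functionFieldMap_fiberι_comp (f : X ⟶ Y) [IsDominant f] :
    (functionFieldMap (f.fiberι (genericPoint Y))).comp (functionFieldMap f) =
      (baseFieldMap (F := Y.residueField (genericPoint Y))
        (f.fiberToSpecResidueField (genericPoint Y))).comp
        (Y.residue (genericPoint Y)).hom :=
  functionFieldMap_comp_of_fac (F := Y.residueField (genericPoint Y))
    (f.fiberι (genericPoint Y)) f (f.fiberToSpecResidueField (genericPoint Y)) _
    (f.fiber_fac (genericPoint Y))

end Compatibility

section Assembly
variable {X Y : Scheme.{u}} [IsIntegral X] [IsIntegral Y] (f : X ⟶ Y) [IsDominant f]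

lemma algebraicIndependent_of_fiber {m : ℕ} {z : Fin m → X.functionField}
    (hz :
      letI : Algebra (Y.residueField (genericPoint Y))
          (f.fiber (genericPoint Y)).functionField :=
        functionFieldAlgebra (f.fiberToSpecResidueField (genericPoint Y))
      AlgebraicIndependent (Y.residueField (genericPoint Y))
        (functionFieldMap (f.fiberι (genericPoint Y)) ∘ z)) :
    letI := (functionFieldMap f).toAlgebra
    AlgebraicIndependent Y.functionField z := by
  let _ := functionFieldAlgebra (F := Y.residueField (genericPoint Y))
    (f.fiberToSpecResidueField (genericPoint Y))
  let _ := (functionFieldMap f).toAlgebra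
  have hinj : Function.Injective ((Y.residue (genericPoint Y)).hom :
      Y.functionField →+* Y.residueField (genericPoint Y)) :=
    RingHom.injective (R := Y.functionField) _
  exact AlgebraicIndependent.of_ringHom_of_comp_eq (R := Y.functionField)
    (S := Y.residueField (genericPoint Y))
    ((Y.residue (genericPoint Y)).hom :
      Y.functionField →+* Y.residueField (genericPoint Y))
    (functionFieldMap (f.fiberι (genericPoint Y))) hz hinj (functionFieldMap_fiberι_comp f).symm

lemma exists_algebraicIndependent_range_eq {k : Type u} [Field k] (π : Y ⟶ Spec (.of k)) {m n : ℕ}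
    {y : Fin n → Y.functionField} {z : Fin m → X.functionField}
    (hy : letI := functionFieldAlgebra π; AlgebraicIndependent k y)
    (hz : letI := (functionFieldMap f).toAlgebra; AlgebraicIndependent Y.functionField z) :
    letI := functionFieldAlgebra (f ≫ π)
    ∃ w : Fin (m + n) → X.functionField, AlgebraicIndependent k w ∧
      Set.range w = Set.range z ∪ functionFieldMap f '' Set.range y := by
  let _ := functionFieldAlgebra (f ≫ π)
  let _ := functionFieldAlgebra π
  let _ := (functionFieldMap f).toAlgebra
  have : IsScalarTower k Y.functionField X.functionField :=
    .of_algebraMap_eq' (functionFieldMap_comp_baseFieldMap f π).symm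
  refine ⟨_, (hy.sumElim_comp hz).comp finSumFinEquiv.symm finSumFinEquiv.symm.injective, ?_⟩
  rw [finSumFinEquiv.symm.surjective.range_comp, Set.Sum.elim_range, Set.range_comp]
  rfl

variable {f}

/-- For small `α > 0` the divisor `Δ + f^*H` is the sum of `α (Δ + c f^*A)`, `f^*H / 2`,
`f^*(H - ε A) / 2`, `(1 - α) (Δ + δ f^*A)` and a positive multiple of `f^*A`. -/
lemma HasRatios.combine {Δ : QCDiv X} {A H : QCDiv Y} {S : Set X.functionField}
    {T : Set Y.functionField} (hA : HasRatios A ∅) {c : ℚ} (hc : 0 < c)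
    (hS : HasRatios (Δ + c • QCDiv.pullback f A) S) (hT : HasRatios H T) {ε : ℚ} (hε : 0 < ε)
    (hH : HasRatios (H - ε • A) ∅) {δ : ℚ} (hδ : 0 < δ) (hδε : δ < ε / 4)
    (hΔ : HasRatios (Δ + δ • QCDiv.pullback f A) ∅) :
    HasRatios (Δ + QCDiv.pullback f H) (S ∪ functionFieldMap f '' T) := by
  obtain ⟨α, hα, hα1, hαc⟩ : ∃ α : ℚ, 0 < α ∧ α < 1 ∧ α * c ≤ ε / 8 := by
    refine ⟨ε / (8 * c + 8 * ε), by positivity, ?_, ?_⟩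
    · rw [div_lt_one (by positivity)]
      linarith
    · rw [div_mul_eq_mul_div, div_le_div_iff₀ (by positivity) (by norm_num)]
      nlinarith [mul_pos hε hε]
  have hθ : 0 < ε / 2 - α * c - (1 - α) * δ := by nlinarith [mul_pos hα hδ]
  have hsum := ((((hS.smul hα).add ((hT.pullback f).smul (one_half_pos (α := ℚ)))).add
    ((hH.pullback f).smul (one_half_pos (α := ℚ)))).add (hΔ.smul (sub_pos.mpr hα1))).add
    ((hA.pullback f).smul hθ)
  rw [map_sub, QCDiv.pullback_smul] at hsum
  simp only [Set.image_empty, Set.union_empty] at hsum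
  convert hsum using 1
  module

lemma hasRatios_add_smul_pullback {D : CDiv X} {A : QCDiv Y} {N n : ℕ} (hN : 0 < N) {E : CDiv Y}
    (hE : n • A = (1 : ℚ) ⊗ₜ[ℤ] E) {c : X.functionField} (hc0 : c ≠ 0)
    (hc : ∀ x, c ∈ (N • D + CDiv.pullback f E).stalk x) :
    HasRatios ((1 : ℚ) ⊗ₜ[ℤ] D + ((n : ℚ) / N) • QCDiv.pullback f A) ∅ := by
  refine ⟨N, hN, _, ?_, c, hc0, hc, fun z hz => hz.elim⟩
  have hN' : (N : ℚ) ≠ 0 := by exact_mod_cast hN.ne'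
  rw [tmul_add, tmul_smul, ← QCDiv.pullback_tmul, ← hE, map_nsmul, smul_add,
    ← Nat.cast_smul_eq_nsmul ℚ N (_ • _), smul_smul, mul_div_cancel₀ _ hN',
    Nat.cast_smul_eq_nsmul]

theorem IsFWP.exists_hasRatios {p : ℕ} (hp : p.Prime) (h : (p : Γ(Y, ⊤)) = 0) [JacobsonSpace Y]
    (hsep : IsSeparableMorphism f) (D : CDiv X) (e : ℕ) {M : Y.Modules}
    (i : M ⟶ (Scheme.Modules.pullback (absFrobenius hp h e)).obj
      ((Scheme.Modules.pushforward f).obj D.sheaf)) [Mono i] (hM0 : ¬ Limits.IsZero M)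
    (hM : IsFWP hp h M) :
    ∃ A : QCDiv Y, A.IsAmple ∧ ∀ ε : ℚ, 0 < ε → ∃ δ : ℚ, 0 < δ ∧ δ < ε ∧
      HasRatios ((1 : ℚ) ⊗ₜ[ℤ] D + δ • QCDiv.pullback f A) ∅ := by
  obtain ⟨hcoh, htf, A, hA, n, hn, hlim⟩ := hM
  refine ⟨A, hA, fun ε hε => ?_⟩
  obtain ⟨e', he', hlt⟩ := ((Filter.eventually_gt_atTop 0).and
    (hlim.eventually_lt_const (show (0 : ℝ) < (ε : ℝ) by exact_mod_cast hε))).exists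
  obtain ⟨hn0, E, hE, hG⟩ := hn e' he'
  obtain ⟨c, hc0, hc⟩ := IsFWP.exists_mem_stalk hp h hsep D e i hM0 hcoh htf e' E hG
  have hN : 0 < p ^ e' * p ^ e := Nat.mul_pos (pow_pos hp.pos _) (pow_pos hp.pos _)
  refine ⟨(n e' : ℚ) / ((p ^ e' * p ^ e : ℕ) : ℚ), by positivity, ?_,
    hasRatios_add_smul_pullback hN hE hc0 hc⟩
  have hltε : (n e' : ℚ) / (p : ℚ) ^ e' < ε := by
    rw [← Rat.cast_lt (K := ℝ)]
    push_cast
    exact hlt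
  refine lt_of_le_of_lt ?_ hltε
  have hpos : (0 : ℚ) < (p : ℚ) ^ e' := pow_pos (by exact_mod_cast hp.pos) _
  have hone : (1 : ℚ) ≤ (p : ℚ) ^ e := one_le_pow₀ (by exact_mod_cast hp.one_le)
  push_cast
  gcongr
  exact le_mul_of_one_le_right hpos.le hone

lemma add_natCast_le_of_forall {a b : WithBot ℕ∞} {n : ℕ}
    (h : ∀ m : ℕ, (m : WithBot ℕ∞) ≤ a → ((m + n : ℕ) : WithBot ℕ∞) ≤ b) : a + n ≤ b := by
  induction a using WithBot.recBotCoe with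
  | bot => simp
  | coe a =>
    induction a using ENat.recTopCoe with
    | top =>
      have hb (m : ℕ) : (m : WithBot ℕ∞) ≤ b :=
        le_trans (by exact_mod_cast Nat.le_add_right m n) (h m (WithBot.coe_le_coe.mpr le_top))
      induction b using WithBot.recBotCoe with
      | bot => simpa using hb 0
      | coe b =>
        have : b = ⊤ := ENat.eq_top_iff_forall_ge.mpr fun m => WithBot.coe_le_coe.mp (hb m)
        rw [this]
        exact le_top
    | coe a => exact_mod_cast h a le_rfl

end Assembly

end
end FWPKod

theorem mainTheorem5_general {k : Type u} [Field k] [Infinite k] {p : ℕ} (hp : p.Prime) [CharP k p]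
    {X Y : Scheme.{u}} [IsIntegral X] [IsIntegral Y] (f : X ⟶ Y) [IsDominant f]
    [LocallyOfFiniteType f] [QuasiCompact f] (hsep : IsSeparableMorphism f)
    (π : Y ⟶ Spec (.of k)) [LocallyOfFiniteType π] (D : CDiv X) (e : ℕ)
    (hFWP : ∃ (M : Y.Modules)
      (i : M ⟶ (Scheme.Modules.pullback (absFrobenius hp (natCast_eq_zero_of_charP p π) e)).obj
        ((Scheme.Modules.pushforward f).obj D.sheaf)),
      Mono i ∧ ¬ Limits.IsZero M ∧ IsFWP hp (natCast_eq_zero_of_charP p π) M)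
    (H : QCDiv Y) (hH : IsBig π H) :
    kappa (F := Y.residueField (genericPoint Y)) (f.fiberToSpecResidueField (genericPoint Y))
        ((1 : ℚ) ⊗ₜ[ℤ] CDiv.pullback (f.fiberι (genericPoint Y)) D) + topologicalKrullDim Y
      ≤ kappa (f ≫ π) ((1 : ℚ) ⊗ₜ[ℤ] D + QCDiv.pullback f H) := by
  have : JacobsonSpace Y := LocallyOfFiniteType.jacobsonSpace π
  obtain ⟨M, i, _, hM0, hM⟩ := hFWP
  obtain ⟨A, hA, hsmall⟩ := hM.exists_hasRatios hp _ hsep D e i hM0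
  obtain ⟨n, y, hdim, hy, hyH⟩ := hH.exists_hasRatios π
  obtain ⟨ε, hε, hHA⟩ := exists_hasRatios_sub_smul π hA hyH
    (letI := functionFieldAlgebra π; hy.isAlgebraic)
  obtain ⟨δ, hδ, hδε, hδD⟩ := hsmall (ε / 4) (by positivity)
  refine (add_le_add_right hdim _).trans (add_natCast_le_of_forall fun m hm => ?_)
  obtain ⟨z, hz, hzD⟩ := exists_algebraicIndependent_of_le_kappa
    (F := Y.residueField (genericPoint Y)) hm
  obtain ⟨z', hz', c, hc, hcD⟩ := HasRatios.of_fiber f hA D hzD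
  obtain rfl : functionFieldMap (f.fiberι (genericPoint Y)) ∘ z' = z := funext hz'
  obtain ⟨w, hw, hrange⟩ := exists_algebraicIndependent_range_eq f π hy.1
    (algebraicIndependent_of_fiber f hz)
  refine HasRatios.le_kappa hw ?_
  rw [hrange]
  exact hA.hasRatios.combine hc hcD hyH hε hHA hδ hδε hδD

theorem mainTheorem5 {k : Type u} [Field k] [IsAlgClosed k] {p : ℕ} (hp : p.Prime) [CharP k p]
    {X Y : Scheme.{u}} [IsIntegral X] [IsIntegral Y]
    (πX : X ⟶ Spec (.of k)) (πY : Y ⟶ Spec (.of k))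
    (hXn : IsNormalScheme X) (hYn : IsNormalScheme Y)
    (hXp : IsProjectiveOver πX) (hYp : IsProjectiveOver πY)
    (f : X ⟶ Y) (hf : f ≫ πY = πX) [IsFibration f] (hsep : IsSeparableMorphism f)
    (D : CDiv X) (e : ℕ) (he : 0 < e)
    (hFWP : ∃ (M : Y.Modules)
      (i : M ⟶ (Scheme.Modules.pullback (absFrobenius hp (natCast_eq_zero_of_charP p πY) e)).obj
        ((Scheme.Modules.pushforward f).obj D.sheaf)),
      Mono i ∧ ¬ Limits.IsZero M ∧ IsFWP hp (natCast_eq_zero_of_charP p πY) M)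
    (H : QCDiv Y) (hH : IsBig πY H) :
    kappa (F := Y.residueField (genericPoint Y)) (f.fiberToSpecResidueField (genericPoint Y))
        ((1 : ℚ) ⊗ₜ[ℤ] CDiv.pullback (f.fiberι (genericPoint Y)) D) + topologicalKrullDim Y
      ≤ kappa πX ((1 : ℚ) ⊗ₜ[ℤ] D + QCDiv.pullback f H) := by
  subst hf
  have := hXp.isProper
  have := hYp.isProper
  have := locallyOfFiniteType_of_comp f πY
  have : QuasiCompact f := .of_comp f πY
  exact mainTheorem5_general hp f hsep πY D e hFWP H hH
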